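/- Let $(N,g)$ be a smooth Riemannian manifold of dimension $n=2m$ with Levi-Civita connection $\nabla$, whose curvature is taken with the sign $R(X,Y)=\nabla_{[X,Y]}-[\nabla_X,\nabla_Y]$ and is regarded as a linear map on two-vectors, $R(X\wedge Y)=R(X,Y)$. For a skew-symmetric endomorphism $a$ of $T_pN$ let $a^\wedge\in\Lambda^2T_pN$ be the two-vector determined by $2g(a^\wedge,X\wedge Y)=g(aX,Y)$ for all $X,Y\in T_pN$, where $g(X_1\wedge X_2,X_3\wedge X_4)=\frac12[g(X_1,X_3)g(X_2,X_4)-g(X_1,X_4)g(X_2,X_3)]$. Let $\pi:\mathcal Z\to N$ be the twistor space of $(N,g)$, the bundle whose fibre at $p$ consists of the complex structures $I$ on $T_pN$ compatible with $g$, that is $I^2=-\mathrm{Id}$ and $g(Iv,Iw)=g(v,w)$. The vertical space $\mathcal V_I$ at $I$ (the tangent space of the fibre) is identified with the space of skew-symmetric endomorphisms of $T_pN$ anti-commuting with $I$; the Levi-Civita connection, acting on the bundle of endomorphisms of $TN$, gives a horizontal complement $\mathcal H_I$ to $\mathcal V_I$ in $T_I\mathcal Z$, and $X^h\in\mathcal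 H_I$ denotes the horizontal lift of $X\in T_pN$. For $t>0$ let $h_t$ be the Riemannian metric on $\mathcal Z$ for which $\mathcal H_I\perp\mathcal V_I$, $h_t(X^h,Y^h)=g(X,Y)$ and $h_t(A,B)=-\frac tn\mathrm{Tr}(A\circ B)$ for $A,B\in\mathcal V_I$. Let $J$ be a smooth almost complex structure on $N$ compatible with $g$, regarded as a map $J:(N,g)\to(\mathcal Z,h_t)$. Let $\widetilde\nabla J_*$ be its second fundamental form, that is the covariant derivative of its differential $J_*$, a section of $\mathrm{Hom}(TN,J^*T\mathcal Z)$, with respect to the connection induced by the Levi-Civita connections of $g$ and $h_t$. Put $\nabla^2_{XY}J=\nabla_X\nabla_YJ-\nabla_{\nabla_XY}J$, and for a skew-symmetric endomorphism $Q$ of $T_pN$ let $\mathcal V(Q)=\frac12(Q+J_pQJ_p)$ be its orthogonal projection onto $\mathcal V_{J(p)}$. Then, for all $p\in N$ and $X,Y\in T_pN$, $$\widetilde\nabla J_*(X,Y)=\frac12\,\mathcal V\big(\nabla^2_{XY}J+\nabla^2_{YX}J\big)-\frac{2t}{n}\Big[\big(R((J\circ\nabla_XJ)^\wedge)Y\big)^h_{J(p)}+\big(R((J\circ\nabla_YJ)^\wedge)X\big)^h_{J(p)}\Big].$$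 -/

import Mathlib

set_option maxSynthPendingDepth 3

open scoped Manifold ContDiff Topology

noncomputable section

namespace Twistor

/-! ### Riemannian geometry in charts -/

section Riemannian

variable {E : Type*} [NormedAddCommGroup E] [NormedSpace ℝ E]
  {M : Type*} [TopologicalSpace M] [ChartedSpace E M]

/-- Fields of bilinear forms on the tangent spaces of `M` (for instance Riemannian metrics). -/
abbrev BilinField (E : Type*) [NormedAddCommGroup E] [NormedSpace ℝ E]
    (M : Type*) [TopologicalSpace M] [ChartedSpace E M] : Type _ :=
  (q : M) → TangentSpace 𝓘(ℝ, E) q →L[ℝ] TangentSpace 𝓘(ℝ, E) q →L[ℝ] ℝ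

/-- Fields of endomorphisms of the tangent spaces of `M`. -/
abbrev EndField (E : Type*) [NormedAddCommGroup E] [NormedSpace ℝ E]
    (M : Type*) [TopologicalSpace M] [ChartedSpace E M] : Type _ :=
  (q : M) → TangentSpace 𝓘(ℝ, E) q →L[ℝ] TangentSpace 𝓘(ℝ, E) q

/-- The coordinate frame of the chart at `p`, at the point with coordinates `y`. -/
def coordFrame (p : M) (y : E) : E →L[ℝ] TangentSpace 𝓘(ℝ, E) ((extChartAt 𝓘(ℝ, E) p).symm y) :=
  mfderiv 𝓘(ℝ, E) 𝓘(ℝ, E) (extChartAt 𝓘(ℝ, E) p).symm y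

/-- The dual coframe: the differential of the chart at `p`, at the point with coordinates `y`. -/
def coordCoframe (p : M) (y : E) :
    TangentSpace 𝓘(ℝ, E) ((extChartAt 𝓘(ℝ, E) p).symm y) →L[ℝ] E :=
  mfderiv 𝓘(ℝ, E) 𝓘(ℝ, E) (extChartAt 𝓘(ℝ, E) p) ((extChartAt 𝓘(ℝ, E) p).symm y)

/-- The components `h_{ij}` of `h` in the chart at `p`, at the point with coordinates `y`. -/
def coordMetric (h : BilinField E M) (p : M) (y : E) : E →L[ℝ] E →L[ℝ] ℝ :=
  let B : E →L[ℝ] E →L[ℝ] ℝ := h ((extChartAt 𝓘(ℝ, E) p).symm y)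
  let D : E →L[ℝ] E := coordFrame p y
  B.bilinearComp D D

/-- The components of an endomorphism field in the chart at `p`. -/
def coordEnd (K : EndField E M) (p : M) (y : E) : E →L[ℝ] E :=
  (coordCoframe p y).comp ((K ((extChartAt 𝓘(ℝ, E) p).symm y)).comp (coordFrame p y))

/-- The Christoffel symbols of the first kind,
`Γ(u, v; w) = ½ (∂_u h(v, w) + ∂_v h(u, w) - ∂_w h(u, v))`, in the chart at `p`. -/
def christoffelFirst (h : BilinField E M) (p : M) (y : E) : E →L[ℝ] E →L[ℝ] E →L[ℝ] ℝ :=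
  let D : E →L[ℝ] E →L[ℝ] E →L[ℝ] ℝ := fderiv ℝ (coordMetric h p) y
  (1 / 2 : ℝ) • (D + D.flip -
    (ContinuousLinearMap.flipₗᵢ ℝ E E ℝ).toContinuousLinearEquiv.toContinuousLinearMap.comp D.flip)

theorem christoffelFirst_apply (h : BilinField E M) (p : M) (y u v w : E) :
    christoffelFirst h p y u v w = (1 / 2 : ℝ) * (fderiv ℝ (coordMetric h p) y u v w +
      fderiv ℝ (coordMetric h p) y v u w - fderiv ℝ (coordMetric h p) y w u v) := rfl

/-- The Christoffel symbols of the Levi-Civita connection of `h` in the chart at `p`: the vector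
`Γ(u, v)` with `h(Γ(u, v), w) = Γ(u, v; w)` for all `w`. -/
def christoffel (h : BilinField E M) (p : M) (y : E) : E →L[ℝ] E →L[ℝ] E :=
  (ContinuousLinearMap.compL ℝ E (E →L[ℝ] ℝ) E (coordMetric h p y).inverse).comp
    (christoffelFirst h p y)

theorem christoffel_apply (h : BilinField E M) (p : M) (y u v : E) :
    christoffel h p y u v = (coordMetric h p y).inverse (christoffelFirst h p y u v) := rfl

/-- The commutator `A ↦ A B - B A`. -/
def commutator (B : E →L[ℝ] E) : (E →L[ℝ] E) →L[ℝ] (E →L[ℝ] E) :=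
  (ContinuousLinearMap.mul ℝ (E →L[ℝ] E)).flip B - ContinuousLinearMap.mul ℝ (E →L[ℝ] E) B

theorem commutator_apply (A B : E →L[ℝ] E) : commutator B A = A * B - B * A := rfl

/-- The covariant derivative of an endomorphism field in the chart at `p`:
`(∇_u K) = ∂_u K + [Γ(u, ·), K]`. -/
def coordNabla (h : BilinField E M) (K : EndField E M) (p : M) (y : E) :
    E →L[ℝ] (E →L[ℝ] E) :=
  fderiv ℝ (coordEnd K p) y + (commutator (coordEnd K p y)).comp (christoffel h p y)

/-- The covariant derivative `∇_X K` at `p` of an endomorphism field with respect to the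
Levi-Civita connection of `h`. -/
def nabla (h : BilinField E M) (K : EndField E M) (p : M) (X : TangentSpace 𝓘(ℝ, E) p) :
    TangentSpace 𝓘(ℝ, E) p →L[ℝ] TangentSpace 𝓘(ℝ, E) p :=
  coordNabla h K p (extChartAt 𝓘(ℝ, E) p p) X

/-- The second covariant derivative `∇²_{XY} K = ∇_X ∇_Y K - ∇_{∇_X Y} K` at `p`, in the chart at
`p`: the covariant derivative of `∇ K`, a one-form with values in the endomorphisms. -/
def nablaSq (h : BilinField E M) (K : EndField E M) (p : M) (X Y : TangentSpace 𝓘(ℝ, E) p) :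
    TangentSpace 𝓘(ℝ, E) p →L[ℝ] TangentSpace 𝓘(ℝ, E) p :=
  let y : E := extChartAt 𝓘(ℝ, E) p p
  let u : E := X
  let v : E := Y
  let Γ : E →L[ℝ] E →L[ℝ] E := christoffel h p y
  fderiv ℝ (coordNabla h K p) y u v + commutator (coordNabla h K p y v) (Γ u)
    - coordNabla h K p y (Γ u v)

/-- The curvature tensor in the chart at `p`, with the sign `R(X, Y) = ∇_{[X, Y]} - [∇_X, ∇_Y]`:
`R(u, v) = ∂_v Γ(u) - ∂_u Γ(v) + Γ(v) Γ(u) - Γ(u) Γ(v)`. -/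
def coordCurvature (h : BilinField E M) (p : M) (y : E) : E [⋀^Fin 2]→ₗ[ℝ] (E →L[ℝ] E) where
  toFun a := fderiv ℝ (christoffel h p) y (a 1) (a 0) - fderiv ℝ (christoffel h p) y (a 0) (a 1)
    + commutator (christoffel h p y (a 0)) (christoffel h p y (a 1))
  map_update_add' a i x y := by
    fin_cases i <;> simp [commutator_apply, add_mul, mul_add] <;> abel
  map_update_smul' a i c x := by
    fin_cases i <;> simp [commutator_apply, smul_sub, smul_add]
  map_eq_zero_of_eq' a i j hij hne := by
    have h01 : a 0 = a 1 := by
      fin_cases i <;> fin_cases j <;> first | exact absurd rfl hne | exact hij | exact hij.symm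
    simp [commutator_apply, h01]

/-- The curvature tensor at `p` as a linear map on two-vectors, `R(X ∧ Y) = R(X, Y)`. -/
def curvature (h : BilinField E M) (p : M) :
    ⋀[ℝ]^2 (TangentSpace 𝓘(ℝ, E) p) →ₗ[ℝ]
      (TangentSpace 𝓘(ℝ, E) p →L[ℝ] TangentSpace 𝓘(ℝ, E) p) :=
  let R : E [⋀^Fin 2]→ₗ[ℝ] (E →L[ℝ] E) := coordCurvature h p (extChartAt 𝓘(ℝ, E) p p)
  let R' : TangentSpace 𝓘(ℝ, E) p [⋀^Fin 2]→ₗ[ℝ]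
    (TangentSpace 𝓘(ℝ, E) p →L[ℝ] TangentSpace 𝓘(ℝ, E) p) := R
  exteriorPower.alternatingMapLinearEquiv R'

variable {E' : Type*} [NormedAddCommGroup E'] [NormedSpace ℝ E']
  {M' : Type*} [TopologicalSpace M'] [ChartedSpace E' M']

/-- The second fundamental form `∇ φ_*` of a map `φ : (M, g) → (M', h)`, that is the covariant
derivative of its differential, a section of `Hom(TM, φ^* TM')`, with respect to the connection
induced by the two Levi-Civita connections. In the charts at `p` and `φ p`,
`(∇ φ_*)(X, Y) = ∂_X ∂_Y φ - φ_* Γ(X, Y) + Γ'(φ_* X, φ_* Y)`. -/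
def secondFundamentalForm (g : BilinField E M) (h : BilinField E' M') (φ : M → M') (p : M)
    (X Y : TangentSpace 𝓘(ℝ, E) p) : TangentSpace 𝓘(ℝ, E') (φ p) :=
  let x : E := extChartAt 𝓘(ℝ, E) p p
  let u : E := X
  let v : E := Y
  let f : E → E' := writtenInExtChartAt 𝓘(ℝ, E) 𝓘(ℝ, E') p φ
  let r : E' := fderiv ℝ (fderiv ℝ f) x u v - fderiv ℝ f x (christoffel g p x u v)
    + christoffel h (φ p) (extChartAt 𝓘(ℝ, E') (φ p) (φ p)) (fderiv ℝ f x u) (fderiv ℝ f x v)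
  r

end Riemannian

/-! ### The manifold of compatible linear complex structures -/

section Linear

/-- The standard Euclidean space of dimension `2m`. -/
abbrev Std (m : ℕ) : Type := EuclideanSpace ℝ (Fin m ⊕ Fin m)

/-- The standard complex structure `J₀ e_k = e_{m+k}`, `J₀ e_{m+k} = -e_k`. -/
def stdJ (m : ℕ) : Std m →L[ℝ] Std m :=
  LinearMap.toContinuousLinearMap
    { toFun := fun v ↦ WithLp.toLp 2 (Sum.elim (fun k ↦ -v (Sum.inr k)) (fun k ↦ v (Sum.inl k)))
      map_add' := by
        intro v w
        ext i
        cases i <;> simp [add_comm]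
      map_smul' := by
        intro c v
        ext i
        cases i <;> simp }

variable {m : ℕ}

theorem stdJ_inl (v : Std m) (k : Fin m) : stdJ m v (Sum.inl k) = -v (Sum.inr k) := rfl

theorem stdJ_inr (v : Std m) (k : Fin m) : stdJ m v (Sum.inr k) = v (Sum.inl k) := rfl

theorem stdJ_mul_self : stdJ m * stdJ m = -1 := by
  ext v i
  cases i <;> simp [stdJ_inl, stdJ_inr]

theorem star_stdJ : star (stdJ m) = -stdJ m := by
  rw [ContinuousLinearMap.star_eq_adjoint]
  symm
  rw [ContinuousLinearMap.eq_adjoint_iff]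
  intro x y
  simp [PiLp.inner_apply, Fintype.sum_sum_type, stdJ_inl, stdJ_inr, add_comm]

/-- The tangent space at the standard complex structure to the manifold of orthogonal complex
structures: the skew-symmetric endomorphisms anti-commuting with the complex structure. -/
def StdTangent (m : ℕ) : Submodule ℝ (Std m →L[ℝ] Std m) where
  carrier := {A | star A = -A ∧ A * stdJ m = -(stdJ m * A)}
  add_mem' := by
    rintro A B ⟨h1, h2⟩ ⟨h3, h4⟩
    refine ⟨by rw [star_add, h1, h3]; abel, by rw [add_mul, h2, h4, mul_add]; abel⟩
  zero_mem' := by simp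
  smul_mem' := by
    rintro c A ⟨h1, h2⟩
    refine ⟨by simp [h1], by simp [h2]⟩

theorem isUnit_one_add {A : Std m →L[ℝ] Std m} (hA : star A = -A) : IsUnit (1 + A) := by
  rw [ContinuousLinearMap.star_eq_adjoint] at hA
  have hinj : Function.Injective (1 + A : Std m →L[ℝ] Std m) := by
    rw [injective_iff_map_eq_zero]
    intro v hv
    have h1 : inner ℝ (A v) v = 0 := by
      have h2 : inner ℝ (A v) v = inner ℝ v (ContinuousLinearMap.adjoint A v) := by
        rw [ContinuousLinearMap.adjoint_inner_right]
      rw [hA, real_inner_comm] at h2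
      have h3 : inner ℝ v (A v) = - inner ℝ v (A v) := by
        simpa [inner_neg_right] using h2
      rw [real_inner_comm]
      linarith
    have h4 : inner ℝ ((1 + A) v) v = 0 := by rw [hv]; simp
    have h5 : inner ℝ ((1 + A) v) v = inner ℝ v v + inner ℝ (A v) v := by
      simp [inner_add_left]
    rw [h4, h1, add_zero] at h5
    exact inner_self_eq_zero.1 h5.symm
  rw [ContinuousLinearMap.isUnit_iff_bijective]
  exact ⟨hinj, (LinearMap.injective_iff_surjective (f := (1 + A).toLinearMap)).1 hinj⟩

/-- Inverse Cayley transform: `A ↦ (1 + A) J₀ (1 + A)⁻¹`. -/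
def cayleyInv (A : Std m →L[ℝ] Std m) : Std m →L[ℝ] Std m :=
  (1 + A) * stdJ m * Ring.inverse (1 + A)

/-- Cayley transform: `I ↦ (1 + J₀ I) (1 - J₀ I)⁻¹`. -/
def cayley (I : Std m →L[ℝ] Std m) : Std m →L[ℝ] Std m :=
  (1 + stdJ m * I) * Ring.inverse (1 - stdJ m * I)

theorem cayleyInv_mul_self {A : Std m →L[ℝ] Std m} (hA : A ∈ StdTangent m) :
    cayleyInv A * cayleyInv A = -1 := by
  obtain ⟨u, hu⟩ := isUnit_one_add hA.1
  simp only [cayleyInv, ← hu, Ring.inverse_unit]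
  calc (u : Std m →L[ℝ] Std m) * stdJ m * ↑u⁻¹ * (↑u * stdJ m * ↑u⁻¹)
      = u * stdJ m * (↑u⁻¹ * ↑u) * stdJ m * ↑u⁻¹ := by simp only [mul_assoc]
    _ = u * (stdJ m * stdJ m) * ↑u⁻¹ := by simp [mul_assoc]
    _ = -1 := by simp [stdJ_mul_self]

theorem star_cayleyInv {A : Std m →L[ℝ] Std m} (hA : A ∈ StdTangent m) :
    star (cayleyInv A) = -cayleyInv A := by
  obtain ⟨u, hu⟩ := isUnit_one_add hA.1
  have hw : star (u : Std m →L[ℝ] Std m) = 1 - A := by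
    rw [hu, star_add, star_one, hA.1]; abel
  have hcomm : star (u : Std m →L[ℝ] Std m) * u * stdJ m
      = stdJ m * (star (u : Std m →L[ℝ] Std m) * u) := by
    rw [hw, hu]
    have h1 : A * A * stdJ m = stdJ m * (A * A) := by
      rw [mul_assoc, hA.2, mul_neg, ← mul_assoc, hA.2, neg_mul, neg_neg, mul_assoc]
    have h2 : (1 - A) * (1 + A) = 1 - A * A := by noncomm_ring
    rw [h2, sub_mul, mul_sub, h1, one_mul, mul_one]
  have hcomm' : ((star u : (Std m →L[ℝ] Std m)ˣ) : Std m →L[ℝ] Std m) * u * stdJ m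
      = stdJ m * (((star u : (Std m →L[ℝ] Std m)ˣ) : Std m →L[ℝ] Std m) * u) := hcomm
  simp only [cayleyInv, ← hu, Ring.inverse_unit, star_mul, star_stdJ]
  change (((star u)⁻¹ : (Std m →L[ℝ] Std m)ˣ) : Std m →L[ℝ] Std m) *
    (-stdJ m * ((star u : (Std m →L[ℝ] Std m)ˣ) : Std m →L[ℝ] Std m)) = _
  rw [neg_mul, mul_neg, neg_inj, Units.inv_mul_eq_iff_eq_mul, ← mul_assoc, ← mul_assoc,
    Units.eq_mul_inv_iff_mul_eq, hcomm', mul_assoc]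

theorem isUnit_and_inverse_eq {R : Type*} [Ring R] {a b : R} (h1 : a * b = 1) (h2 : b * a = 1) :
    IsUnit a ∧ Ring.inverse a = b :=
  ⟨⟨⟨a, b, h1, h2⟩, rfl⟩, Ring.inverse_unit ⟨a, b, h1, h2⟩⟩

theorem cayley_cayleyInv {A : Std m →L[ℝ] Std m} (hA : A ∈ StdTangent m) :
    IsUnit (1 - stdJ m * cayleyInv A) ∧ cayley (cayleyInv A) = A := by
  obtain ⟨u, hu⟩ := isUnit_one_add hA.1
  have hJu : stdJ m * (u : Std m →L[ℝ] Std m) * stdJ m = -(1 - A) := by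
    have h1 : (u : Std m →L[ℝ] Std m) * stdJ m = stdJ m * (1 - A) := by
      rw [hu, add_mul, hA.2, mul_sub]; simp [sub_eq_add_neg]
    rw [mul_assoc, h1, ← mul_assoc, stdJ_mul_self, neg_one_mul]
  have h2 : stdJ m * cayleyInv A = -((1 - A) * ↑u⁻¹) := by
    simp only [cayleyInv, ← hu, Ring.inverse_unit]
    rw [← mul_assoc, ← mul_assoc, hJu, neg_mul]
  have hone : (1 : Std m →L[ℝ] Std m) = (1 + A) * ↑u⁻¹ := by rw [← hu, Units.mul_inv]
  have h3 : 1 - stdJ m * cayleyInv A = (2 : ℝ) • (↑u⁻¹ : Std m →L[ℝ] Std m) := by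
    rw [h2]
    nth_rewrite 1 [hone]
    rw [sub_neg_eq_add, ← add_mul, show (1 + A + (1 - A) : Std m →L[ℝ] Std m) = (2 : ℝ) • 1 by
      module, smul_mul_assoc, one_mul]
  have h4 : 1 + stdJ m * cayleyInv A = (2 : ℝ) • (A * (↑u⁻¹ : Std m →L[ℝ] Std m)) := by
    rw [h2]
    nth_rewrite 1 [hone]
    rw [← sub_eq_add_neg, ← sub_mul, show (1 + A - (1 - A) : Std m →L[ℝ] Std m) = (2 : ℝ) • A by
      module, smul_mul_assoc]
  obtain ⟨h5, h6⟩ := isUnit_and_inverse_eq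
    (a := (2 : ℝ) • (↑u⁻¹ : Std m →L[ℝ] Std m)) (b := (1 / 2 : ℝ) • (u : Std m →L[ℝ] Std m))
    (by rw [smul_mul_smul_comm]; simp) (by rw [smul_mul_smul_comm]; simp)
  refine ⟨h3 ▸ h5, ?_⟩
  rw [cayley, h3, h4, h6, smul_mul_smul_comm, mul_assoc, Units.inv_mul]
  norm_num

theorem cayleyInv_cayley {I : Std m →L[ℝ] Std m} (hI : I * I = -1) (hs : star I = -I)
    (hv : IsUnit (1 - stdJ m * I)) : cayley I ∈ StdTangent m ∧ cayleyInv (cayley I) = I := by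
  obtain ⟨v, hv⟩ := hv
  have hJ : stdJ m * stdJ m = -1 := stdJ_mul_self
  have hstar : star (v : Std m →L[ℝ] Std m) = 1 - I * stdJ m := by
    rw [hv, star_sub, star_one, star_mul, hs, star_stdJ, neg_mul_neg]
  have hA : cayley I = (1 + stdJ m * I) * ↑v⁻¹ := by rw [cayley, ← hv, Ring.inverse_unit]
  have hJv : stdJ m * (v : Std m →L[ℝ] Std m) = v * I := by
    rw [hv, mul_sub, sub_mul, ← mul_assoc, hJ, mul_assoc, hI]; simp [add_comm]
  have hvJ : (↑v⁻¹ : Std m →L[ℝ] Std m) * stdJ m = I * ↑v⁻¹ := by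
    rw [Units.inv_mul_eq_iff_eq_mul, ← mul_assoc, Units.eq_mul_inv_iff_mul_eq, hJv]
  have hone : 1 + cayley I = (2 : ℝ) • (↑v⁻¹ : Std m →L[ℝ] Std m) := by
    have h1 : (1 : Std m →L[ℝ] Std m) = (1 - stdJ m * I) * ↑v⁻¹ := by rw [← hv, Units.mul_inv]
    rw [hA]
    nth_rewrite 1 [h1]
    rw [← add_mul, show (1 - stdJ m * I + (1 + stdJ m * I) : Std m →L[ℝ] Std m) = (2 : ℝ) • 1 by
      module, smul_mul_assoc, one_mul]
  refine ⟨⟨?_, ?_⟩, ?_⟩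
  · have hsv : star (↑v⁻¹ : Std m →L[ℝ] Std m) =
        (((star v)⁻¹ : (Std m →L[ℝ] Std m)ˣ) : Std m →L[ℝ] Std m) := rfl
    have hsv' : ((star v : (Std m →L[ℝ] Std m)ˣ) : Std m →L[ℝ] Std m) = 1 - I * stdJ m := hstar
    rw [hA, star_mul, hsv, Units.inv_mul_eq_iff_eq_mul, hsv', mul_neg, ← mul_assoc, ← neg_mul,
      Units.eq_mul_inv_iff_mul_eq, hv, star_add, star_one, star_mul, hs, star_stdJ, neg_mul_neg]
    have h1 : I * stdJ m * (stdJ m * I) = 1 := by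
      rw [mul_assoc, ← mul_assoc (stdJ m), hJ, neg_one_mul, mul_neg, hI, neg_neg]
    rw [add_mul, sub_mul, mul_sub, mul_add, mul_sub, mul_add, h1]
    noncomm_ring
  · rw [hA, mul_assoc, hvJ, ← mul_assoc, ← mul_assoc, ← neg_mul, add_mul, mul_assoc (stdJ m) I I,
      hI, mul_add, ← mul_assoc (stdJ m) (stdJ m), hJ]
    congr 1
    simp
  · obtain ⟨-, h6⟩ := isUnit_and_inverse_eq
      (a := (2 : ℝ) • (↑v⁻¹ : Std m →L[ℝ] Std m)) (b := (1 / 2 : ℝ) • (v : Std m →L[ℝ] Std m))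
      (by rw [smul_mul_smul_comm]; simp) (by rw [smul_mul_smul_comm]; simp)
    rw [cayleyInv, hone, h6, smul_mul_assoc, smul_mul_smul_comm, mul_assoc, hJv, ← mul_assoc,
      Units.inv_mul]
    norm_num

/-- A linear projection onto the tangent space at the standard complex structure. -/
def stdProj (m : ℕ) : (Std m →L[ℝ] Std m) →L[ℝ] StdTangent m :=
  let P : (Std m →L[ℝ] Std m) →ₗ[ℝ] (Std m →L[ℝ] Std m) :=
    { toFun := fun A ↦ (1 / 4 : ℝ) • ((A - star A) + stdJ m * (A - star A) * stdJ m)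
      map_add' := by
        intro A B
        rw [star_add, show A + B - (star A + star B) = (A - star A) + (B - star B) by abel,
          mul_add, add_mul]
        module
      map_smul' := by
        intro c A
        simp only [star_smul, star_trivial, ← smul_sub, mul_smul_comm, smul_mul_assoc,
          RingHom.id_apply]
        module }
  LinearMap.toContinuousLinearMap (P.codRestrict (StdTangent m) (by
    intro A
    have hJ : stdJ m * stdJ m = -1 := stdJ_mul_self
    constructor
    · simp only [P, LinearMap.coe_mk, AddHom.coe_mk, star_smul, star_trivial, star_add, star_sub,
        star_star, star_mul, star_stdJ]
      rw [← smul_neg]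
      congr 1
      noncomm_ring
    · simp only [P, LinearMap.coe_mk, AddHom.coe_mk, smul_mul_assoc, mul_smul_comm]
      rw [← smul_neg]
      congr 1
      rw [add_mul, mul_add, mul_assoc _ (stdJ m) (stdJ m), hJ, ← mul_assoc, ← mul_assoc, hJ]
      noncomm_ring))

theorem stdProj_of_mem {A : Std m →L[ℝ] Std m} (hA : A ∈ StdTangent m) :
    stdProj m A = ⟨A, hA⟩ := by
  apply Subtype.ext
  change (1 / 4 : ℝ) • ((A - star A) + stdJ m * (A - star A) * stdJ m) = A
  have h : stdJ m * A * stdJ m = A := by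
    rw [mul_assoc, hA.2, mul_neg, ← mul_assoc, stdJ_mul_self]; simp
  rw [hA.1, sub_neg_eq_add, mul_add, add_mul, h]
  module

end Linear

/-! ### Orthonormal frames -/

section Frames

/-- The model space of a manifold of dimension `n = 2m`. -/
abbrev Model (m : ℕ) : Type := EuclideanSpace ℝ (Fin (2 * m))

variable {m : ℕ}

variable {V : Type*} [AddCommGroup V] [Module ℝ V] [TopologicalSpace V] [IsTopologicalAddGroup V]
  [ContinuousSMul ℝ V] [FiniteDimensional ℝ V]

theorem exists_adapted_aux (B : V →L[ℝ] V →L[ℝ] ℝ) (hsymm : ∀ v w, B v w = B w v)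
    (hpos : ∀ v, v ≠ 0 → 0 < B v v) (J : V →L[ℝ] V) (hJ : ∀ v, J (J v) = -v)
    (hB : ∀ v w, B (J v) (J w) = B v w) (hdim : Module.finrank ℝ V = 2 * m)
    (k : ℕ) (hk : k ≤ m) :
    ∃ b : Fin k → V, (∀ i j, B (b i) (b j) = if i = j then 1 else 0) ∧
      ∀ i j, B (b i) (J (b j)) = 0 := by
  induction k with
  | zero => exact ⟨Fin.elim0, fun i ↦ i.elim0, fun i ↦ i.elim0⟩
  | succ k ih =>
    obtain ⟨b, hb, hbJ⟩ := ih (by omega)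
    let L : V →ₗ[ℝ] (Fin k → ℝ) × (Fin k → ℝ) :=
      (LinearMap.pi fun i ↦ (B (b i)).toLinearMap).prod
        (LinearMap.pi fun i ↦ (B (J (b i))).toLinearMap)
    have hker : LinearMap.ker L ≠ ⊥ := by
      apply LinearMap.ker_ne_bot_of_finrank_lt
      simp [Module.finrank_prod, hdim]
      omega
    obtain ⟨w, hw, hw0⟩ := (Submodule.ne_bot_iff _).1 hker
    have hw1 : ∀ i, B (b i) w = 0 := fun i ↦
      congrFun (congrArg Prod.fst (LinearMap.mem_ker.1 hw)) i
    have hw2 : ∀ i, B (J (b i)) w = 0 := fun i ↦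
      congrFun (congrArg Prod.snd (LinearMap.mem_ker.1 hw)) i
    have hJw : B w (J w) = 0 := by
      have h1 := hB w (J w)
      rw [hJ, map_neg, hsymm (J w) w] at h1
      linarith
    have hbw : ∀ i, B (b i) (J w) = 0 := by
      intro i
      have h1 := hB (b i) (J w)
      rw [hJ, map_neg, hw2 i] at h1
      linarith
    have hwp := hpos w hw0
    set c : ℝ := (√(B w w))⁻¹ with hc
    have hcc : c * (c * B w w) = 1 := by
      have h1 : √(B w w) ≠ 0 := (Real.sqrt_pos.2 hwp).ne'
      have h2 : √(B w w) * √(B w w) = B w w := Real.mul_self_sqrt hwp.le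
      rw [hc]
      nth_rewrite 3 [← h2]
      field_simp
    refine ⟨Fin.snoc b (c • w), ?_, ?_⟩
    · intro i j
      refine Fin.lastCases ?_ (fun i ↦ ?_) i <;> refine Fin.lastCases ?_ (fun j ↦ ?_) j
      · simpa using hcc
      · simp [hsymm w (b j), hw1, (Fin.castSucc_lt_last j).ne']
      · simp [hw1, (Fin.castSucc_lt_last i).ne]
      · simp [hb]
    · intro i j
      refine Fin.lastCases ?_ (fun i ↦ ?_) i <;> refine Fin.lastCases ?_ (fun j ↦ ?_) j
      · simp [hJw]
      · simp [hsymm w (J (b j)), hw2]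
      · simp [hbw]
      · simp [hbJ]

/-- An orthonormal basis `e_1, ..., e_m, J e_1, ..., J e_m`. -/
theorem exists_adapted (B : V →L[ℝ] V →L[ℝ] ℝ) (hsymm : ∀ v w, B v w = B w v)
    (hpos : ∀ v, v ≠ 0 → 0 < B v v) (J : V →L[ℝ] V) (hJ : ∀ v, J (J v) = -v)
    (hB : ∀ v w, B (J v) (J w) = B v w)
    (hdim : Module.finrank ℝ V = 2 * m) :
    ∃ b : Fin m ⊕ Fin m → V, (∀ i j, B (b i) (b j) = if i = j then 1 else 0) ∧
      ∀ k, J (b (Sum.inl k)) = b (Sum.inr k) := by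
  obtain ⟨b, hb, hbJ⟩ := exists_adapted_aux B hsymm hpos J hJ hB hdim m le_rfl
  refine ⟨Sum.elim b (fun k ↦ J (b k)), ?_, fun k ↦ rfl⟩
  rintro (i | i) (j | j)
  · simp [hb]
  · simp [hbJ]
  · simp [hsymm _ (b j), hbJ]
  · simp [hB, hb]

variable {N : Type*} [TopologicalSpace N] [ChartedSpace (Model m) N]
  [IsManifold 𝓘(ℝ, Model m) ∞ N]

/-- Smooth Riemannian metrics on a manifold of dimension `2m`. -/
abbrev Metric (m : ℕ) (N : Type*) [TopologicalSpace N] [ChartedSpace (Model m) N]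
    [IsManifold 𝓘(ℝ, Model m) ∞ N] : Type _ :=
  Bundle.ContMDiffRiemannianMetric 𝓘(ℝ, Model m) ∞ (Model m)
    (fun q : N ↦ TangentSpace 𝓘(ℝ, Model m) q)

/-- Smoothness of a vector field on a set. -/
abbrev SmoothField (U : Set N) (s : (q : N) → TangentSpace 𝓘(ℝ, Model m) q) : Prop :=
  ContMDiffOn 𝓘(ℝ, Model m) (𝓘(ℝ, Model m).prod 𝓘(ℝ, Model m)) ∞
    (fun q ↦ Bundle.TotalSpace.mk' (Model m) q (s q)) U

instance (q : N) : FiniteDimensional ℝ (TangentSpace 𝓘(ℝ, Model m) q) :=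
  inferInstanceAs (FiniteDimensional ℝ (Model m))

theorem finrank_tangentSpace (q : N) :
    Module.finrank ℝ (TangentSpace 𝓘(ℝ, Model m) q) = 2 * m :=
  (finrank_euclideanSpace (𝕜 := ℝ)).trans (Fintype.card_fin _)

theorem smooth_inner (g : Metric m N) {U : Set N} {s t : (q : N) → TangentSpace 𝓘(ℝ, Model m) q}
    (hs : SmoothField U s) (ht : SmoothField U t) :
    ContMDiffOn 𝓘(ℝ, Model m) 𝓘(ℝ) ∞ (fun q ↦ g.inner q (s q) (t q)) U := by
  intro q hq
  have h : ContMDiffWithinAt 𝓘(ℝ, Model m) (𝓘(ℝ, Model m).prod 𝓘(ℝ)) ∞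
      (fun q ↦ Bundle.TotalSpace.mk' ℝ (E := Bundle.Trivial N ℝ) q (g.inner q (s q) (t q))) U q := by
    apply ContMDiffWithinAt.clm_bundle_apply₂ (F₁ := Model m) (F₂ := Model m)
    · exact (g.contMDiff q).contMDiffWithinAt
    · exact hs q hq
    · exact ht q hq
  simp only [Bundle.contMDiffWithinAt_totalSpace] at h
  exact h.2

theorem smooth_extend (p : N) (v : TangentSpace 𝓘(ℝ, Model m) p) :
    SmoothField (chartAt (Model m) p).source (FiberBundle.extend (Model m) v) := by
  have h := (trivializationAt (Model m) (TangentSpace 𝓘(ℝ, Model m) : N → Type _)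
    p).contMDiffOn_section_baseSet_iff (IB := 𝓘(ℝ, Model m)) (n := ∞)
      (s := FiberBundle.extend (Model m) v)
  refine h.2 ((contMDiffOn_const (c := (trivializationAt (Model m)
    (TangentSpace 𝓘(ℝ, Model m) : N → Type _) p ⟨p, v⟩).2)).congr ?_)
  intro y hy
  simp only [FiberBundle.extend]
  rw [Bundle.Trivialization.apply_mk_symm _ hy]

/-- Gram-Schmidt. -/
theorem exists_frame (g : Metric m N) (p : N) (k : ℕ) (b : Fin k → TangentSpace 𝓘(ℝ, Model m) p)
    (hb : ∀ i j, g.inner p (b i) (b j) = if i = j then 1 else 0) :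
    ∃ (U : Set N) (s : Fin k → (q : N) → TangentSpace 𝓘(ℝ, Model m) q), IsOpen U ∧ p ∈ U ∧
      (∀ i, SmoothField U (s i)) ∧
      (∀ q ∈ U, ∀ i j, g.inner q (s i q) (s j q) = if i = j then 1 else 0) ∧
      ∀ i, s i p = b i := by
  induction k with
  | zero => exact ⟨Set.univ, Fin.elim0, isOpen_univ, trivial, fun i ↦ i.elim0,
      fun _ _ i ↦ i.elim0, fun i ↦ i.elim0⟩
  | succ k ih =>
    obtain ⟨U, s, hU, hpU, hs, ho, hsp⟩ := ih (fun i ↦ b i.castSucc) (by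
      intro i j
      rw [hb]
      simp)
    set V : Set N := U ∩ (chartAt (Model m) p).source with hV
    have hVo : IsOpen V := hU.inter (chartAt (Model m) p).open_source
    have hpV : p ∈ V := ⟨hpU, mem_chart_source _ _⟩
    let e : (q : N) → TangentSpace 𝓘(ℝ, Model m) q := FiberBundle.extend (Model m) (b (Fin.last k))
    have he : SmoothField V e := (smooth_extend p _).mono Set.inter_subset_right
    have hsV : ∀ i, SmoothField V (s i) := fun i ↦ (hs i).mono Set.inter_subset_left
    let w : (q : N) → TangentSpace 𝓘(ℝ, Model m) q :=
      fun q ↦ e q - ∑ i, g.inner q (s i q) (e q) • s i q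
    have hw : SmoothField V w :=
      he.sub_section (ContMDiffOn.sum_section
        (fun i _ ↦ (smooth_inner g (hsV i) he).smul_section (hsV i)))
    have hwp : w p = b (Fin.last k) := by
      have : ∀ i, g.inner p (s i p) (e p) = 0 := by
        intro i
        simp only [e, FiberBundle.extend_apply_self, hsp, hb]
        simp [(Fin.castSucc_lt_last i).ne]
      have hz : ∑ i, g.inner p (s i p) (e p) • s i p = 0 :=
        Finset.sum_eq_zero fun i _ ↦ by rw [this i, zero_smul]
      simp only [w, hz, sub_zero]
      exact FiberBundle.extend_apply_self ..
    let f : N → ℝ := fun q ↦ g.inner q (w q) (w q)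
    have hf : ContMDiffOn 𝓘(ℝ, Model m) 𝓘(ℝ) ∞ f V := smooth_inner g hw hw
    have hfp : f p = 1 := by
      simp only [f, hwp, hb]
      simp
    let W : Set N := V ∩ f ⁻¹' Set.Ioi 0
    have hWo : IsOpen W := hf.continuousOn.isOpen_inter_preimage hVo isOpen_Ioi
    have hpW : p ∈ W := ⟨hpV, by simp [hfp]⟩
    have hWV : W ⊆ V := Set.inter_subset_left
    let c : N → ℝ := fun q ↦ (√(f q))⁻¹
    have hc : ContMDiffOn 𝓘(ℝ, Model m) 𝓘(ℝ) ∞ c W := by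
      intro q hq
      have h1 : ContDiffAt ℝ ∞ (fun x : ℝ ↦ (√x)⁻¹) (f q) :=
        (Real.contDiffAt_sqrt (ne_of_gt hq.2)).inv (Real.sqrt_pos.2 hq.2).ne'
      exact h1.contMDiffAt.comp_contMDiffWithinAt q ((hf.mono hWV) q hq)
    have hsw : ∀ q ∈ V, ∀ i, g.inner q (s i q) (w q) = 0 := by
      intro q hq i
      simp only [w, map_sub, map_sum, map_smul, ho q hq.1]
      simp
    refine ⟨W, Fin.snoc s (fun q ↦ c q • w q), hWo, hpW, ?_, ?_, ?_⟩
    · intro i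
      refine Fin.lastCases ?_ (fun i ↦ ?_) i
      · simp only [Fin.snoc_last]
        exact hc.smul_section (hw.mono hWV)
      · simp only [Fin.snoc_castSucc]
        exact (hsV i).mono hWV
    · intro q hq i j
      have h0 : 0 < f q := hq.2
      have hcc : c q * (c q * f q) = 1 := by
        have h1 : √(f q) ≠ 0 := (Real.sqrt_pos.2 h0).ne'
        have h2 : √(f q) * √(f q) = f q := Real.mul_self_sqrt h0.le
        simp only [c]
        nth_rewrite 3 [← h2]
        field_simp
      refine Fin.lastCases ?_ (fun i ↦ ?_) i <;> refine Fin.lastCases ?_ (fun j ↦ ?_) j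
      · simpa using hcc
      · simp [g.symm q (w q) (s j q), hsw q hq.1, (Fin.castSucc_lt_last j).ne']
      · simp [hsw q hq.1, (Fin.castSucc_lt_last i).ne]
      · simp [ho q hq.1.1]
    · intro i
      refine Fin.lastCases ?_ (fun i ↦ ?_) i
      · simp [c, hfp, hwp]
      · simp [hsp]

end Frames

/-! ### The twistor space as a manifold -/

section TwistorSpace

variable {m : ℕ} {N : Type*} [TopologicalSpace N] [ChartedSpace (Model m) N]
  [IsManifold 𝓘(ℝ, Model m) ∞ N]

/-- The twistor space of `(N, g)`: the bundle over `N` whose fibre at `q` consists of the complex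
structures on the tangent space `T_q N` compatible with the metric `g_q`. -/
structure TwistorSpace (g : Metric m N) where
  /-- The base point. -/
  proj : N
  /-- The complex structure on the tangent space at the base point. -/
  cs : TangentSpace 𝓘(ℝ, Model m) proj →L[ℝ] TangentSpace 𝓘(ℝ, Model m) proj
  cs_cs : ∀ v, cs (cs v) = -v
  inner_cs : ∀ v w, g.inner proj (cs v) (cs w) = g.inner proj v w

/-- A smooth orthonormal frame on an open subset. -/
structure OrthoFrame (g : Metric m N) where
  dom : Set N
  isOpen_dom : IsOpen dom
  vec : Fin m ⊕ Fin m → (q : N) → TangentSpace 𝓘(ℝ, Model m) q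
  smooth : ∀ i, SmoothField dom (vec i)
  ortho : ∀ q ∈ dom, ∀ i j, g.inner q (vec i q) (vec j q) = if i = j then 1 else 0

variable {g : Metric m N}

namespace OrthoFrame

/-- The linear isometry from the standard Euclidean space onto `T_q N` defined by a frame. -/
def lin (F : OrthoFrame g) (q : N) : Std m →L[ℝ] TangentSpace 𝓘(ℝ, Model m) q :=
  ∑ i, (EuclideanSpace.proj i : Std m →L[ℝ] ℝ).smulRight (F.vec i q)

/-- The components of tangent vectors at `q` with respect to a frame. -/
def coord (F : OrthoFrame g) (q : N) : TangentSpace 𝓘(ℝ, Model m) q →L[ℝ] Std m :=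
  ∑ i, (g.inner q (F.vec i q)).smulRight (EuclideanSpace.single i (1 : ℝ))

theorem lin_apply (F : OrthoFrame g) (q : N) (v : Std m) :
    F.lin q v = ∑ i, v i • F.vec i q := by
  simp [lin]

theorem coord_apply (F : OrthoFrame g) (q : N) (v : TangentSpace 𝓘(ℝ, Model m) q)
    (i : Fin m ⊕ Fin m) : F.coord q v i = g.inner q (F.vec i q) v := by
  rw [coord, sum_apply]
  simp only [ContinuousLinearMap.smulRight_apply, WithLp.ofLp_sum, WithLp.ofLp_smul,
    Finset.sum_apply, Pi.smul_apply, PiLp.single_apply, smul_eq_mul, mul_ite, mul_one,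
    mul_zero, Finset.sum_ite_eq, Finset.mem_univ, if_true]

theorem coord_lin (F : OrthoFrame g) {q : N} (hq : q ∈ F.dom) (v : Std m) :
    F.coord q (F.lin q v) = v := by
  ext i
  rw [coord_apply, lin_apply, map_sum]
  simp only [map_smul, F.ortho q hq]
  simp only [smul_eq_mul, mul_ite, mul_one, mul_zero, Finset.sum_ite_eq, Finset.mem_univ, if_true]

theorem lin_coord (F : OrthoFrame g) {q : N} (hq : q ∈ F.dom)
    (v : TangentSpace 𝓘(ℝ, Model m) q) : F.lin q (F.coord q v) = v := by
  have hinj : Function.Injective (F.lin q) := Function.LeftInverse.injective (F.coord_lin hq)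
  have hsurj : Function.Surjective (F.lin q).toLinearMap :=
    (LinearMap.injective_iff_surjective_of_finrank_eq_finrank
      (by rw [finrank_tangentSpace]; simp [two_mul])).1 hinj
  obtain ⟨w, rfl⟩ := hsurj v
  change F.lin q (F.coord q (F.lin q w)) = F.lin q w
  rw [F.coord_lin hq]

theorem inner_lin (F : OrthoFrame g) (q : N) (v : Std m) (x : TangentSpace 𝓘(ℝ, Model m) q) :
    g.inner q (F.lin q v) x = inner ℝ v (F.coord q x) := by
  rw [lin_apply, PiLp.inner_apply, map_sum, sum_apply]
  refine Finset.sum_congr rfl fun i _ ↦ ?_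
  rw [coord_apply, map_smul]
  simp [mul_comm]

/-- The matrix of a compatible complex structure with respect to a frame. -/
def mat (F : OrthoFrame g) (σ : TwistorSpace g) : Std m →L[ℝ] Std m :=
  (F.coord σ.proj).comp (σ.cs.comp (F.lin σ.proj))

theorem mat_apply (F : OrthoFrame g) (σ : TwistorSpace g) (v : Std m) :
    F.mat σ v = F.coord σ.proj (σ.cs (F.lin σ.proj v)) := rfl

theorem mat_mul_self (F : OrthoFrame g) (σ : TwistorSpace g) (h : σ.proj ∈ F.dom) :
    F.mat σ * F.mat σ = -1 := by
  ext1 v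
  change F.mat σ (F.mat σ v) = _
  rw [mat_apply, mat_apply, F.lin_coord h, σ.cs_cs, map_neg,
    F.coord_lin h]
  rfl

theorem star_mat (F : OrthoFrame g) (σ : TwistorSpace g) :
    star (F.mat σ) = -F.mat σ := by
  rw [ContinuousLinearMap.star_eq_adjoint]
  symm
  rw [ContinuousLinearMap.eq_adjoint_iff]
  intro v w
  have h1 : inner ℝ v (F.mat σ w) = g.inner σ.proj (F.lin σ.proj v) (σ.cs (F.lin σ.proj w)) :=
    (F.inner_lin σ.proj v _).symm
  have h2 : inner ℝ w (F.mat σ v) = g.inner σ.proj (F.lin σ.proj w) (σ.cs (F.lin σ.proj v)) :=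
    (F.inner_lin σ.proj w _).symm
  have h3 := σ.inner_cs (F.lin σ.proj w) (σ.cs (F.lin σ.proj v))
  rw [σ.cs_cs, map_neg, g.symm, ← h1, ← h2] at h3
  change inner ℝ (-(F.mat σ v)) w = _
  rw [inner_neg_left, real_inner_comm, ← h3, neg_neg]

/-- The compatible complex structure with a given matrix with respect to a frame. -/
def ofMat (F : OrthoFrame g) (q : N) (hq : q ∈ F.dom) (I : Std m →L[ℝ] Std m) (hI : I * I = -1)
    (hs : star I = -I) : TwistorSpace g where
  proj := q
  cs := (F.lin q).comp (I.comp (F.coord q))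
  cs_cs v := by
    have h : ∀ x, I (I x) = -x := fun x ↦ DFunLike.congr_fun hI x
    simp only [ContinuousLinearMap.comp_apply, F.coord_lin hq, h, map_neg, F.lin_coord hq]
  inner_cs v w := by
    simp only [ContinuousLinearMap.comp_apply]
    have h : ∀ x, I (I x) = -x := fun x ↦ DFunLike.congr_fun hI x
    rw [F.inner_lin, F.coord_lin hq, ← ContinuousLinearMap.adjoint_inner_right,
      ← ContinuousLinearMap.star_eq_adjoint, hs, neg_apply, h, neg_neg,
      ← F.inner_lin, F.lin_coord hq]

theorem mat_ofMat (F : OrthoFrame g) (q : N) (hq : q ∈ F.dom) (I : Std m →L[ℝ] Std m)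
    (hI : I * I = -1) (hs : star I = -I) : F.mat (F.ofMat q hq I hI hs) = I := by
  ext1 v
  change F.coord q (F.lin q (I (F.coord q (F.lin q v)))) = I v
  rw [F.coord_lin hq, F.coord_lin hq]

theorem ofMat_mat (F : OrthoFrame g) (σ : TwistorSpace g) (q : N) (hq : q ∈ F.dom)
    (hqσ : q = σ.proj) (I : Std m →L[ℝ] Std m) (hI : I * I = -1) (hs : star I = -I)
    (hM : I = F.mat σ) : F.ofMat q hq I hI hs = σ := by
  subst hM
  obtain ⟨q', J, h1, h2⟩ := σ
  change q = q' at hqσ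
  subst hqσ
  have hJ : (F.lin q).comp ((F.mat ⟨q, J, h1, h2⟩).comp (F.coord q)) = J := by
    ext1 v
    simp only [ContinuousLinearMap.comp_apply, mat_apply, F.lin_coord hq]
  simp only [ofMat, hJ]

end OrthoFrame

/-- Around every point of the twistor space there is an orthonormal frame with respect to which
the complex structure at this point is the standard one. -/
theorem exists_adaptedFrame (σ : TwistorSpace g) :
    ∃ F : OrthoFrame g, σ.proj ∈ F.dom ∧ F.mat σ = stdJ m := by
  obtain ⟨b, hb, hJ⟩ := exists_adapted (g.inner σ.proj) (g.symm σ.proj) (g.pos σ.proj) σ.cs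
    σ.cs_cs σ.inner_cs (finrank_tangentSpace σ.proj)
  obtain ⟨U, s, hU, hpU, hs, ho, hsp⟩ := exists_frame g σ.proj (m + m)
    (fun i ↦ b (finSumFinEquiv.symm i)) (by intro i j; rw [hb]; simp)
  let F : OrthoFrame g :=
    { dom := U
      isOpen_dom := hU
      vec := fun i ↦ s (finSumFinEquiv i)
      smooth := fun i ↦ hs _
      ortho := by intro q hq i j; rw [ho q hq]; simp }
  have hF : ∀ i, F.vec i σ.proj = b i := by
    intro i
    simp only [F, hsp, Equiv.symm_apply_apply]
  have hJ' : ∀ k, σ.cs (b (Sum.inr k)) = -b (Sum.inl k) := by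
    intro k
    rw [← hJ, σ.cs_cs]
  refine ⟨F, hpU, ?_⟩
  have key : ∀ v, σ.cs (F.lin σ.proj v) = F.lin σ.proj (stdJ m v) := by
    intro v
    rw [F.lin_apply, F.lin_apply, map_sum, Fintype.sum_sum_type, Fintype.sum_sum_type]
    simp only [hF, map_smul, hJ, hJ', stdJ_inl, stdJ_inr, smul_neg, neg_smul]
    rw [add_comm]
  ext1 v
  rw [F.mat_apply, key, F.coord_lin hpU]

end TwistorSpace

section TwistorCharts

variable {m : ℕ} {N : Type*} [TopologicalSpace N] [ChartedSpace (Model m) N]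
  [IsManifold 𝓘(ℝ, Model m) ∞ N] {g : Metric m N}

/-- The point of the twistor space with coordinates `z` with respect to a chart `c` of `N` and an
orthonormal frame `F`: the complex structure at `c⁻¹(z.1)` whose matrix with respect to `F` has
Cayley transform `z.2` (with a default value where `F` is not defined). -/
def twistorPoint (F : OrthoFrame g) (c : OpenPartialHomeomorph N (Model m)) (σ₀ : TwistorSpace g)
    (z : Model m × StdTangent m) : TwistorSpace g :=
  open Classical in
  if h : c.symm z.1 ∈ F.dom then
    F.ofMat (c.symm z.1) h (cayleyInv z.2) (cayleyInv_mul_self z.2.2) (star_cayleyInv z.2.2)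
  else σ₀

theorem twistorPoint_proj (F : OrthoFrame g) (c : OpenPartialHomeomorph N (Model m))
    (σ₀ : TwistorSpace g) (z : Model m × StdTangent m) (h : c.symm z.1 ∈ F.dom) :
    (twistorPoint F c σ₀ z).proj = c.symm z.1 := by
  rw [twistorPoint, dif_pos h]
  rfl

/-- The chart of the twistor space defined by a chart `c` of `N` and an orthonormal frame `F`: it
maps a complex structure at `q` to the coordinates of `q` and the Cayley transform of the matrix
of the complex structure. -/
def twistorChart (F : OrthoFrame g) (c : OpenPartialHomeomorph N (Model m)) (σ₀ : TwistorSpace g) :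
    PartialEquiv (TwistorSpace g) (Model m × StdTangent m) where
  toFun σ := (c σ.proj, stdProj m (cayley (F.mat σ)))
  invFun := twistorPoint F c σ₀
  source := {σ | σ.proj ∈ c.source ∧ σ.proj ∈ F.dom ∧ IsUnit (1 - stdJ m * F.mat σ)}
  target := {z | z.1 ∈ c.target ∧ c.symm z.1 ∈ F.dom}
  map_source' := by
    rintro σ ⟨h1, h2, -⟩
    refine ⟨c.map_source h1, ?_⟩
    change c.symm (c σ.proj) ∈ F.dom
    rwa [c.left_inv h1]
  map_target' := by
    rintro z ⟨h1, h2⟩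
    refine ⟨?_, ?_, ?_⟩
    · rw [twistorPoint_proj F c σ₀ z h2]
      exact c.map_target h1
    · rwa [twistorPoint_proj F c σ₀ z h2]
    · rw [twistorPoint, dif_pos h2, F.mat_ofMat]
      exact (cayley_cayleyInv z.2.2).1
  left_inv' := by
    rintro σ ⟨h1, h2, h3⟩
    have h4 : c.symm (c σ.proj) ∈ F.dom := by rwa [c.left_inv h1]
    obtain ⟨h5, h6⟩ := cayleyInv_cayley (F.mat_mul_self σ h2) (F.star_mat σ) h3
    rw [twistorPoint, dif_pos h4]
    apply F.ofMat_mat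
    · exact c.left_inv h1
    · change cayleyInv (stdProj m (cayley (F.mat σ)) : Std m →L[ℝ] Std m) = F.mat σ
      rw [stdProj_of_mem h5]
      exact h6
  right_inv' := by
    rintro ⟨x, A⟩ ⟨h1, h2⟩
    apply Prod.ext
    · change c (twistorPoint F c σ₀ (x, A)).proj = x
      rw [twistorPoint_proj F c σ₀ _ h2]
      exact c.right_inv h1
    · change stdProj m (cayley (F.mat (twistorPoint F c σ₀ (x, A)))) = A
      rw [twistorPoint, dif_pos h2, F.mat_ofMat, (cayley_cayleyInv A.2).2, stdProj_of_mem A.2]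

namespace OrthoFrame

/-- The transition matrix between two frames. -/
def transition (F F' : OrthoFrame g) (q : N) : Std m →L[ℝ] Std m :=
  (F'.coord q).comp (F.lin q)

theorem transition_eq (F F' : OrthoFrame g) (q : N) :
    F.transition F' q = ∑ j, ∑ i, g.inner q (F'.vec i q) (F.vec j q) •
      (EuclideanSpace.proj j : Std m →L[ℝ] ℝ).smulRight (EuclideanSpace.single i (1 : ℝ)) := by
  ext1 v
  change F'.coord q (F.lin q v) = _
  rw [lin_apply, map_sum, sum_apply]
  refine Finset.sum_congr rfl fun j _ ↦ ?_
  rw [map_smul, coord, sum_apply, sum_apply, Finset.smul_sum]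
  refine Finset.sum_congr rfl fun i _ ↦ ?_
  simp only [ContinuousLinearMap.smulRight_apply, smul_apply]
  rw [smul_comm]
  rfl

theorem smooth_transition (F F' : OrthoFrame g) :
    ContMDiffOn 𝓘(ℝ, Model m) 𝓘(ℝ, Std m →L[ℝ] Std m) ∞ (F.transition F') (F.dom ∩ F'.dom) := by
  simp only [funext (F.transition_eq F')]
  refine contMDiffOn_finsetSum fun j _ ↦ contMDiffOn_finsetSum fun i _ ↦ ?_
  exact (smooth_inner g ((F'.smooth i).mono Set.inter_subset_right)
    ((F.smooth j).mono Set.inter_subset_left)).smul contMDiffOn_const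

end OrthoFrame

/-- The matrix, with respect to `F'`, of the point with given coordinates with respect to `F`. -/
def transMat (F F' : OrthoFrame g) (c : OpenPartialHomeomorph N (Model m))
    (z : Model m × StdTangent m) : Std m →L[ℝ] Std m :=
  F.transition F' (c.symm z.1) * cayleyInv z.2 * F'.transition F (c.symm z.1)

theorem mat_twistorPoint (F F' : OrthoFrame g) (c : OpenPartialHomeomorph N (Model m))
    (σ₀ : TwistorSpace g) (z : Model m × StdTangent m) (h : c.symm z.1 ∈ F.dom) :
    F'.mat (twistorPoint F c σ₀ z) = transMat F F' c z := by
  rw [twistorPoint, dif_pos h]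
  rfl

theorem contDiff_cayleyInv :
    ContDiff ℝ ∞ (fun A : StdTangent m ↦ cayleyInv (A : Std m →L[ℝ] Std m)) := by
  have hA : ContDiff ℝ ∞ (fun A : StdTangent m ↦ (1 + (A : Std m →L[ℝ] Std m))) :=
    contDiff_const.add (StdTangent m).subtypeL.contDiff
  have hinv : ContDiff ℝ ∞ (fun A : StdTangent m ↦ Ring.inverse (1 + (A : Std m →L[ℝ] Std m))) := by
    rw [contDiff_iff_contDiffAt]
    intro A
    obtain ⟨u, hu⟩ := isUnit_one_add A.2.1
    have h := contDiffAt_ringInverse ℝ (n := ∞) u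
    rw [hu] at h
    exact h.comp A hA.contDiffAt
  exact (hA.mul contDiff_const).mul hinv

theorem contDiffAt_cayley {I : Std m →L[ℝ] Std m} (hI : IsUnit (1 - stdJ m * I)) :
    ContDiffAt ℝ ∞ (cayley (m := m)) I := by
  have h1 : ContDiffAt ℝ ∞ (fun I : Std m →L[ℝ] Std m ↦ stdJ m * I) I :=
    contDiffAt_const.mul contDiffAt_id
  have h2 : ContDiffAt ℝ ∞ (fun I : Std m →L[ℝ] Std m ↦ Ring.inverse (1 - stdJ m * I)) I := by
    obtain ⟨u, hu⟩ := hI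
    have h := contDiffAt_ringInverse ℝ (n := ∞) u
    rw [hu] at h
    exact h.comp I (contDiffAt_const.sub h1)
  exact (contDiffAt_const.add h1).mul h2

/-- The set of coordinates of points in the domain of a second frame. -/
def transDom (F F' : OrthoFrame g) (c c' : OpenPartialHomeomorph N (Model m)) :
    Set (Model m × StdTangent m) :=
  Prod.fst ⁻¹' (c.target ∩ c.symm ⁻¹' (F.dom ∩ (c'.source ∩ F'.dom)))

theorem isOpen_transDom (F F' : OrthoFrame g) (c c' : OpenPartialHomeomorph N (Model m)) :
    IsOpen (transDom F F' c c') :=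
  (c.symm.isOpen_inter_preimage (F.isOpen_dom.inter (c'.open_source.inter F'.isOpen_dom))).preimage
    continuous_fst

theorem contDiffOn_transMat (F F' : OrthoFrame g) (a a' : N) :
    ContDiffOn ℝ ∞ (transMat F F' (chartAt (Model m) a))
      (transDom F F' (chartAt (Model m) a) (chartAt (Model m) a')) := by
  have hfst : ContMDiffOn 𝓘(ℝ, Model m × StdTangent m) 𝓘(ℝ, Model m) ∞
      (fun z : Model m × StdTangent m ↦ (chartAt (Model m) a).symm z.1)
      (transDom F F' (chartAt (Model m) a) (chartAt (Model m) a')) :=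
    (contMDiffOn_chart_symm (I := 𝓘(ℝ, Model m)) (x := a)).comp
      (contDiff_fst.contMDiff.contMDiffOn) fun z hz ↦ hz.1
  have h1 := ((F.smooth_transition F').comp hfst
    (fun z hz ↦ ⟨hz.2.1, hz.2.2.2⟩)).contDiffOn
  have h2 := ((F'.smooth_transition F).comp hfst
    (fun z hz ↦ ⟨hz.2.2.2, hz.2.1⟩)).contDiffOn
  exact (h1.mul (contDiff_cayleyInv.comp contDiff_snd).contDiffOn).mul h2

theorem source_trans (F F' : OrthoFrame g) (c c' : OpenPartialHomeomorph N (Model m))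
    (σ₀ σ₁ : TwistorSpace g) :
    ((twistorChart F c σ₀).symm.trans (twistorChart F' c' σ₁)).source =
      transDom F F' c c' ∩ transMat F F' c ⁻¹' {I | IsUnit (1 - stdJ m * I)} := by
  ext z
  rw [PartialEquiv.trans_source]
  constructor
  · rintro ⟨⟨h1, h2⟩, h3, h4, h5⟩
    change (twistorPoint F c σ₀ z).proj ∈ _ at h3
    change (twistorPoint F c σ₀ z).proj ∈ _ at h4
    change IsUnit (1 - stdJ m * F'.mat (twistorPoint F c σ₀ z)) at h5
    rw [twistorPoint_proj F c σ₀ z h2] at h3 h4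
    rw [mat_twistorPoint F F' c σ₀ z h2] at h5
    exact ⟨⟨h1, h2, h3, h4⟩, h5⟩
  · rintro ⟨⟨h1, h2, h3, h4⟩, h5⟩
    refine ⟨⟨h1, h2⟩, ?_, ?_, ?_⟩
    · change (twistorPoint F c σ₀ z).proj ∈ _
      rwa [twistorPoint_proj F c σ₀ z h2]
    · change (twistorPoint F c σ₀ z).proj ∈ _
      rwa [twistorPoint_proj F c σ₀ z h2]
    · change IsUnit (1 - stdJ m * F'.mat (twistorPoint F c σ₀ z))
      rwa [mat_twistorPoint F F' c σ₀ z h2]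

theorem isOpen_source_trans (F F' : OrthoFrame g) (a a' : N) (σ₀ σ₁ : TwistorSpace g) :
    IsOpen ((twistorChart F (chartAt (Model m) a) σ₀).symm.trans
      (twistorChart F' (chartAt (Model m) a') σ₁)).source := by
  rw [source_trans]
  refine (contDiffOn_transMat F F' a a').continuousOn.isOpen_inter_preimage
    (isOpen_transDom _ _ _ _) ?_
  exact Units.isOpen.preimage (continuous_const.sub (continuous_const.mul continuous_id))

theorem contDiffOn_trans (F F' : OrthoFrame g) (a a' : N) (σ₀ σ₁ : TwistorSpace g) :
    ContDiffOn ℝ ∞ ((twistorChart F (chartAt (Model m) a) σ₀).symm.trans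
      (twistorChart F' (chartAt (Model m) a') σ₁))
      ((twistorChart F (chartAt (Model m) a) σ₀).symm.trans
        (twistorChart F' (chartAt (Model m) a') σ₁)).source := by
  rw [source_trans]
  set S := transDom F F' (chartAt (Model m) a) (chartAt (Model m) a') ∩
    transMat F F' (chartAt (Model m) a) ⁻¹' {I | IsUnit (1 - stdJ m * I)}
  have h1 : ContMDiffOn 𝓘(ℝ, Model m × StdTangent m) 𝓘(ℝ, Model m) ∞
      (fun z : Model m × StdTangent m ↦
        chartAt (Model m) a' ((chartAt (Model m) a).symm z.1)) S :=
    (contMDiffOn_chart (I := 𝓘(ℝ, Model m)) (x := a')).comp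
      ((contMDiffOn_chart_symm (I := 𝓘(ℝ, Model m)) (x := a)).comp
        (contDiff_fst.contMDiff.contMDiffOn) fun z hz ↦ hz.1.1) fun z hz ↦ hz.1.2.2.1
  have h2 : ContDiffOn ℝ ∞ (fun z ↦
      stdProj m (cayley (transMat F F' (chartAt (Model m) a) z))) S := by
    refine (stdProj m).contDiff.comp_contDiffOn ?_
    intro z hz
    exact (contDiffAt_cayley hz.2).comp_contDiffWithinAt z
      (((contDiffOn_transMat F F' a a').mono Set.inter_subset_left) z hz)
  refine (h1.contDiffOn.prodMk h2).congr ?_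
  rintro z ⟨⟨h3, h4, h5⟩, h6⟩
  change (chartAt (Model m) a' (twistorPoint F (chartAt (Model m) a) σ₀ z).proj,
    stdProj m (cayley (F'.mat (twistorPoint F (chartAt (Model m) a) σ₀ z)))) = _
  rw [twistorPoint_proj F _ σ₀ z h4, mat_twistorPoint F F' _ σ₀ z h4]

variable (g) in
/-- The atlas of the twistor space defined by the charts of `N` and the orthonormal frames. -/
def twistorCore : ChartedSpaceCore (Model m × StdTangent m) (TwistorSpace g) where
  atlas := {e | ∃ (F : OrthoFrame g) (a : N) (σ₀ : TwistorSpace g),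
    e = twistorChart F (chartAt (Model m) a) σ₀}
  chartAt σ := twistorChart (exists_adaptedFrame σ).choose (chartAt (Model m) σ.proj) σ
  mem_chart_source σ := by
    obtain ⟨h1, h2⟩ := (exists_adaptedFrame σ).choose_spec
    refine ⟨mem_chart_source _ _, h1, ?_⟩
    rw [h2, stdJ_mul_self, sub_neg_eq_add, one_add_one_eq_two]
    have h := (IsUnit.mk0 (2 : ℝ) two_ne_zero).map (algebraMap ℝ (Std m →L[ℝ] Std m))
    rwa [map_ofNat] at h
  chart_mem_atlas σ := ⟨_, _, _, rfl⟩
  open_source := by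
    rintro e e' ⟨F, a, σ₀, rfl⟩ ⟨F', a', σ₁, rfl⟩
    exact isOpen_source_trans F F' a a' σ₀ σ₁
  continuousOn_toFun := by
    rintro e e' ⟨F, a, σ₀, rfl⟩ ⟨F', a', σ₁, rfl⟩
    exact (contDiffOn_trans F F' a a' σ₀ σ₁).continuousOn

instance : TopologicalSpace (TwistorSpace g) := (twistorCore g).toTopologicalSpace

instance : ChartedSpace (Model m × StdTangent m) (TwistorSpace g) := (twistorCore g).toChartedSpace

instance : IsManifold 𝓘(ℝ, Model m × StdTangent m) ∞ (TwistorSpace g) := by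
  apply isManifold_of_contDiffOn
  rintro e e' he he'
  obtain ⟨_, ⟨e₁, rfl⟩, _, ⟨⟨F, a, σ₀, rfl⟩, rfl⟩, rfl⟩ := he
  obtain ⟨_, ⟨e₂, rfl⟩, _, ⟨⟨F', a', σ₁, rfl⟩, rfl⟩, rfl⟩ := he'
  have h := contDiffOn_trans F F' a a' σ₀ σ₁
  simp only [modelWithCornersSelf_coe, modelWithCornersSelf_coe_symm, Set.range_id,
    Set.inter_univ, Function.comp_id, Set.preimage_id_eq, id_eq, Function.id_comp]
  exact h

end TwistorCharts

/-! ### The metrics on the twistor space -/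

section TwistorMetric

variable {m : ℕ} {N : Type*} [TopologicalSpace N] [ChartedSpace (Model m) N]
  [IsManifold 𝓘(ℝ, Model m) ∞ N] {g : Metric m N}

namespace TwistorSpace

/-- The differential `π_*` of the projection `π` onto `N`. -/
def projDeriv (σ : TwistorSpace g) : TangentSpace 𝓘(ℝ, Model m × StdTangent m) σ →L[ℝ]
    TangentSpace 𝓘(ℝ, Model m) σ.proj :=
  mfderiv 𝓘(ℝ, Model m × StdTangent m) 𝓘(ℝ, Model m) TwistorSpace.proj σ

/-- The components of the complex structure `τ` in the chart of `N` at `p`. -/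
def coordCs (p : N) (τ : TwistorSpace g) : Model m →L[ℝ] Model m :=
  let D : TangentSpace 𝓘(ℝ, Model m) τ.proj →L[ℝ] Model m :=
    mfderiv 𝓘(ℝ, Model m) 𝓘(ℝ, Model m) (extChartAt 𝓘(ℝ, Model m) p) τ.proj
  D.comp (τ.cs.comp D.inverse)

/-- The connection map of the Levi-Civita connection of `g`: it maps the velocity at `σ` of a curve
of complex structures, regarded as a section of the endomorphism bundle along its projection to
`N`, to the covariant derivative `I' + [Γ(x'), I]` of this section. -/
def connectionMap (σ : TwistorSpace g) : TangentSpace 𝓘(ℝ, Model m × StdTangent m) σ →L[ℝ]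
    (TangentSpace 𝓘(ℝ, Model m) σ.proj →L[ℝ] TangentSpace 𝓘(ℝ, Model m) σ.proj) :=
  let D : TangentSpace 𝓘(ℝ, Model m × StdTangent m) σ →L[ℝ] (Model m →L[ℝ] Model m) :=
    mfderiv 𝓘(ℝ, Model m × StdTangent m) 𝓘(ℝ, Model m →L[ℝ] Model m) (coordCs (g := g) σ.proj) σ
  let P : TangentSpace 𝓘(ℝ, Model m × StdTangent m) σ →L[ℝ] Model m := σ.projDeriv
  let Γ : Model m →L[ℝ] Model m →L[ℝ] Model m :=
    christoffel g.inner σ.proj (extChartAt 𝓘(ℝ, Model m) σ.proj σ.proj)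
  let J : Model m →L[ℝ] Model m := σ.cs
  D + ((commutator J).comp Γ).comp P

/-- The splitting of the tangent space at `σ` into its horizontal part, the kernel of the
connection map, which `π_*` identifies with the tangent space of `N`, and its vertical part, the
kernel of `π_*`, which the connection map identifies with the space of skew-symmetric endomorphisms
anti-commuting with the complex structure. -/
def splitting (σ : TwistorSpace g) : TangentSpace 𝓘(ℝ, Model m × StdTangent m) σ →L[ℝ]
    TangentSpace 𝓘(ℝ, Model m) σ.proj ×
      (TangentSpace 𝓘(ℝ, Model m) σ.proj →L[ℝ] TangentSpace 𝓘(ℝ, Model m) σ.proj) :=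
  σ.projDeriv.prod σ.connectionMap

/-- The horizontal lift `X^h`: the horizontal vector at `σ` with `π_* X^h = X`. -/
def horizontalLift (σ : TwistorSpace g) (X : TangentSpace 𝓘(ℝ, Model m) σ.proj) :
    TangentSpace 𝓘(ℝ, Model m × StdTangent m) σ :=
  Function.invFun σ.splitting (X, 0)

/-- The vertical vector at `σ` corresponding to the endomorphism `A`, for `A` skew-symmetric and
anti-commuting with the complex structure. -/
def verticalVector (σ : TwistorSpace g)
    (A : TangentSpace 𝓘(ℝ, Model m) σ.proj →L[ℝ] TangentSpace 𝓘(ℝ, Model m) σ.proj) :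
    TangentSpace 𝓘(ℝ, Model m × StdTangent m) σ :=
  Function.invFun σ.splitting (0, A)

/-- The orthogonal projection `𝒱 Q = ½ (Q + I Q I)` of skew-symmetric endomorphisms onto the
vertical space at `I`. -/
def verticalProj (σ : TwistorSpace g)
    (Q : TangentSpace 𝓘(ℝ, Model m) σ.proj →L[ℝ] TangentSpace 𝓘(ℝ, Model m) σ.proj) :
    TangentSpace 𝓘(ℝ, Model m) σ.proj →L[ℝ] TangentSpace 𝓘(ℝ, Model m) σ.proj :=
  (1 / 2 : ℝ) • (Q + σ.cs.comp (Q.comp σ.cs))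

end TwistorSpace

/-- The metric `G(A, B) = -(1/n) Tr (A B)` on endomorphisms, `n = 2m`. -/
def endMetric {N : Type*} [TopologicalSpace N] [ChartedSpace (Model m) N] (q : N) :
    (TangentSpace 𝓘(ℝ, Model m) q →L[ℝ] TangentSpace 𝓘(ℝ, Model m) q) →L[ℝ]
      (TangentSpace 𝓘(ℝ, Model m) q →L[ℝ] TangentSpace 𝓘(ℝ, Model m) q) →L[ℝ] ℝ :=
  let tr : (Model m →L[ℝ] Model m) →ₗ[ℝ] ℝ :=
    (LinearMap.trace ℝ (Model m)).comp (ContinuousLinearMap.coeLM ℝ)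
  let B : (Model m →L[ℝ] Model m) →L[ℝ] (Model m →L[ℝ] Model m) →L[ℝ] ℝ :=
    (-(1 / (2 * m : ℝ))) • (ContinuousLinearMap.compL ℝ (Model m →L[ℝ] Model m)
      (Model m →L[ℝ] Model m) ℝ (LinearMap.toContinuousLinearMap tr)).comp
        (ContinuousLinearMap.mul ℝ (Model m →L[ℝ] Model m))
  B

theorem endMetric_apply {N : Type*} [TopologicalSpace N] [ChartedSpace (Model m) N] (q : N)
    (A B : TangentSpace 𝓘(ℝ, Model m) q →L[ℝ] TangentSpace 𝓘(ℝ, Model m) q) :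
    endMetric q A B =
      -(1 / (2 * m : ℝ)) * LinearMap.trace ℝ (TangentSpace 𝓘(ℝ, Model m) q) (A.comp B) := rfl

variable (g) in
/-- The metric `h_t` on the twistor space, `h_t(ξ, η) = g(π_* ξ, π_* η) + t G(ξ^v, η^v)`. -/
def twistorMetric (t : ℝ) : BilinField (Model m × StdTangent m) (TwistorSpace g) :=
  fun σ ↦
    let P : Model m × StdTangent m →L[ℝ] Model m := σ.projDeriv
    let K : Model m × StdTangent m →L[ℝ] (Model m →L[ℝ] Model m) := σ.connectionMap
    let b : Model m →L[ℝ] Model m →L[ℝ] ℝ := g.inner σ.proj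
    let G : (Model m →L[ℝ] Model m) →L[ℝ] (Model m →L[ℝ] Model m) →L[ℝ] ℝ := endMetric σ.proj
    let h : Model m × StdTangent m →L[ℝ] Model m × StdTangent m →L[ℝ] ℝ :=
      b.bilinearComp P P + t • G.bilinearComp K K
    h

theorem twistorMetric_apply (t : ℝ) (σ : TwistorSpace g)
    (ξ η : TangentSpace 𝓘(ℝ, Model m × StdTangent m) σ) :
    twistorMetric g t σ ξ η = g.inner σ.proj (σ.projDeriv ξ) (σ.projDeriv η) +
      t * endMetric σ.proj (σ.connectionMap ξ) (σ.connectionMap η) := rfl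

end TwistorMetric

/-! ### Two-vectors and almost Hermitian structures -/

section TwoVectors

variable {m : ℕ} {N : Type*} [TopologicalSpace N] [ChartedSpace (Model m) N]
  [IsManifold 𝓘(ℝ, Model m) ∞ N]

/-- The metric as a bilinear form. -/
def bilinForm (g : Metric m N) (q : N) :
    LinearMap.BilinForm ℝ (TangentSpace 𝓘(ℝ, Model m) q) :=
  LinearMap.mk₂ ℝ (fun v w ↦ g.inner q v w) (by simp) (by simp) (by simp) (by simp)

theorem bilinForm_nondegenerate (g : Metric m N) (q : N) : (bilinForm g q).Nondegenerate := by
  have h : ∀ v, bilinForm g q v v = 0 → v = 0 := by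
    intro v hv
    by_contra h
    exact (g.pos q v h).ne' hv
  exact ⟨fun v hv ↦ h v (hv v), fun v hv ↦ h v (hv v)⟩

/-- The metric on two-vectors, `g(X ∧ Y, Z ∧ W) = ½ (g(X, Z) g(Y, W) - g(X, W) g(Y, Z))`, as a
function of the first argument. -/
def wedgeInner (g : Metric m N) (q : N) (Z W : TangentSpace 𝓘(ℝ, Model m) q) :
    ⋀[ℝ]^2 (TangentSpace 𝓘(ℝ, Model m) q) →ₗ[ℝ] ℝ :=
  exteriorPower.alternatingMapLinearEquiv
    { toFun := fun a ↦ (1 / 2 : ℝ) * (g.inner q (a 0) Z * g.inner q (a 1) W -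
        g.inner q (a 0) W * g.inner q (a 1) Z)
      map_update_add' := by
        intro _ a i x y
        fin_cases i <;> simp <;> ring
      map_update_smul' := by
        intro _ a i c x
        fin_cases i <;> simp <;> ring
      map_eq_zero_of_eq' := by
        intro a i j hij hne
        have h01 : a 0 = a 1 := by
          fin_cases i <;> fin_cases j <;> first | exact absurd rfl hne | exact hij | exact hij.symm
        rw [h01]
        ring }

/-- The two-vector `a^∧` corresponding to a skew-symmetric endomorphism `a`, which is characterized
by `2 g(a^∧, X ∧ Y) = g(a X, Y)` (see `two_mul_wedgeInner_hat`). -/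
def hat (g : Metric m N) (q : N)
    (a : TangentSpace 𝓘(ℝ, Model m) q →L[ℝ] TangentSpace 𝓘(ℝ, Model m) q) :
    ⋀[ℝ]^2 (TangentSpace 𝓘(ℝ, Model m) q) :=
  let b := Module.finBasis ℝ (TangentSpace 𝓘(ℝ, Model m) q)
  let b' := (bilinForm g q).dualBasis (bilinForm_nondegenerate g q) b
  (1 / 2 : ℝ) • ∑ i, exteriorPower.ιMulti ℝ 2 ![b' i, a (b i)]

theorem two_mul_wedgeInner_hat (g : Metric m N) (q : N)
    (a : TangentSpace 𝓘(ℝ, Model m) q →L[ℝ] TangentSpace 𝓘(ℝ, Model m) q)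
    (ha : ∀ v w, g.inner q (a v) w = -g.inner q v (a w)) (X Y : TangentSpace 𝓘(ℝ, Model m) q) :
    2 * wedgeInner g q X Y (hat g q a) = g.inner q (a X) Y := by
  let b := Module.finBasis ℝ (TangentSpace 𝓘(ℝ, Model m) q)
  let b' := (bilinForm g q).dualBasis (bilinForm_nondegenerate g q) b
  have hX : ∀ X : TangentSpace 𝓘(ℝ, Model m) q, ∑ i, g.inner q (b' i) X • b i = X := by
    intro X
    have h : ∀ i, g.inner q (b' i) X = b.repr X i := by
      intro i
      change bilinForm g q (b' i) X = b.repr X i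
      conv_lhs => rw [← b.sum_repr X, map_sum]
      simp only [map_smul, b', LinearMap.BilinForm.apply_dualBasis_left]
      simp
    simp only [h]
    exact b.sum_repr X
  have h1 : ∀ X Y : TangentSpace 𝓘(ℝ, Model m) q,
      ∑ i, g.inner q (b' i) X * g.inner q (a (b i)) Y = g.inner q (a X) Y := by
    intro X Y
    conv_rhs => rw [← hX X, map_sum, map_sum, sum_apply]
    simp
  have h2 : wedgeInner g q X Y (hat g q a) = (1 / 2 : ℝ) * ∑ i, (1 / 2 : ℝ) *
      (g.inner q (b' i) X * g.inner q (a (b i)) Y -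
        g.inner q (b' i) Y * g.inner q (a (b i)) X) := by
    simp only [hat, map_smul, map_sum, wedgeInner,
      exteriorPower.alternatingMapLinearEquiv_apply_ιMulti]
    rfl
  rw [h2, ← Finset.mul_sum, Finset.sum_sub_distrib, h1, h1, ha Y X, g.symm q Y (a X)]
  ring

/-- A (smooth) almost complex structure on `N` compatible with the metric `g`. -/
structure AlmostHermitian (g : Metric m N) where
  J : EndField (Model m) N
  smooth : ContMDiff 𝓘(ℝ, Model m) (𝓘(ℝ, Model m).prod 𝓘(ℝ, Model m →L[ℝ] Model m)) ∞
    (fun q ↦ Bundle.TotalSpace.mk' (Model m →L[ℝ] Model m)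
      (E := fun q : N ↦ TangentSpace 𝓘(ℝ, Model m) q →L[ℝ] TangentSpace 𝓘(ℝ, Model m) q) q (J q))
  J_J : ∀ q v, J q (J q v) = -v
  inner_J : ∀ q v w, g.inner q (J q v) (J q w) = g.inner q v w

/-- A compatible almost complex structure, regarded as a section of the twistor space. -/
def AlmostHermitian.section {g : Metric m N} (J : AlmostHermitian g) (q : N) : TwistorSpace g :=
  ⟨q, J.J q, J.J_J q, J.inner_J q⟩

end TwoVectors

end Twistor

end

noncomputable section

namespace Twistor

/-! ### Metric torsion-free connections on a vector space: derivatives, curvature, symmetries -/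

section Calculus

variable {E : Type*} [NormedAddCommGroup E] [NormedSpace ℝ E]

/-! Everything is computed in the chart of the twistor space at J(p), where one endomorphism-valued
one-form carries the geometry: K ξ = dI(ξ) + [Γ(π_* ξ), I] (`connForm`), with I the complex
structure as a function of the chart coordinates. Its values are skew and anti-commute with I, and
on the whole chart h_t(ξ, η) = g(π_* ξ, π_* η) - (t/n) Tr(K ξ K η) (`coordMetric_twistorMetric`).
The latter needs an argument, since the connection map at each point is defined in the chart of N
preferred at its own base point: the second derivatives of the transition maps cancel against the
inhomogeneous term in the transformation law of the Christoffel symbols (`connModel_frame`).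

The second derivative of I is symmetric, so the exterior covariant derivative of K is, up to sign,
[R, I] (`fderiv_connForm_sub`). Inserted in the Koszul formula for h_t, this structure equation
gives its Christoffel symbols of the first kind (`christoffelFirst_twistor`): those of g, a
symmetrised covariant derivative of K paired with K ζ, and two traces Tr(K η [R(π_* ξ, π_* ζ), I]).

Let s be the section J in these charts. Near p one has ∇J = K ∘ ds (`eventually_coordNabla`), so
differentiating once more writes ∇²J in terms of ∂K(ds, ds), K(d²s), [Γ, K ds] and K(ds Γ)
(`modelNablaSq_eq`). The same terms appear when the second fundamental form of s is paired with an
arbitrary ζ by h_t. A trace against K ζ sees only the vertical projection (`trace_vertical`), which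
produces the vertical term. Since K η anti-commutes with I, each curvature trace equals 2 Tr(I K η
R), and the pair symmetry of R turns Tr(a R(v, w)) into -2 g(R(a^∧) v, w)
(`two_mul_inner_curvature_hat`), which produces the horizontal lifts. The two sides thus have the
same pairing with every ζ (`secondFundamentalForm_test`), and h_t is positive definite
(`coordMetric_twistor_separating`). -/

/-- An injective map into the dual is bijective by dimension. Both for g and for h_t this is what
makes `christoffel` meaningful, since `inverse` takes a default value on maps that are not
invertible. -/
theorem isInvertible_of_separating [FiniteDimensional ℝ E] {B : E →L[ℝ] E →L[ℝ] ℝ}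
    (hB : ∀ v, (∀ w, B v w = 0) → v = 0) : B.IsInvertible := by
  have hinj : Function.Injective B.toLinearMap := by
    rw [injective_iff_map_eq_zero]
    intro v hv
    exact hB v fun w ↦ by
      have : B v = 0 := hv
      rw [this]; rfl
  have hdim : Module.finrank ℝ E = Module.finrank ℝ (E →L[ℝ] ℝ) := by
    rw [← (LinearMap.toContinuousLinearMap (𝕜 := ℝ) (E := E) (F' := ℝ)).finrank_eq]
    exact (Subspace.dual_finrank_eq (K := ℝ) (V := E)).symm
  refine ⟨(LinearEquiv.ofInjectiveOfFinrankEq B.toLinearMap hinj hdim).toContinuousLinearEquiv, ?_⟩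
  ext v w
  rfl

/-! ### Covariant derivatives over a parameter space, which may be a chart of N or of the twistor
space -/

section Parameter

variable {F : Type*} [NormedAddCommGroup F] [NormedSpace ℝ F]
  {G : F → E →L[ℝ] E →L[ℝ] ℝ} {Γ : F → F →L[ℝ] E →L[ℝ] E} {x : F}

/-- Derivative of `G(A a, b)` for a field of endomorphisms `A`, in terms of a metric connection. -/
theorem hasFDerivAt_metric_left (hG : DifferentiableAt ℝ G x)
    (hc : ∀ u v w, fderiv ℝ G x u v w = G x (Γ x u v) w + G x v (Γ x u w))
    {A : F → E →L[ℝ] E} (hA : DifferentiableAt ℝ A x) (a b : E) (u : F) :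
    DifferentiableAt ℝ (fun y ↦ G y (A y a) b) x ∧
    fderiv ℝ (fun y ↦ G y (A y a) b) x u =
      G x (Γ x u (A x a)) b + G x (A x a) (Γ x u b) + G x (fderiv ℝ A x u a) b := by
  have h1 : HasFDerivAt (fun y ↦ A y a) _ x := hA.hasFDerivAt.clm_apply (hasFDerivAt_const a x)
  have h2 := (hG.hasFDerivAt.clm_apply h1).clm_apply (hasFDerivAt_const b x)
  refine ⟨h2.differentiableAt, ?_⟩
  rw [h2.fderiv]
  simp [hc]
  abel

theorem hasFDerivAt_metric_right (hG : DifferentiableAt ℝ G x)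
    (hc : ∀ u v w, fderiv ℝ G x u v w = G x (Γ x u v) w + G x v (Γ x u w))
    {A : F → E →L[ℝ] E} (hA : DifferentiableAt ℝ A x) (a b : E) (u : F) :
    DifferentiableAt ℝ (fun y ↦ G y a (A y b)) x ∧
    fderiv ℝ (fun y ↦ G y a (A y b)) x u =
      G x (Γ x u a) (A x b) + G x a (Γ x u (A x b)) + G x a (fderiv ℝ A x u b) := by
  have h1 : HasFDerivAt (fun y ↦ A y b) _ x := hA.hasFDerivAt.clm_apply (hasFDerivAt_const b x)
  have h2 := (hG.hasFDerivAt.clm_apply (hasFDerivAt_const a x)).clm_apply h1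
  refine ⟨h2.differentiableAt, ?_⟩
  rw [h2.fderiv]
  simp [hc]
  abel

/-- The covariant derivative of a field of skew-symmetric endomorphisms is skew-symmetric. -/
theorem covDeriv_skew (hG : DifferentiableAt ℝ G x)
    (hc : ∀ u v w, fderiv ℝ G x u v w = G x (Γ x u v) w + G x v (Γ x u w))
    {A : F → E →L[ℝ] E} (hA : DifferentiableAt ℝ A x)
    (hs : ∀ᶠ y in 𝓝 x, ∀ a b, G y (A y a) b = -G y a (A y b)) (u : F) (a b : E) :
    G x ((fderiv ℝ A x u + commutator (A x) (Γ x u)) a) b =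
      -G x a ((fderiv ℝ A x u + commutator (A x) (Γ x u)) b) := by
  have h0 : (fun y ↦ G y (A y a) b) =ᶠ[𝓝 x] fun y ↦ -G y a (A y b) :=
    hs.mono fun y hy ↦ hy a b
  have h1 := h0.fderiv_eq (𝕜 := ℝ)
  have h2 := DFunLike.congr_fun h1 u
  rw [(hasFDerivAt_metric_left hG hc hA a b u).2, fderiv_fun_neg, neg_apply,
    (hasFDerivAt_metric_right hG hc hA a b u).2] at h2
  have h3 := hs.self_of_nhds
  simp only [commutator_apply, add_apply, sub_apply, mul_apply_eq_comp, map_add,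
    map_sub] at h2 ⊢
  -- Skewness of A at x turns A Γ a and A a into terms where A acts on the other argument, so that
  -- the derivative of the skewness relation becomes skewness of ∂A + [Γ, A].
  rw [h3 (Γ x u a) b]
  rw [h3 a (Γ x u b)] at h2
  linarith

/-- The covariant derivative of a field of complex structures anti-commutes with it. -/
theorem covDeriv_anticomm {z : F}
    {A : F → E →L[ℝ] E} (hA : DifferentiableAt ℝ A z)
    (hs : ∀ᶠ y in 𝓝 z, A y * A y = -1) (C : E →L[ℝ] E) (u : F) :
    (fderiv ℝ A z u + commutator (A z) C) * A z =
      -(A z * (fderiv ℝ A z u + commutator (A z) C)) := by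
  have h0 : (fun y ↦ A y * A y) =ᶠ[𝓝 z] fun _ ↦ -1 := hs
  have h1 := DFunLike.congr_fun (h0.fderiv_eq (𝕜 := ℝ)) u
  rw [(hA.hasFDerivAt.fun_mul' hA.hasFDerivAt).fderiv] at h1
  simp only [fderiv_fun_const, Pi.zero_apply, add_apply, smul_apply, zero_apply, smul_eq_mul,
    MulOpposite.smul_eq_mul_unop, MulOpposite.unop_op] at h1
  have h2 := hs.self_of_nhds
  rw [commutator_apply]
  have h3 : A z * fderiv ℝ A z u = - (fderiv ℝ A z u * A z) := eq_neg_of_add_eq_zero_left h1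
  -- The connection plays no part here: [C, A] anti-commutes with A for every C as soon as A² = -1.
  rw [add_mul, mul_add, h3, mul_sub, sub_mul, mul_assoc C, h2, ← mul_assoc (A z) (A z), h2]
  noncomm_ring

end Parameter

variable {G : E → E →L[ℝ] E →L[ℝ] ℝ} {Γ : E → E →L[ℝ] E →L[ℝ] E} {x : E}

/-- The curvature of a metric connection is skew-symmetric. -/
theorem curvature_skew (hG : ContDiffAt ℝ 2 G x) (hΓ : DifferentiableAt ℝ Γ x)
    (hc : ∀ᶠ y in 𝓝 x, ∀ u v w, fderiv ℝ G y u v w = G y (Γ y u v) w + G y v (Γ y u w))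
    (u v a b : E) :
    G x ((fderiv ℝ Γ x v u - fderiv ℝ Γ x u v + commutator (Γ x u) (Γ x v)) a) b =
      -G x a ((fderiv ℝ Γ x v u - fderiv ℝ Γ x u v + commutator (Γ x u) (Γ x v)) b) := by
  have hGd : DifferentiableAt ℝ G x := hG.differentiableAt (by norm_num)
  have hG' : DifferentiableAt ℝ (fderiv ℝ G) x :=
    (hG.fderiv_right (m := 1) (by norm_num)).differentiableAt (by norm_num)
  have hc0 := hc.self_of_nhds
  -- Metric compatibility differentiated a second time. Exchanging u and v leaves the left side
  -- unchanged, and the difference of the two right sides is the skewness of the curvature.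
  have key : ∀ u v, fderiv ℝ (fderiv ℝ G) x v u a b =
      G x (Γ x v (Γ x u a)) b + G x (Γ x u a) (Γ x v b) + G x (fderiv ℝ Γ x v u a) b +
      (G x (Γ x v a) (Γ x u b) + G x a (Γ x v (Γ x u b)) + G x a (fderiv ℝ Γ x v u b)) := by
    intro u v
    have hA : DifferentiableAt ℝ (fun y ↦ Γ y u) x := hΓ.clm_apply (differentiableAt_const u)
    have hA' : fderiv ℝ (fun y ↦ Γ y u) x v = fderiv ℝ Γ x v u := by
      rw [(hΓ.hasFDerivAt.clm_apply (hasFDerivAt_const u x)).fderiv]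
      simp
    have h0 : (fun y ↦ fderiv ℝ G y u a b) =ᶠ[𝓝 x]
        fun y ↦ G y (Γ y u a) b + G y a (Γ y u b) := hc.mono fun y hy ↦ hy u a b
    have h1 := DFunLike.congr_fun (h0.fderiv_eq (𝕜 := ℝ)) v
    obtain ⟨d1, e1⟩ := hasFDerivAt_metric_left hGd hc0 hA a b v
    obtain ⟨d2, e2⟩ := hasFDerivAt_metric_right hGd hc0 hA a b v
    rw [fderiv_fun_add d1 d2, add_apply, e1, e2, hA'] at h1
    rw [← h1, (((hG'.hasFDerivAt.clm_apply (hasFDerivAt_const u x)).clm_apply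
      (hasFDerivAt_const a x)).clm_apply (hasFDerivAt_const b x)).fderiv]
    simp
  have hsym := (hG.isSymmSndFDerivAt (by simp)).eq u v
  have h1 := key u v
  have h2 := key v u
  rw [← hsym] at h1
  simp only [commutator_apply, add_apply, sub_apply, mul_apply_eq_comp, map_add,
    map_sub]
  linarith

/-- The first Bianchi identity for a torsion-free connection. -/
theorem curvature_bianchi (hΓ : DifferentiableAt ℝ Γ x)
    (hs : ∀ᶠ y in 𝓝 x, ∀ u v, Γ y u v = Γ y v u) (u v w : E) :
    (fderiv ℝ Γ x v u - fderiv ℝ Γ x u v + commutator (Γ x u) (Γ x v)) w +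
    (fderiv ℝ Γ x w v - fderiv ℝ Γ x v w + commutator (Γ x v) (Γ x w)) u +
    (fderiv ℝ Γ x u w - fderiv ℝ Γ x w u + commutator (Γ x w) (Γ x u)) v = 0 := by
  have hs0 := hs.self_of_nhds
  -- The symmetry of Γ holds on a neighbourhood, so its derivatives inherit it.
  have key : ∀ a u v, fderiv ℝ Γ x a u v = fderiv ℝ Γ x a v u := by
    intro a u v
    have h0 : (fun y ↦ Γ y u v) =ᶠ[𝓝 x] fun y ↦ Γ y v u := hs.mono fun y hy ↦ hy u v
    have h1 := DFunLike.congr_fun (h0.fderiv_eq (𝕜 := ℝ)) a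
    rw [((hΓ.hasFDerivAt.clm_apply (hasFDerivAt_const u x)).clm_apply
      (hasFDerivAt_const v x)).fderiv, ((hΓ.hasFDerivAt.clm_apply (hasFDerivAt_const v x)).clm_apply
      (hasFDerivAt_const u x)).fderiv] at h1
    simpa using h1
  simp only [commutator_apply, add_apply, sub_apply, mul_apply_eq_comp]
  rw [key v u w, key u v w, key w v u, hs0 v w, hs0 u w, hs0 u v]
  abel

/-- The pair symmetry of an algebraic curvature tensor. -/
theorem pair_symmetry {V : Type*} {R : V → V → V → V → ℝ}
    (h1 : ∀ a b c d, R a b c d = -R b a c d) (h2 : ∀ a b c d, R a b c d = -R a b d c)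
    (h3 : ∀ a b c d, R a b c d + R b c a d + R c a b d = 0) (a b c d : V) :
    R a b c d = R c d a b := by
  -- The octahedron argument: the four cyclic identities, one for each vector in the last slot, are
  -- combined linearly. The instances of antisymmetry only bring the twelve terms to common
  -- representatives.
  have := h3 a b c d
  have := h3 b c d a
  have := h3 c d a b
  have := h3 d a b c
  have := h1 a b c d
  have := h2 a b c d
  have := h1 b c a d
  have := h2 b c a d
  have := h1 c a b d
  have := h2 c a b d
  have := h2 b c d a
  have := h1 c d b a
  have := h2 c d b a
  have := h1 d b c a
  have := h2 d b c a
  have := h2 b d c a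
  have := h2 b d a c
  have := h1 a c d b
  have := h1 d a c b
  have := h2 d a c b
  have := h2 a d c b
  have := h1 a b d c
  have := h1 b d a c
  have := h2 a c d b
  have := h2 a c b d
  have := h2 a d b c
  have := h1 d a b c
  have := h2 d a b c
  linarith

end Calculus

/-! ### The Levi-Civita connection in a chart and its change of charts -/

section Christoffel

variable {E : Type*} [NormedAddCommGroup E] [NormedSpace ℝ E]
  {M : Type*} [TopologicalSpace M] [ChartedSpace E M] {h : BilinField E M} {p : M} {y : E}

theorem coordMetric_christoffel (hB : (coordMetric h p y).IsInvertible) (u v w : E) :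
    coordMetric h p y (christoffel h p y u v) w = christoffelFirst h p y u v w := by
  rw [christoffel_apply, hB.self_apply_inverse]

theorem fderiv_coordMetric_symm (hd : DifferentiableAt ℝ (coordMetric h p) y)
    (hs : ∀ᶠ z in 𝓝 y, ∀ v w, coordMetric h p z v w = coordMetric h p z w v) (u v w : E) :
    fderiv ℝ (coordMetric h p) y u v w = fderiv ℝ (coordMetric h p) y u w v := by
  have h0 : (fun z ↦ coordMetric h p z v w) =ᶠ[𝓝 y] fun z ↦ coordMetric h p z w v :=
    hs.mono fun z hz ↦ hz v w
  have h1 := DFunLike.congr_fun (h0.fderiv_eq (𝕜 := ℝ)) u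
  rw [((hd.hasFDerivAt.clm_apply (hasFDerivAt_const v y)).clm_apply
      (hasFDerivAt_const w y)).fderiv, ((hd.hasFDerivAt.clm_apply (hasFDerivAt_const w y)).clm_apply
      (hasFDerivAt_const v y)).fderiv] at h1
  simpa using h1

theorem christoffel_symm (hd : DifferentiableAt ℝ (coordMetric h p) y)
    (hs : ∀ᶠ z in 𝓝 y, ∀ v w, coordMetric h p z v w = coordMetric h p z w v) (u v : E) :
    christoffel h p y u v = christoffel h p y v u := by
  rw [christoffel_apply, christoffel_apply]
  congr 1
  ext w
  rw [christoffelFirst_apply, christoffelFirst_apply, fderiv_coordMetric_symm hd hs w u v]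
  ring

/-- Metric compatibility: in Γ(u, v; w) + Γ(u, w; v) the derivatives along v and w cancel and the
two halves of ∂_u h(v, w) add up. -/
theorem fderiv_coordMetric (hd : DifferentiableAt ℝ (coordMetric h p) y)
    (hs : ∀ᶠ z in 𝓝 y, ∀ v w, coordMetric h p z v w = coordMetric h p z w v)
    (hB : (coordMetric h p y).IsInvertible) (u v w : E) :
    fderiv ℝ (coordMetric h p) y u v w = coordMetric h p y (christoffel h p y u v) w +
      coordMetric h p y v (christoffel h p y u w) := by
  rw [hs.self_of_nhds v, coordMetric_christoffel hB, coordMetric_christoffel hB,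
    christoffelFirst_apply, christoffelFirst_apply, fderiv_coordMetric_symm hd hs v u w,
    fderiv_coordMetric_symm hd hs w u v, fderiv_coordMetric_symm hd hs u w v]
  ring

/-- The transformation law of the Christoffel symbols under a change of charts `ψ`. -/
theorem christoffel_change {q : M} {ψ : E → E} (hψ : ContDiffAt ℝ 2 ψ y)
    (hψ' : Function.Surjective (fderiv ℝ ψ y))
    (hm : ∀ᶠ z in 𝓝 y, ∀ v w, coordMetric h p z v w =
      coordMetric h q (ψ z) (fderiv ℝ ψ z v) (fderiv ℝ ψ z w))
    (hd : DifferentiableAt ℝ (coordMetric h q) (ψ y))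
    (hs : ∀ z, ∀ v w, coordMetric h q z v w = coordMetric h q z w v)
    (hB : (coordMetric h p y).IsInvertible) (hB' : (coordMetric h q (ψ y)).IsInvertible)
    (hdp : DifferentiableAt ℝ (coordMetric h p) y) (u v : E) :
    fderiv ℝ ψ y (christoffel h p y u v) = fderiv ℝ (fderiv ℝ ψ) y u v +
      christoffel h q (ψ y) (fderiv ℝ ψ y u) (fderiv ℝ ψ y v) := by
  have hψd : DifferentiableAt ℝ ψ y := hψ.differentiableAt (by norm_num)
  have hψ2 : DifferentiableAt ℝ (fderiv ℝ ψ) y :=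
    (hψ.fderiv_right (m := 1) (by norm_num)).differentiableAt (by norm_num)
  have hsym := (hψ.isSymmSndFDerivAt (by simp)).eq
  -- Product and chain rule for the metric pulled back by ψ. In the Koszul combination of these,
  -- only the term pairing D²ψ(u, v) with Dψ w survives besides the first-kind symbols.
  have hD : ∀ u v w, fderiv ℝ (coordMetric h p) y u v w =
      fderiv ℝ (coordMetric h q) (ψ y) (fderiv ℝ ψ y u) (fderiv ℝ ψ y v) (fderiv ℝ ψ y w) +
      coordMetric h q (ψ y) (fderiv ℝ (fderiv ℝ ψ) y u v) (fderiv ℝ ψ y w) +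
      coordMetric h q (ψ y) (fderiv ℝ ψ y v) (fderiv ℝ (fderiv ℝ ψ) y u w) := by
    intro u v w
    have h0 : (fun z ↦ coordMetric h p z v w) =ᶠ[𝓝 y] fun z ↦
      coordMetric h q (ψ z) (fderiv ℝ ψ z v) (fderiv ℝ ψ z w) := hm.mono fun z hz ↦ hz v w
    have h1 := DFunLike.congr_fun (h0.fderiv_eq (𝕜 := ℝ)) u
    have ha : ∀ v, HasFDerivAt (fun z ↦ fderiv ℝ ψ z v) _ y := fun v ↦
      hψ2.hasFDerivAt.clm_apply (hasFDerivAt_const v y)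
    have hb : HasFDerivAt (fun z ↦ coordMetric h q (ψ z)) _ y :=
      hd.hasFDerivAt.comp y hψd.hasFDerivAt
    rw [((hdp.hasFDerivAt.clm_apply (hasFDerivAt_const v y)).clm_apply
      (hasFDerivAt_const w y)).fderiv, ((hb.clm_apply (ha v)).clm_apply (ha w)).fderiv] at h1
    simp at h1
    rw [h1]
    ring
  have hm0 := hm.self_of_nhds
  have key : ∀ w, coordMetric h q (ψ y) (fderiv ℝ ψ y (christoffel h p y u v)) w =
      coordMetric h q (ψ y) (fderiv ℝ (fderiv ℝ ψ) y u v +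
      christoffel h q (ψ y) (fderiv ℝ ψ y u) (fderiv ℝ ψ y v)) w := by
    intro w'
    -- Testing on the image of Dψ is enough, and there the pairing is one in the source chart.
    obtain ⟨w, rfl⟩ := hψ' w'
    rw [← hm0, coordMetric_christoffel hB, map_add, add_apply, coordMetric_christoffel hB',
      christoffelFirst_apply, christoffelFirst_apply, hD, hD, hD, hsym v u, hsym w u, hsym w v,
      hs _ (fderiv ℝ ψ y u) (fderiv ℝ (fderiv ℝ ψ) y v w),
      hs _ (fderiv ℝ ψ y v) (fderiv ℝ (fderiv ℝ ψ) y u w)]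
    ring
  exact hB'.injective (by ext w; exact key w)

end Christoffel

/-! ### Coordinate frames as endomorphisms of the model space -/

section Charts

variable {E : Type*} [NormedAddCommGroup E] [NormedSpace ℝ E]
  {M : Type*} [TopologicalSpace M] [ChartedSpace E M]

/-- The coordinate frame as an endomorphism of the model space, the tangent space at each point
being identified with the model space by the preferred chart at this point. -/
def frame (p : M) (y : E) : E →L[ℝ] E := coordFrame p y

/-- The coordinate coframe as an endomorphism of the model space. -/
def coframe (p : M) (y : E) : E →L[ℝ] E := coordCoframe p y

/-- An endomorphism of a tangent space as an endomorphism of the model space. -/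
def modelEnd {q : M} (A : TangentSpace 𝓘(ℝ, E) q →L[ℝ] TangentSpace 𝓘(ℝ, E) q) : E →L[ℝ] E := A

/-- A tangent vector as an element of the model space. -/
def modelVec {q : M} (v : TangentSpace 𝓘(ℝ, E) q) : E := v

/-- The value at `q` of a field of bilinear forms, on the model space. -/
def modelBilin (h : BilinField E M) (q : M) : E →L[ℝ] E →L[ℝ] ℝ := h q

/-- The change of coordinates between the charts at `p` and `q`. -/
def chartTrans (p q : M) : E → E := extChartAt 𝓘(ℝ, E) q ∘ (extChartAt 𝓘(ℝ, E) p).symm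

theorem coordMetric_apply (h : BilinField E M) (p : M) (y u v : E) :
    coordMetric h p y u v =
      modelBilin h ((extChartAt 𝓘(ℝ, E) p).symm y) (frame p y u) (frame p y v) := rfl

theorem coordEnd_eq (K : EndField E M) (p : M) (y : E) : coordEnd K p y =
    coframe p y * modelEnd (K ((extChartAt 𝓘(ℝ, E) p).symm y)) * frame p y := rfl

theorem extChartAt_symm_mem_chart_source {p : M} {y : E}
    (hy : y ∈ (extChartAt 𝓘(ℝ, E) p).target) :
    (extChartAt 𝓘(ℝ, E) p).symm y ∈ (chartAt E p).source := by
  rw [← extChartAt_source 𝓘(ℝ, E)]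
  exact (extChartAt 𝓘(ℝ, E) p).map_target hy

theorem eventually_chartTrans {p q : M} {y : E} (hy : y ∈ (extChartAt 𝓘(ℝ, E) p).target)
    (hq : (extChartAt 𝓘(ℝ, E) p).symm y ∈ (extChartAt 𝓘(ℝ, E) q).source) :
    ∀ᶠ z in 𝓝 y, z ∈ (extChartAt 𝓘(ℝ, E) p).target ∧
      (extChartAt 𝓘(ℝ, E) p).symm z ∈ (extChartAt 𝓘(ℝ, E) q).source := by
  refine Filter.Eventually.and ((isOpen_extChartAt_target (I := 𝓘(ℝ, E)) p).mem_nhds hy) ?_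
  exact (continuousAt_extChartAt_symm'' hy).eventually
    ((isOpen_extChartAt_source (I := 𝓘(ℝ, E)) q).mem_nhds hq)

variable [IsManifold 𝓘(ℝ, E) ∞ M]

theorem isManifold_one : IsManifold 𝓘(ℝ, E) 1 M := IsManifold.of_le (n := ∞) (by simp)

theorem contDiffAt_chartTrans {p q : M} {y : E} (hy : y ∈ (extChartAt 𝓘(ℝ, E) p).target)
    (hq : (extChartAt 𝓘(ℝ, E) p).symm y ∈ (extChartAt 𝓘(ℝ, E) q).source) :
    ContDiffAt ℝ ∞ (chartTrans p q) y := by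
  have h := contDiffWithinAt_ext_coord_change (I := 𝓘(ℝ, E)) (n := ∞) q p (y := y) ⟨hy, hq⟩
  rwa [modelWithCornersSelf_coe, Set.range_id, contDiffWithinAt_univ] at h

theorem mdifferentiableAt_chart_symm {p : M} {y : E} (hy : y ∈ (extChartAt 𝓘(ℝ, E) p).target) :
    MDifferentiableAt 𝓘(ℝ, E) 𝓘(ℝ, E) (extChartAt 𝓘(ℝ, E) p).symm y := by
  have : IsManifold 𝓘(ℝ, E) 1 M := isManifold_one
  have h := mdifferentiableWithinAt_extChartAt_symm (I := 𝓘(ℝ, E)) hy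
  rwa [modelWithCornersSelf_coe, Set.range_id, mdifferentiableWithinAt_univ] at h

/-- A tangent vector at r is a model vector read in the chart preferred at r. The manifold
derivative of the inverse chart at y is therefore that of a transition map, into the chart of the
point with coordinates y, which itself varies with y. -/
theorem frame_eq_fderiv {p : M} {y : E} (hy : y ∈ (extChartAt 𝓘(ℝ, E) p).target) :
    frame p y = fderiv ℝ (chartTrans p ((extChartAt 𝓘(ℝ, E) p).symm y)) y := by
  have h := mdifferentiableAt_chart_symm hy
  simp only [frame, coordFrame, mfderiv, h]
  simp only [modelWithCornersSelf_coe, Set.range_id, fderivWithin_univ]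
  rfl

/-- The chain rule for the transitions p → q → r, where r is the point with coordinates y. -/
theorem frame_chartTrans {p q : M} {y : E} (hy : y ∈ (extChartAt 𝓘(ℝ, E) p).target)
    (hq : (extChartAt 𝓘(ℝ, E) p).symm y ∈ (extChartAt 𝓘(ℝ, E) q).source) :
    frame q (chartTrans p q y) * fderiv ℝ (chartTrans p q) y = frame p y := by
  have hr : (extChartAt 𝓘(ℝ, E) q).symm (chartTrans p q y) = (extChartAt 𝓘(ℝ, E) p).symm y :=
    (extChartAt 𝓘(ℝ, E) q).left_inv hq
  have hy' : chartTrans p q y ∈ (extChartAt 𝓘(ℝ, E) q).target :=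
    (extChartAt 𝓘(ℝ, E) q).map_source hq
  have hs : (extChartAt 𝓘(ℝ, E) p).symm y ∈
      (extChartAt 𝓘(ℝ, E) ((extChartAt 𝓘(ℝ, E) p).symm y)).source := mem_extChartAt_source _
  rw [frame_eq_fderiv hy, frame_eq_fderiv hy', hr]
  have h1 : DifferentiableAt ℝ (chartTrans q ((extChartAt 𝓘(ℝ, E) p).symm y))
      (chartTrans p q y) :=
    (contDiffAt_chartTrans hy' (by rw [hr]; exact hs)).differentiableAt (by simp)
  have h2 : DifferentiableAt ℝ (chartTrans p q) y :=
    (contDiffAt_chartTrans hy hq).differentiableAt (by simp)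
  change (fderiv ℝ _ _).comp _ = _
  rw [← fderiv_comp y h1 h2]
  apply Filter.EventuallyEq.fderiv_eq
  filter_upwards [eventually_chartTrans hy hq] with z hz
  simp only [chartTrans, Function.comp_apply]
  rw [(extChartAt 𝓘(ℝ, E) q).left_inv hz.2]

theorem coframe_mul_frame {p : M} {y : E} (hy : y ∈ (extChartAt 𝓘(ℝ, E) p).target) :
    coframe p y * frame p y = 1 := by
  have : IsManifold 𝓘(ℝ, E) 1 M := isManifold_one
  have h := mfderiv_extChartAt_comp_mfderivWithin_extChartAt_symm (I := 𝓘(ℝ, E)) hy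
  rw [modelWithCornersSelf_coe, Set.range_id, mfderivWithin_univ] at h
  exact h

theorem frame_mul_coframe {p : M} {y : E} (hy : y ∈ (extChartAt 𝓘(ℝ, E) p).target) :
    frame p y * coframe p y = 1 := by
  have : IsManifold 𝓘(ℝ, E) 1 M := isManifold_one
  have h := mfderivWithin_extChartAt_symm_comp_mfderiv_extChartAt (I := 𝓘(ℝ, E)) hy
  rw [modelWithCornersSelf_coe, Set.range_id, mfderivWithin_univ] at h
  exact h

/-- At its own centre a chart induces the identity on the model space. For this reason formulas
written in the chart at p give tensors on T_p N without any correction. -/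
theorem frame_self (p : M) : frame p (extChartAt 𝓘(ℝ, E) p p) = 1 := by
  have : IsManifold 𝓘(ℝ, E) 1 M := isManifold_one
  have h := mfderivWithin_range_extChartAt_symm (I := 𝓘(ℝ, E)) (x := p)
  rw [modelWithCornersSelf_coe, Set.range_id, mfderivWithin_univ] at h
  exact h

theorem coframe_self (p : M) : coframe p (extChartAt 𝓘(ℝ, E) p p) = 1 := by
  have h := coframe_mul_frame (mem_extChartAt_target (I := 𝓘(ℝ, E)) p)
  rwa [frame_self, mul_one] at h

theorem coordMetric_self (h : BilinField E M) (p : M) (u v : E) :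
    coordMetric h p (extChartAt 𝓘(ℝ, E) p p) u v = modelBilin h p u v := by
  rw [coordMetric_apply, frame_self, extChartAt_to_inv]
  rfl

theorem coordMetric_chartTrans (h : BilinField E M) {p q : M} {y : E}
    (hy : y ∈ (extChartAt 𝓘(ℝ, E) p).target)
    (hq : (extChartAt 𝓘(ℝ, E) p).symm y ∈ (extChartAt 𝓘(ℝ, E) q).source) (u v : E) :
    coordMetric h p y u v = coordMetric h q (chartTrans p q y)
      (fderiv ℝ (chartTrans p q) y u) (fderiv ℝ (chartTrans p q) y v) := by
  have hr : (extChartAt 𝓘(ℝ, E) q).symm (chartTrans p q y) = (extChartAt 𝓘(ℝ, E) p).symm y :=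
    (extChartAt 𝓘(ℝ, E) q).left_inv hq
  rw [coordMetric_apply, coordMetric_apply, ← frame_chartTrans hy hq, hr]
  rfl

end Charts

/-! ### Smoothness of the metric and of its Christoffel symbols in charts -/

section MetricCharts

variable {m : ℕ} {N : Type*} [TopologicalSpace N] [ChartedSpace (Model m) N]
  [IsManifold 𝓘(ℝ, Model m) ∞ N]

theorem coordMetric_symm (g : Metric m N) (p : N) (y u v : Model m) :
    coordMetric g.inner p y u v = coordMetric g.inner p y v u :=
  g.symm _ _ _

theorem coordMetric_pos (g : Metric m N) {p : N} {y : Model m}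
    (hy : y ∈ (extChartAt 𝓘(ℝ, Model m) p).target) {v : Model m} (hv : v ≠ 0) :
    0 < coordMetric g.inner p y v v := by
  rw [coordMetric_apply]
  refine g.pos _ _ fun h0 ↦ hv ?_
  have h1 : coframe p y (frame p y v) = v := DFunLike.congr_fun (coframe_mul_frame hy) v
  have h2 : frame p y v = 0 := h0
  rw [← h1, h2, map_zero]

theorem isInvertible_coordMetric (g : Metric m N) {p : N} {y : Model m}
    (hy : y ∈ (extChartAt 𝓘(ℝ, Model m) p).target) :
    (coordMetric g.inner p y).IsInvertible := by
  refine isInvertible_of_separating fun v hv ↦ ?_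
  by_contra h
  exact (coordMetric_pos g hy h).ne' (hv v)

/-- Links bundle smoothness with coordinates: the fields that are constant in the tangent bundle
trivialization at p are the coordinate fields. -/
theorem symmL_eq_frame {p q : N} (hq : q ∈ (chartAt (Model m) p).source) (u : Model m) :
    ((trivializationAt (Model m) (TangentSpace 𝓘(ℝ, Model m) : N → Type _)
      p).symm q u : Model m) = frame p (extChartAt 𝓘(ℝ, Model m) p q) u := by
  have : IsManifold 𝓘(ℝ, Model m) 1 N := isManifold_one
  have h := TangentBundle.symmL_trivializationAt (I := 𝓘(ℝ, Model m)) hq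
  rw [modelWithCornersSelf_coe, Set.range_id, mfderivWithin_univ] at h
  have h' := DFunLike.congr_fun h u
  rw [Bundle.Trivialization.symmL_apply _ (by exact hq)] at h'
  exact h'

theorem smoothField_symm (p : N) (u : Model m) :
    SmoothField (chartAt (Model m) p).source (fun q : N ↦
      (trivializationAt (Model m) (TangentSpace 𝓘(ℝ, Model m) : N → Type _) p).symm q u) := by
  refine (Bundle.Trivialization.contMDiffOn_section_baseSet_iff (IB := 𝓘(ℝ, Model m)) (n := ∞)
    (trivializationAt (Model m) (TangentSpace 𝓘(ℝ, Model m) : N → Type _) p)).2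
    ((contMDiffOn_const (c := u)).congr ?_)
  intro y hy
  rw [Bundle.Trivialization.apply_mk_symm _ hy]

theorem symm_eq_frame {p : N} {y : Model m} (hy : y ∈ (extChartAt 𝓘(ℝ, Model m) p).target)
    (u : Model m) : ((trivializationAt (Model m) (TangentSpace 𝓘(ℝ, Model m) : N → Type _) p).symm
      ((extChartAt 𝓘(ℝ, Model m) p).symm y) u : Model m) = frame p y u := by
  rw [symmL_eq_frame (extChartAt_symm_mem_chart_source hy),
    (extChartAt 𝓘(ℝ, Model m) p).right_inv hy]

theorem contDiffOn_coordMetric (g : Metric m N) (p : N) :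
    ContDiffOn ℝ ∞ (coordMetric g.inner p) (extChartAt 𝓘(ℝ, Model m) p).target := by
  rw [contDiffOn_clm_apply]
  intro u
  rw [contDiffOn_clm_apply]
  intro v
  have h := (smooth_inner g (smoothField_symm p u) (smoothField_symm p v)).comp
    (contMDiffOn_extChartAt_symm (n := ∞) (I := 𝓘(ℝ, Model m)) p)
    (fun y hy ↦ extChartAt_symm_mem_chart_source hy)
  refine h.contDiffOn.congr ?_
  intro y hy
  rw [coordMetric_apply, ← symm_eq_frame hy u, ← symm_eq_frame hy v]
  rfl

theorem contDiffOn_christoffel (g : Metric m N) (p : N) :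
    ContDiffOn ℝ ∞ (christoffel g.inner p) (extChartAt 𝓘(ℝ, Model m) p).target := by
  have hG := contDiffOn_coordMetric g p
  have ho : IsOpen (extChartAt 𝓘(ℝ, Model m) p).target := isOpen_extChartAt_target p
  have hG' : ContDiffOn ℝ ∞ (fderiv ℝ (coordMetric g.inner p))
      (extChartAt 𝓘(ℝ, Model m) p).target := hG.fderiv_of_isOpen ho (by simp)
  have hc : ∀ u v w : Model m, ContDiffOn ℝ ∞
      (fun y ↦ fderiv ℝ (coordMetric g.inner p) y u v w) (extChartAt 𝓘(ℝ, Model m) p).target :=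
    fun u v w ↦ ((hG'.clm_apply contDiffOn_const).clm_apply contDiffOn_const).clm_apply
      contDiffOn_const
  have h1 : ContDiffOn ℝ ∞ (christoffelFirst g.inner p) (extChartAt 𝓘(ℝ, Model m) p).target := by
    rw [contDiffOn_clm_apply]
    intro u
    rw [contDiffOn_clm_apply]
    intro v
    rw [contDiffOn_clm_apply]
    intro w
    simp only [christoffelFirst_apply]
    exact contDiffOn_const.mul (((hc u v w).add (hc v u w)).sub (hc w u v))
  have h2 : ContDiffOn ℝ ∞ (fun y ↦ (coordMetric g.inner p y).inverse)
      (extChartAt 𝓘(ℝ, Model m) p).target := by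
    intro y hy
    exact (isInvertible_coordMetric g hy).contDiffAt_map_inverse.comp_contDiffWithinAt y (hG y hy)
  rw [contDiffOn_clm_apply]
  intro u
  rw [contDiffOn_clm_apply]
  intro v
  simp only [christoffel_apply]
  exact h2.clm_apply ((h1.clm_apply contDiffOn_const).clm_apply contDiffOn_const)

variable (g : Metric m N) {p : N} {y : Model m}

theorem contDiffAt_coordMetric (hy : y ∈ (extChartAt 𝓘(ℝ, Model m) p).target) :
    ContDiffAt ℝ ∞ (coordMetric g.inner p) y :=
  (contDiffOn_coordMetric g p).contDiffAt ((isOpen_extChartAt_target p).mem_nhds hy)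

theorem contDiffAt_christoffel (hy : y ∈ (extChartAt 𝓘(ℝ, Model m) p).target) :
    ContDiffAt ℝ ∞ (christoffel g.inner p) y :=
  (contDiffOn_christoffel g p).contDiffAt ((isOpen_extChartAt_target p).mem_nhds hy)

theorem metric_christoffel_symm (hy : y ∈ (extChartAt 𝓘(ℝ, Model m) p).target) (u v : Model m) :
    christoffel g.inner p y u v = christoffel g.inner p y v u :=
  christoffel_symm ((contDiffAt_coordMetric g hy).differentiableAt (by simp))
    (Filter.Eventually.of_forall fun _ ↦ coordMetric_symm g p _) u v

theorem fderiv_metric (hy : y ∈ (extChartAt 𝓘(ℝ, Model m) p).target) (u v w : Model m) :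
    fderiv ℝ (coordMetric g.inner p) y u v w =
      coordMetric g.inner p y (christoffel g.inner p y u v) w +
      coordMetric g.inner p y v (christoffel g.inner p y u w) :=
  fderiv_coordMetric ((contDiffAt_coordMetric g hy).differentiableAt (by simp))
    (Filter.Eventually.of_forall fun _ ↦ coordMetric_symm g p _)
    (isInvertible_coordMetric g hy) u v w

/-- The transformation law with q the very point with coordinates y. The differential of the
transition is then the frame, and the Christoffel symbols on the right are those entering the
connection map over q. -/
theorem christoffel_chartTrans {q : N} (hy : y ∈ (extChartAt 𝓘(ℝ, Model m) p).target)
    (hq : (extChartAt 𝓘(ℝ, Model m) p).symm y = q) (u v : Model m) :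
    frame p y (christoffel g.inner p y u v) = fderiv ℝ (fderiv ℝ (chartTrans p q)) y u v +
      christoffel g.inner q (extChartAt 𝓘(ℝ, Model m) q q) (frame p y u) (frame p y v) := by
  have hqs : (extChartAt 𝓘(ℝ, Model m) p).symm y ∈ (extChartAt 𝓘(ℝ, Model m) q).source := by
    rw [hq]; exact mem_extChartAt_source q
  have hψ : chartTrans p q y = extChartAt 𝓘(ℝ, Model m) q q := by
    rw [chartTrans, Function.comp_apply, hq]
  have hf : fderiv ℝ (chartTrans p q) y = frame p y := by rw [frame_eq_fderiv hy, hq]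
  have hyq : chartTrans p q y ∈ (extChartAt 𝓘(ℝ, Model m) q).target := by
    rw [hψ]; exact mem_extChartAt_target q
  have h := christoffel_change (h := g.inner) (p := p) (q := q) (y := y) (ψ := chartTrans p q)
    ((contDiffAt_chartTrans hy hqs).of_le (by norm_cast))
    (by
      intro w
      refine ⟨coframe p y w, ?_⟩
      rw [hf]
      exact DFunLike.congr_fun (frame_mul_coframe hy) w)
    ((eventually_chartTrans hy hqs).mono fun z hz v w ↦
      coordMetric_chartTrans g.inner hz.1 hz.2 v w)
    ((contDiffAt_coordMetric g hyq).differentiableAt (by simp))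
    (fun z ↦ coordMetric_symm g q z) (isInvertible_coordMetric g hy)
    (isInvertible_coordMetric g hyq) ((contDiffAt_coordMetric g hy).differentiableAt (by simp)) u v
  rwa [hf, hψ] at h

end MetricCharts

/-! ### Differentials of maps, read through inverse charts -/

section ChartDerivatives

variable {E : Type*} [NormedAddCommGroup E] [NormedSpace ℝ E]
  {M : Type*} [TopologicalSpace M] [ChartedSpace E M]
  {E' : Type*} [NormedAddCommGroup E'] [NormedSpace ℝ E']
  {M' : Type*} [TopologicalSpace M'] [ChartedSpace E' M']

variable (E E') in
/-- The differential of a map, on the model spaces. -/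
def mfderivModel (f : M → M') (x : M) : E →L[ℝ] E' := mfderiv 𝓘(ℝ, E) 𝓘(ℝ, E') f x

theorem mfderivModel_congr {f f' : M → M'} {x : M} (h : f =ᶠ[𝓝 x] f') :
    mfderivModel E E' f x = mfderivModel E E' f' x :=
  h.mfderiv_eq

theorem mfderivModel_eq_fderiv (f : E → E') (y : E) : mfderivModel E E' f y = fderiv ℝ f y :=
  mfderiv_eq_fderiv

variable [IsManifold 𝓘(ℝ, E) ∞ M]

theorem mdifferentiableAt_of_comp_symm {f : M → M'} {p : M} {y : E}
    (hy : y ∈ (extChartAt 𝓘(ℝ, E) p).target)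
    (hf : MDifferentiableAt 𝓘(ℝ, E) 𝓘(ℝ, E') (f ∘ (extChartAt 𝓘(ℝ, E) p).symm) y) :
    MDifferentiableAt 𝓘(ℝ, E) 𝓘(ℝ, E') f ((extChartAt 𝓘(ℝ, E) p).symm y) := by
  have : IsManifold 𝓘(ℝ, E) 1 M := isManifold_one
  have hs : (extChartAt 𝓘(ℝ, E) p).symm y ∈ (extChartAt 𝓘(ℝ, E) p).source :=
    (extChartAt 𝓘(ℝ, E) p).map_target hy
  have h1 : MDifferentiableAt 𝓘(ℝ, E) 𝓘(ℝ, E) (extChartAt 𝓘(ℝ, E) p)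
      ((extChartAt 𝓘(ℝ, E) p).symm y) :=
    mdifferentiableAt_extChartAt (by rwa [extChartAt_source] at hs)
  have h2 : MDifferentiableAt 𝓘(ℝ, E) 𝓘(ℝ, E')
      ((f ∘ (extChartAt 𝓘(ℝ, E) p).symm) ∘ extChartAt 𝓘(ℝ, E) p)
      ((extChartAt 𝓘(ℝ, E) p).symm y) := by
    refine MDifferentiableAt.comp _ ?_ h1
    rwa [(extChartAt 𝓘(ℝ, E) p).right_inv hy]
  refine h2.congr_of_eventuallyEq ?_
  filter_upwards [(isOpen_extChartAt_source (I := 𝓘(ℝ, E)) p).mem_nhds hs] with q hq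
  simp only [Function.comp_apply]
  rw [(extChartAt 𝓘(ℝ, E) p).left_inv hq]

theorem mfderivModel_comp_symm {f : M → M'} {p : M} {y : E}
    (hy : y ∈ (extChartAt 𝓘(ℝ, E) p).target)
    (hf : MDifferentiableAt 𝓘(ℝ, E) 𝓘(ℝ, E') (f ∘ (extChartAt 𝓘(ℝ, E) p).symm) y) :
    mfderivModel E E' (f ∘ (extChartAt 𝓘(ℝ, E) p).symm) y =
      (mfderivModel E E' f ((extChartAt 𝓘(ℝ, E) p).symm y)).comp (frame p y) :=
  mfderiv_comp y (mdifferentiableAt_of_comp_symm hy hf) (mdifferentiableAt_chart_symm hy)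

theorem mfderivModel_symm_comp {f : E' → E} {p : M} {y : E'}
    (hy : f y ∈ (extChartAt 𝓘(ℝ, E) p).target) (hf : DifferentiableAt ℝ f y) :
    MDifferentiableAt 𝓘(ℝ, E') 𝓘(ℝ, E) ((extChartAt 𝓘(ℝ, E) p).symm ∘ f) y ∧
    mfderivModel E' E ((extChartAt 𝓘(ℝ, E) p).symm ∘ f) y = (frame p (f y)).comp (fderiv ℝ f y) := by
  have h1 := mdifferentiableAt_chart_symm hy
  refine ⟨h1.comp y hf.mdifferentiableAt, ?_⟩
  have h2 := mfderiv_comp y h1 hf.mdifferentiableAt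
  rw [mfderiv_eq_fderiv] at h2
  exact h2

end ChartDerivatives

/-! ### The charts of the twistor space and the tautological complex structure -/

section TwistorCharts

variable {m : ℕ} {N : Type*} [TopologicalSpace N] [ChartedSpace (Model m) N]
  [IsManifold 𝓘(ℝ, Model m) ∞ N] {g : Metric m N}

/-- The orthonormal frame used in the preferred chart of the twistor space at `σ`. -/
def adaptedFrame (σ : TwistorSpace g) : OrthoFrame g := (exists_adaptedFrame σ).choose

theorem proj_mem_adaptedFrame (σ : TwistorSpace g) : σ.proj ∈ (adaptedFrame σ).dom :=
  (exists_adaptedFrame σ).choose_spec.1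

theorem mat_adaptedFrame (σ : TwistorSpace g) : (adaptedFrame σ).mat σ = stdJ m :=
  (exists_adaptedFrame σ).choose_spec.2

theorem extChartAt_twistor (σ τ : TwistorSpace g) :
    extChartAt 𝓘(ℝ, Model m × StdTangent m) σ τ =
      (extChartAt 𝓘(ℝ, Model m) σ.proj τ.proj, stdProj m (cayley ((adaptedFrame σ).mat τ))) := rfl

theorem extChartAt_twistor_symm (σ : TwistorSpace g) (z : Model m × StdTangent m) :
    (extChartAt 𝓘(ℝ, Model m × StdTangent m) σ).symm z =
      twistorPoint (adaptedFrame σ) (chartAt (Model m) σ.proj) σ z := rfl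

theorem mem_twistor_source (σ τ : TwistorSpace g) :
    τ ∈ (extChartAt 𝓘(ℝ, Model m × StdTangent m) σ).source ↔
      τ.proj ∈ (extChartAt 𝓘(ℝ, Model m) σ.proj).source ∧ τ.proj ∈ (adaptedFrame σ).dom ∧
        IsUnit (1 - stdJ m * (adaptedFrame σ).mat τ) := by
  rw [extChartAt_source, extChartAt_source]
  rfl

theorem mem_twistor_target (σ : TwistorSpace g) (z : Model m × StdTangent m) :
    z ∈ (extChartAt 𝓘(ℝ, Model m × StdTangent m) σ).target ↔
      z.1 ∈ (extChartAt 𝓘(ℝ, Model m) σ.proj).target ∧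
        (extChartAt 𝓘(ℝ, Model m) σ.proj).symm z.1 ∈ (adaptedFrame σ).dom := by
  rw [extChartAt_target, extChartAt_target]
  simp only [modelWithCornersSelf_coe, Set.range_id, Set.inter_univ, modelWithCornersSelf_coe_symm,
    Set.preimage_id_eq, id_eq]
  rfl

/-- The fibre coordinate of the centre is 0 because the adapted frame turns σ into J₀, and 1 + J₀J₀
= 0. -/
theorem extChartAt_twistor_self (σ : TwistorSpace g) :
    extChartAt 𝓘(ℝ, Model m × StdTangent m) σ σ =
      (extChartAt 𝓘(ℝ, Model m) σ.proj σ.proj, 0) := by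
  rw [extChartAt_twistor, mat_adaptedFrame, cayley, stdJ_mul_self, add_neg_cancel, zero_mul,
    map_zero]

variable {σ : TwistorSpace g} {z : Model m × StdTangent m}

theorem proj_twistor_symm (hz : z ∈ (extChartAt 𝓘(ℝ, Model m × StdTangent m) σ).target) :
    ((extChartAt 𝓘(ℝ, Model m × StdTangent m) σ).symm z).proj =
      (extChartAt 𝓘(ℝ, Model m) σ.proj).symm z.1 := by
  rw [extChartAt_twistor_symm]
  exact twistorPoint_proj _ _ _ _ ((mem_twistor_target σ z).1 hz).2

theorem eventually_twistor_target
    (hz : z ∈ (extChartAt 𝓘(ℝ, Model m × StdTangent m) σ).target) :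
    ∀ᶠ z' in 𝓝 z, z' ∈ (extChartAt 𝓘(ℝ, Model m × StdTangent m) σ).target :=
  (isOpen_extChartAt_target σ).mem_nhds hz

theorem coordCs_eq {p : N} {y : Model m} (hy : y ∈ (extChartAt 𝓘(ℝ, Model m) p).target)
    (τ : TwistorSpace g) (hτ : τ.proj = (extChartAt 𝓘(ℝ, Model m) p).symm y) :
    TwistorSpace.coordCs p τ = coframe p y * modelEnd τ.cs * frame p y := by
  obtain ⟨q, I, h1, h2⟩ := τ
  change q = _ at hτ
  subst hτ
  -- `coordCs` uses the formal inverse of the chart differential. It is a true inverse on the target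
  -- of the chart, namely the frame.
  have hinv : (coframe p y).inverse = frame p y :=
    ContinuousLinearMap.inverse_eq (coframe_mul_frame hy) (frame_mul_coframe hy)
  rw [← hinv]
  rfl

/-- The components of the complex structure in the chart of `N` at `σ.proj`, as a function of the
coordinates in the chart of the twistor space at `σ`. -/
def csField (σ : TwistorSpace g) (z : Model m × StdTangent m) : Model m →L[ℝ] Model m :=
  TwistorSpace.coordCs σ.proj ((extChartAt 𝓘(ℝ, Model m × StdTangent m) σ).symm z)

/-- The components of the vectors of the coordinate frame of the chart at `p` with respect to an
orthonormal frame. -/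
def frameCoord (F : OrthoFrame g) (p : N) (y : Model m) : Model m →L[ℝ] Std m :=
  (F.coord ((extChartAt 𝓘(ℝ, Model m) p).symm y)).comp (coordFrame p y)

/-- The components in the chart at `p` of the vectors of an orthonormal frame. -/
def frameLin (F : OrthoFrame g) (p : N) (y : Model m) : Std m →L[ℝ] Model m :=
  (coordCoframe p y).comp (F.lin ((extChartAt 𝓘(ℝ, Model m) p).symm y))

variable {F : OrthoFrame g} {p : N} {y : Model m}

theorem frameCoord_comp_frameLin (hy : y ∈ (extChartAt 𝓘(ℝ, Model m) p).target)
    (hF : (extChartAt 𝓘(ℝ, Model m) p).symm y ∈ F.dom) :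
    (frameCoord F p y).comp (frameLin F p y) = ContinuousLinearMap.id ℝ _ := by
  ext1 v
  have h := DFunLike.congr_fun (frame_mul_coframe hy)
    (F.lin ((extChartAt 𝓘(ℝ, Model m) p).symm y) v)
  have h' : F.coord ((extChartAt 𝓘(ℝ, Model m) p).symm y) (coordFrame p y (coordCoframe p y
    (F.lin ((extChartAt 𝓘(ℝ, Model m) p).symm y) v))) =
    F.coord ((extChartAt 𝓘(ℝ, Model m) p).symm y)
      (F.lin ((extChartAt 𝓘(ℝ, Model m) p).symm y) v) := congrArg _ h
  exact h'.trans (F.coord_lin hF v)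

theorem frameLin_comp_frameCoord (hy : y ∈ (extChartAt 𝓘(ℝ, Model m) p).target)
    (hF : (extChartAt 𝓘(ℝ, Model m) p).symm y ∈ F.dom) :
    (frameLin F p y).comp (frameCoord F p y) = ContinuousLinearMap.id ℝ _ := by
  ext1 v
  change coordCoframe p y (F.lin _ (F.coord _ (coordFrame p y v))) = v
  rw [F.lin_coord hF]
  exact DFunLike.congr_fun (coframe_mul_frame hy) v

theorem contDiffOn_frameCoord (F : OrthoFrame g) (p : N) :
    ContDiffOn ℝ ∞ (frameCoord F p) ((extChartAt 𝓘(ℝ, Model m) p).target ∩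
      (extChartAt 𝓘(ℝ, Model m) p).symm ⁻¹' F.dom) := by
  rw [contDiffOn_clm_apply]
  intro u
  rw [contDiffOn_euclidean]
  intro i
  have h := (smooth_inner g ((F.smooth i).mono Set.inter_subset_right)
    ((smoothField_symm p u).mono Set.inter_subset_left)).comp
    ((contMDiffOn_extChartAt_symm (n := ∞) (I := 𝓘(ℝ, Model m)) p).mono
      (Set.inter_subset_left (t := (extChartAt 𝓘(ℝ, Model m) p).symm ⁻¹' F.dom)))
    (fun y hy ↦ ⟨extChartAt_symm_mem_chart_source hy.1, hy.2⟩)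
  refine h.contDiffOn.congr ?_
  intro y hy
  change F.coord _ (coordFrame p y u) i = _
  rw [F.coord_apply]
  have e : coordFrame p y u = (trivializationAt (Model m)
    (TangentSpace 𝓘(ℝ, Model m) : N → Type _) p).symm ((extChartAt 𝓘(ℝ, Model m) p).symm y) u :=
    (symm_eq_frame hy.1 u).symm
  rw [e]
  rfl

theorem isOpen_frame_dom (F : OrthoFrame g) (p : N) :
    IsOpen ((extChartAt 𝓘(ℝ, Model m) p).target ∩
      (extChartAt 𝓘(ℝ, Model m) p).symm ⁻¹' F.dom) :=
  (continuousOn_extChartAt_symm (I := 𝓘(ℝ, Model m)) p).isOpen_inter_preimage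
    (isOpen_extChartAt_target p) F.isOpen_dom

/-- The entries of `frameCoord` are inner products of smooth fields. Its inverse is smooth because
inversion of linear maps is. -/
theorem contDiffOn_frameLin (F : OrthoFrame g) (p : N) :
    ContDiffOn ℝ ∞ (frameLin F p) ((extChartAt 𝓘(ℝ, Model m) p).target ∩
      (extChartAt 𝓘(ℝ, Model m) p).symm ⁻¹' F.dom) := by
  have h : ContDiffOn ℝ ∞ (fun y ↦ (frameCoord F p y).inverse)
      ((extChartAt 𝓘(ℝ, Model m) p).target ∩
        (extChartAt 𝓘(ℝ, Model m) p).symm ⁻¹' F.dom) := by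
    intro y hy
    have hi : (frameCoord F p y).IsInvertible := ContinuousLinearMap.IsInvertible.of_inverse
      (frameCoord_comp_frameLin hy.1 hy.2) (frameLin_comp_frameCoord hy.1 hy.2)
    exact hi.contDiffAt_map_inverse.comp_contDiffWithinAt y (contDiffOn_frameCoord F p y hy)
  refine h.congr fun y hy ↦ ?_
  exact (ContinuousLinearMap.inverse_eq (frameCoord_comp_frameLin hy.1 hy.2)
    (frameLin_comp_frameCoord hy.1 hy.2)).symm

/-- The orthonormal frame depends on the base coordinates only and the Cayley factor on the fibre
coordinate only. Both the smoothness of I and its vertical derivative are read off from this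
factorisation. -/
theorem csField_eq (hz : z ∈ (extChartAt 𝓘(ℝ, Model m × StdTangent m) σ).target) :
    csField σ z = (frameLin (adaptedFrame σ) σ.proj z.1).comp
      ((cayleyInv (z.2 : Std m →L[ℝ] Std m)).comp (frameCoord (adaptedFrame σ) σ.proj z.1)) := by
  obtain ⟨h1, h2⟩ := (mem_twistor_target σ z).1 hz
  rw [csField, extChartAt_twistor_symm, coordCs_eq h1 _ (twistorPoint_proj _ _ _ _ h2)]
  have h2' : (chartAt (Model m) σ.proj).symm z.1 ∈ (adaptedFrame σ).dom := h2
  rw [twistorPoint, dif_pos h2']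
  rfl

theorem contDiffOn_csField (σ : TwistorSpace g) : ContDiffOn ℝ ∞ (csField σ)
    (extChartAt 𝓘(ℝ, Model m × StdTangent m) σ).target := by
  have hm : Set.MapsTo Prod.fst (extChartAt 𝓘(ℝ, Model m × StdTangent m) σ).target
    ((extChartAt 𝓘(ℝ, Model m) σ.proj).target ∩
      (extChartAt 𝓘(ℝ, Model m) σ.proj).symm ⁻¹' (adaptedFrame σ).dom) :=
    fun z hz ↦ (mem_twistor_target σ z).1 hz
  have h1 := (contDiffOn_frameLin (adaptedFrame σ) σ.proj).comp contDiff_fst.contDiffOn hm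
  have h2 := (contDiffOn_frameCoord (adaptedFrame σ) σ.proj).comp contDiff_fst.contDiffOn hm
  have h3 : ContDiffOn ℝ ∞ (fun z : Model m × StdTangent m ↦
      cayleyInv (z.2 : Std m →L[ℝ] Std m))
      (extChartAt 𝓘(ℝ, Model m × StdTangent m) σ).target :=
    (contDiff_cayleyInv.comp contDiff_snd).contDiffOn
  exact (h1.clm_comp (h3.clm_comp h2)).congr fun z hz ↦ csField_eq hz

theorem contDiffAt_csField (hz : z ∈ (extChartAt 𝓘(ℝ, Model m × StdTangent m) σ).target) :
    ContDiffAt ℝ ∞ (csField σ) z :=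
  (contDiffOn_csField σ).contDiffAt ((isOpen_extChartAt_target σ).mem_nhds hz)

theorem coordCs_mul_self (hy : y ∈ (extChartAt 𝓘(ℝ, Model m) p).target)
    (τ : TwistorSpace g) (hτ : τ.proj = (extChartAt 𝓘(ℝ, Model m) p).symm y) :
    TwistorSpace.coordCs p τ * TwistorSpace.coordCs p τ = -1 := by
  have hI : modelEnd τ.cs * modelEnd τ.cs = -1 := by
    ext1 v
    exact τ.cs_cs v
  rw [coordCs_eq hy τ hτ]
  calc coframe p y * modelEnd τ.cs * frame p y * (coframe p y * modelEnd τ.cs * frame p y)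
      = coframe p y * modelEnd τ.cs * (frame p y * coframe p y) * modelEnd τ.cs * frame p y := by
        noncomm_ring
    _ = coframe p y * (modelEnd τ.cs * modelEnd τ.cs) * frame p y := by
        rw [frame_mul_coframe hy]; noncomm_ring
    _ = -1 := by rw [hI, mul_neg_one, neg_mul, coframe_mul_frame hy]

theorem coordCs_skew (hy : y ∈ (extChartAt 𝓘(ℝ, Model m) p).target)
    (τ : TwistorSpace g) (hτ : τ.proj = (extChartAt 𝓘(ℝ, Model m) p).symm y) (a b : Model m) :
    coordMetric g.inner p y (TwistorSpace.coordCs p τ a) b =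
      -coordMetric g.inner p y a (TwistorSpace.coordCs p τ b) := by
  rw [coordCs_eq hy τ hτ]
  obtain ⟨q, I, h1, h2⟩ := τ
  change q = _ at hτ
  subst hτ
  have hfc : ∀ v, frame p y (coframe p y v) = v := fun v ↦
    DFunLike.congr_fun (frame_mul_coframe hy) v
  rw [coordMetric_apply, coordMetric_apply]
  simp only [mul_apply_eq_comp, hfc]
  have h3 := h2 (coordFrame p y a) (I (coordFrame p y b))
  rw [h1, map_neg] at h3
  have h4 : g.inner _ (I (coordFrame p y a)) (coordFrame p y b) = -g.inner _ (coordFrame p y a)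
    (I (coordFrame p y b)) := by rw [← h3, neg_neg]
  exact h4

end TwistorCharts

/-! ### The connection map and the metric h_t on a whole twistor chart -/

section Connection

variable {m : ℕ} {N : Type*} [TopologicalSpace N] [ChartedSpace (Model m) N]
  [IsManifold 𝓘(ℝ, Model m) ∞ N] {g : Metric m N}

/-- The differential of the projection, on the model spaces. -/
def projModel (τ : TwistorSpace g) : Model m × StdTangent m →L[ℝ] Model m :=
  mfderivModel (Model m × StdTangent m) (Model m) (TwistorSpace.proj (g := g)) τ

/-- The connection map, on the model spaces. -/
def connModel (τ : TwistorSpace g) :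
    Model m × StdTangent m →L[ℝ] (Model m →L[ℝ] Model m) := τ.connectionMap

theorem connModel_apply (τ : TwistorSpace g) (ξ : Model m × StdTangent m) :
    connModel τ ξ = mfderivModel (Model m × StdTangent m)
      (Model m →L[ℝ] Model m) (TwistorSpace.coordCs (g := g) τ.proj) τ ξ +
      commutator (modelEnd τ.cs) (christoffel g.inner τ.proj
        (extChartAt 𝓘(ℝ, Model m) τ.proj τ.proj) (projModel τ ξ)) := rfl

/-- The connection map in the chart at `σ`: `K ξ = dI(ξ) + [Γ(π_* ξ), I]`. -/
def connForm (σ : TwistorSpace g) (z : Model m × StdTangent m) :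
    Model m × StdTangent m →L[ℝ] (Model m →L[ℝ] Model m) :=
  fderiv ℝ (csField σ) z + ((commutator (csField σ z)).comp (christoffel g.inner σ.proj z.1)).comp
    (ContinuousLinearMap.fst ℝ (Model m) (StdTangent m))

theorem connForm_apply (σ : TwistorSpace g) (z ξ : Model m × StdTangent m) :
    connForm σ z ξ = fderiv ℝ (csField σ) z ξ +
      commutator (csField σ z) (christoffel g.inner σ.proj z.1 ξ.1) := rfl

variable {σ : TwistorSpace g} {z : Model m × StdTangent m}

/-- In the charts the projection of the twistor space is the first projection of the product. -/
theorem projModel_frame (hz : z ∈ (extChartAt 𝓘(ℝ, Model m × StdTangent m) σ).target)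
    (ξ : Model m × StdTangent m) :
    projModel ((extChartAt 𝓘(ℝ, Model m × StdTangent m) σ).symm z) (frame σ z ξ) =
      frame σ.proj z.1 ξ.1 := by
  have hz1 := ((mem_twistor_target σ z).1 hz).1
  have heq : (TwistorSpace.proj ∘ (extChartAt 𝓘(ℝ, Model m × StdTangent m) σ).symm) =ᶠ[𝓝 z]
      ((extChartAt 𝓘(ℝ, Model m) σ.proj).symm ∘ Prod.fst) :=
    (eventually_twistor_target hz).mono fun z' hz' ↦ proj_twistor_symm hz'
  obtain ⟨h1, h2⟩ := mfderivModel_symm_comp (f := Prod.fst) (y := z) hz1 differentiableAt_fst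
  have h3 := mfderivModel_comp_symm (f := TwistorSpace.proj (g := g)) hz
    (h1.congr_of_eventuallyEq heq)
  rw [mfderivModel_congr heq, h2, fderiv_fst] at h3
  exact (DFunLike.congr_fun h3 ξ).symm

/-- The complex structure in a second chart. -/
theorem coordCs_chartTrans {p q : N} {y : Model m}
    (hy : y ∈ (extChartAt 𝓘(ℝ, Model m) p).target)
    (hq : (extChartAt 𝓘(ℝ, Model m) p).symm y ∈ (extChartAt 𝓘(ℝ, Model m) q).source)
    (τ : TwistorSpace g) (hτ : τ.proj = (extChartAt 𝓘(ℝ, Model m) p).symm y) :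
    TwistorSpace.coordCs q τ * fderiv ℝ (chartTrans p q) y =
      fderiv ℝ (chartTrans p q) y * TwistorSpace.coordCs p τ := by
  have hy' : chartTrans p q y ∈ (extChartAt 𝓘(ℝ, Model m) q).target :=
    (extChartAt 𝓘(ℝ, Model m) q).map_source hq
  have hr : (extChartAt 𝓘(ℝ, Model m) q).symm (chartTrans p q y) =
      (extChartAt 𝓘(ℝ, Model m) p).symm y := (extChartAt 𝓘(ℝ, Model m) q).left_inv hq
  have hf := frame_chartTrans hy hq
  have hc : coframe q (chartTrans p q y) = fderiv ℝ (chartTrans p q) y * coframe p y := by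
    calc coframe q (chartTrans p q y)
        = coframe q (chartTrans p q y) * (frame p y * coframe p y) := by
          rw [frame_mul_coframe hy, mul_one]
      _ = coframe q (chartTrans p q y) * frame q (chartTrans p q y) *
          fderiv ℝ (chartTrans p q) y * coframe p y := by rw [← hf]; noncomm_ring
      _ = _ := by rw [coframe_mul_frame hy', one_mul]
  rw [coordCs_eq hy τ hτ, coordCs_eq hy' τ (hτ.trans hr.symm), hc, mul_assoc, hf]
  noncomm_ring

theorem frame_isInvertible {p : N} {y : Model m}
    (hy : y ∈ (extChartAt 𝓘(ℝ, Model m) p).target) : (frame p y).IsInvertible :=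
  ContinuousLinearMap.IsInvertible.of_inverse (frame_mul_coframe hy) (coframe_mul_frame hy)

/-- The components of the complex structure in the chart of `N` at `q`, as a function of the
coordinates in the chart of the twistor space at `σ`. -/
def csFieldAt (q : N) (σ : TwistorSpace g) (z : Model m × StdTangent m) : Model m →L[ℝ] Model m :=
  TwistorSpace.coordCs q ((extChartAt 𝓘(ℝ, Model m × StdTangent m) σ).symm z)

theorem eventually_csFieldAt {q : N}
    (hz : z ∈ (extChartAt 𝓘(ℝ, Model m × StdTangent m) σ).target)
    (hqs : (extChartAt 𝓘(ℝ, Model m) σ.proj).symm z.1 ∈ (extChartAt 𝓘(ℝ, Model m) q).source) :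
    ∀ᶠ z' in 𝓝 z, csFieldAt q σ z' * fderiv ℝ (chartTrans σ.proj q) z'.1 =
      fderiv ℝ (chartTrans σ.proj q) z'.1 * csField σ z' := by
  filter_upwards [eventually_twistor_target hz, continuousAt_fst.eventually
    (eventually_chartTrans ((mem_twistor_target σ z).1 hz).1 hqs)] with z' hz' hz''
  exact coordCs_chartTrans hz''.1 hz''.2 _ (proj_twistor_symm hz')

/-- Obtained by differentiating W Φ = Φ I, where W and I are the complex structure in the charts at
q and at the base point of σ, and Φ is the differential of the transition. The base point q is held
fixed while the coordinates move. The two terms with the second derivative of the transition are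
what the Christoffel symbols will absorb. -/
theorem fderiv_csFieldAt {q : N} (hz : z ∈ (extChartAt 𝓘(ℝ, Model m × StdTangent m) σ).target)
    (hq : (extChartAt 𝓘(ℝ, Model m) σ.proj).symm z.1 = q) (ξ : Model m × StdTangent m) :
    DifferentiableAt ℝ (csFieldAt q σ) z ∧ fderiv ℝ (csFieldAt q σ) z ξ * frame σ.proj z.1 =
      frame σ.proj z.1 * fderiv ℝ (csField σ) z ξ +
        fderiv ℝ (fderiv ℝ (chartTrans σ.proj q)) z.1 ξ.1 * csField σ z -
        csFieldAt q σ z * fderiv ℝ (fderiv ℝ (chartTrans σ.proj q)) z.1 ξ.1 := by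
  obtain ⟨hz1, -⟩ := (mem_twistor_target σ z).1 hz
  have hqs : (extChartAt 𝓘(ℝ, Model m) σ.proj).symm z.1 ∈
      (extChartAt 𝓘(ℝ, Model m) q).source := by
    rw [hq]; exact mem_extChartAt_source q
  have hev := eventually_csFieldAt hz hqs
  let Φ : Model m × StdTangent m → (Model m →L[ℝ] Model m) :=
    fun z' ↦ fderiv ℝ (chartTrans σ.proj q) z'.1
  have hψ : ContDiffAt ℝ ∞ (fderiv ℝ (chartTrans σ.proj q)) z.1 :=
    (contDiffAt_chartTrans hz1 hqs).fderiv_right (by simp)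
  have hΦ : HasFDerivAt Φ ((fderiv ℝ (fderiv ℝ (chartTrans σ.proj q)) z.1).comp
      (ContinuousLinearMap.fst ℝ (Model m) (StdTangent m))) z :=
    (hψ.differentiableAt (by simp)).hasFDerivAt.comp z hasFDerivAt_fst
  have hΦc : ContDiffAt ℝ ∞ Φ z := hψ.comp z contDiffAt_fst
  have hΦz : Φ z = frame σ.proj z.1 := by rw [frame_eq_fderiv hz1, hq]
  have hI : DifferentiableAt ℝ (csField σ) z := (contDiffAt_csField hz).differentiableAt (by simp)
  -- W = Φ I Φ⁻¹ near z, because Φ z is an invertible frame and invertibility is an open condition.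
  have hW : DifferentiableAt ℝ (csFieldAt q σ) z := by
    have hinv : ∀ᶠ z' in 𝓝 z, (Φ z').IsInvertible := by
      have : ∀ᶠ A in 𝓝 (Φ z), A.IsInvertible := by
        rw [hΦz]
        obtain ⟨e, he⟩ := frame_isInvertible hz1
        rw [← he]
        exact e.nhds
      exact hΦc.continuousAt.eventually this
    have h2 : DifferentiableAt ℝ (fun z' ↦ (Φ z').inverse) z :=
      (hinv.self_of_nhds.contDiffAt_map_inverse.comp z hΦc).differentiableAt (by simp)
    refine ((hΦ.differentiableAt.mul hI).mul h2).congr_of_eventuallyEq ?_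
    filter_upwards [hev, hinv] with z' h1 h2
    have h3 : Φ z' * (Φ z').inverse = 1 := h2.self_comp_inverse
    change _ = fderiv ℝ (chartTrans σ.proj q) z'.1 * csField σ z' * (Φ z').inverse
    rw [← h1, mul_assoc]
    exact (mul_one _).symm.trans (congrArg _ h3.symm)
  refine ⟨hW, ?_⟩
  have h0 : (fun z' ↦ csFieldAt q σ z' * Φ z') =ᶠ[𝓝 z] fun z' ↦ Φ z' * csField σ z' := hev
  have h1 := DFunLike.congr_fun (h0.fderiv_eq (𝕜 := ℝ)) ξ
  rw [(hW.hasFDerivAt.fun_mul' hΦ).fderiv, (hΦ.fun_mul' hI.hasFDerivAt).fderiv] at h1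
  simp only [add_apply, smul_apply, smul_eq_mul, MulOpposite.smul_eq_mul_unop,
    MulOpposite.unop_op, ContinuousLinearMap.comp_apply, ContinuousLinearMap.coe_fst', hΦz] at h1
  rw [eq_sub_iff_add_eq, ← h1, add_comm]

theorem csFieldAt_self {τ : TwistorSpace g}
    (hτ : (extChartAt 𝓘(ℝ, Model m × StdTangent m) σ).symm z = τ) :
    csFieldAt τ.proj σ z = modelEnd τ.cs := by
  have h := coordCs_eq (mem_extChartAt_target (I := 𝓘(ℝ, Model m)) τ.proj) τ
    (extChartAt_to_inv τ.proj).symm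
  rw [frame_self, coframe_self, one_mul, mul_one] at h
  rw [csFieldAt, hτ, h]

/-- Chain rule through the inverse chart at σ: the connection map at τ, defined in the chart of N at
its own base point, becomes an expression in the coordinates at σ. -/
theorem connModel_frame_eq {τ : TwistorSpace g}
    (hz : z ∈ (extChartAt 𝓘(ℝ, Model m × StdTangent m) σ).target)
    (hτ : (extChartAt 𝓘(ℝ, Model m × StdTangent m) σ).symm z = τ)
    (ξ : Model m × StdTangent m) :
    connModel τ (frame σ z ξ) = fderiv ℝ (csFieldAt τ.proj σ) z ξ +
      commutator (csFieldAt τ.proj σ z) (christoffel g.inner τ.proj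
        (extChartAt 𝓘(ℝ, Model m) τ.proj τ.proj) (frame σ.proj z.1 ξ.1)) := by
  have hq : (extChartAt 𝓘(ℝ, Model m) σ.proj).symm z.1 = τ.proj := by
    rw [← proj_twistor_symm hz, hτ]
  have h1 := mfderivModel_comp_symm (f := TwistorSpace.coordCs (g := g) τ.proj) hz
    (fderiv_csFieldAt hz hq ξ).1.mdifferentiableAt
  rw [mfderivModel_eq_fderiv, hτ] at h1
  have h4 := projModel_frame hz ξ
  rw [hτ] at h4
  rw [connModel_apply, h4, csFieldAt_self hτ]
  exact congrArg (· + _) (DFunLike.congr_fun h1 ξ).symm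

/-- The connection map does not depend on the chart, up to conjugation by the frame. This makes K
available away from the centre of the chart, as is needed to differentiate it. -/
theorem connModel_frame (hz : z ∈ (extChartAt 𝓘(ℝ, Model m × StdTangent m) σ).target)
    (ξ : Model m × StdTangent m) :
    connModel ((extChartAt 𝓘(ℝ, Model m × StdTangent m) σ).symm z) (frame σ z ξ) *
      frame σ.proj z.1 = frame σ.proj z.1 * connForm σ z ξ := by
  obtain ⟨hz1, -⟩ := (mem_twistor_target σ z).1 hz
  generalize hτ : (extChartAt 𝓘(ℝ, Model m × StdTangent m) σ).symm z = τ
  have hq : (extChartAt 𝓘(ℝ, Model m) σ.proj).symm z.1 = τ.proj := by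
    rw [← proj_twistor_symm hz, hτ]
  rw [connModel_frame_eq hz hτ]
  generalize τ.proj = q at hq
  have hqs : (extChartAt 𝓘(ℝ, Model m) σ.proj).symm z.1 ∈
      (extChartAt 𝓘(ℝ, Model m) q).source := by
    rw [hq]; exact mem_extChartAt_source q
  have hWz : csFieldAt q σ z * frame σ.proj z.1 = frame σ.proj z.1 * csField σ z := by
    rw [frame_eq_fderiv hz1, hq]
    exact (eventually_csFieldAt hz hqs).self_of_nhds
  -- The transformation law as an identity of endomorphisms. Its second-derivative term, commuted
  -- with the complex structure, cancels the two terms left by `fderiv_csFieldAt`.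
  have hchr : christoffel g.inner q (extChartAt 𝓘(ℝ, Model m) q q) (frame σ.proj z.1 ξ.1) *
      frame σ.proj z.1 = frame σ.proj z.1 * christoffel g.inner σ.proj z.1 ξ.1 -
        fderiv ℝ (fderiv ℝ (chartTrans σ.proj q)) z.1 ξ.1 := by
    ext1 v
    exact eq_sub_of_add_eq' (christoffel_chartTrans g hz1 hq ξ.1 v).symm
  rw [connForm_apply, commutator_apply, commutator_apply, add_mul, sub_mul,
    mul_assoc _ (csFieldAt q σ z), hWz, ← mul_assoc _ _ (csField σ z), mul_assoc (csFieldAt q σ z),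
    hchr, mul_sub, ← mul_assoc (csFieldAt q σ z), hWz, (fderiv_csFieldAt hz hq ξ).2]
  noncomm_ring

theorem trace_mul_of_conj {A B A' B' Φ Ψ : Model m →L[ℝ] Model m} (h1 : Φ * Ψ = 1)
    (h2 : Ψ * Φ = 1) (hA : A * Φ = Φ * A') (hB : B * Φ = Φ * B') :
    LinearMap.trace ℝ (Model m) (A * B : Model m →L[ℝ] Model m) =
      LinearMap.trace ℝ (Model m) (A' * B' : Model m →L[ℝ] Model m) := by
  have e : A * B = Φ * (A' * B' * Ψ) := by
    calc A * B = A * B * (Φ * Ψ) := by rw [h1, mul_one]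
      _ = A * (B * Φ) * Ψ := by noncomm_ring
      _ = (A * Φ) * B' * Ψ := by rw [hB]; noncomm_ring
      _ = _ := by rw [hA]; noncomm_ring
  have e' : (A' * B' * Ψ) * Φ = A' * B' := by rw [mul_assoc, h2, mul_one]
  have e'' := LinearMap.trace_mul_comm ℝ Φ.toLinearMap (A' * B' * Ψ).toLinearMap
  rw [e]
  exact e''.trans (congrArg (fun T : Model m →L[ℝ] Model m ↦ LinearMap.trace ℝ (Model m) T) e')

theorem twistorMetric_model (t : ℝ) (τ : TwistorSpace g) (ξ η : Model m × StdTangent m) :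
    modelBilin (twistorMetric g t) τ ξ η =
      modelBilin g.inner τ.proj (projModel τ ξ) (projModel τ η) +
      t * (-(1 / (2 * m : ℝ)) * LinearMap.trace ℝ (Model m)
        (connModel τ ξ * connModel τ η : Model m →L[ℝ] Model m)) := rfl

/-- Changing charts conjugates both values of the connection map by the same frame, and the trace is
insensitive to this. -/
theorem coordMetric_twistorMetric (t : ℝ)
    (hz : z ∈ (extChartAt 𝓘(ℝ, Model m × StdTangent m) σ).target)
    (ξ η : Model m × StdTangent m) :
    coordMetric (twistorMetric g t) σ z ξ η = coordMetric g.inner σ.proj z.1 ξ.1 η.1 +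
      t * (-(1 / (2 * m : ℝ)) * LinearMap.trace ℝ (Model m)
        (connForm σ z ξ * connForm σ z η : Model m →L[ℝ] Model m)) := by
  obtain ⟨hz1, -⟩ := (mem_twistor_target σ z).1 hz
  have h1 := trace_mul_of_conj (frame_mul_coframe hz1) (coframe_mul_frame hz1)
    (connModel_frame hz ξ) (connModel_frame hz η)
  have h3 := twistorMetric_model t ((extChartAt 𝓘(ℝ, Model m × StdTangent m) σ).symm z)
    (frame σ z ξ) (frame σ z η)
  rw [h1, projModel_frame hz ξ, projModel_frame hz η, proj_twistor_symm hz] at h3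
  exact h3

end Connection

/-! ### The trace form on skew endomorphisms; values of the connection form -/

section Splitting

variable {m : ℕ} {N : Type*} [TopologicalSpace N] [ChartedSpace (Model m) N]
  [IsManifold 𝓘(ℝ, Model m) ∞ N] {g : Metric m N}

/-- ⟨e, T T e⟩ = -|T e|² for skew T. Hence -Tr is definite on skew endomorphisms, which is the
positivity of the vertical part of h_t. -/
theorem trace_skew_mul_self {T : Std m →L[ℝ] Std m} (hT : star T = -T) :
    LinearMap.trace ℝ (Std m) (T * T : Std m →L[ℝ] Std m) =
      -∑ i, ‖T (EuclideanSpace.basisFun _ ℝ i)‖ ^ 2 := by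
  rw [LinearMap.trace_eq_sum_inner _ (EuclideanSpace.basisFun _ ℝ), ← Finset.sum_neg_distrib]
  refine Finset.sum_congr rfl fun i _ ↦ ?_
  rw [ContinuousLinearMap.star_eq_adjoint] at hT
  change inner ℝ _ (T (T _)) = _
  rw [← ContinuousLinearMap.adjoint_inner_left, hT, neg_apply, inner_neg_left,
    real_inner_self_eq_norm_sq]

theorem eq_zero_of_trace_skew {T : Std m →L[ℝ] Std m} (hT : star T = -T)
    (h : 0 ≤ LinearMap.trace ℝ (Std m) (T * T : Std m →L[ℝ] Std m)) : T = 0 := by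
  rw [trace_skew_mul_self hT] at h
  have h1 : ∑ i, ‖T (EuclideanSpace.basisFun _ ℝ i)‖ ^ 2 = 0 :=
    le_antisymm (by linarith) (Finset.sum_nonneg fun i _ ↦ by positivity)
  rw [Finset.sum_eq_zero_iff_of_nonneg fun i _ ↦ by positivity] at h1
  apply ContinuousLinearMap.coe_injective
  refine (EuclideanSpace.basisFun (Fin m ⊕ Fin m) ℝ).toBasis.ext fun i ↦ ?_
  have h2 := h1 i (Finset.mem_univ i)
  simpa using h2

variable {F : OrthoFrame g} {p : N} {y : Model m}

/-- The orthonormal frame is an isometry from the standard Euclidean space, so adjoints with respect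
to g become matrix adjoints. -/
theorem coordMetric_frameLin (hy : y ∈ (extChartAt 𝓘(ℝ, Model m) p).target) (v : Std m)
    (w : Model m) :
    coordMetric g.inner p y (frameLin F p y v) w = inner ℝ v (frameCoord F p y w) := by
  have h := F.inner_lin ((extChartAt 𝓘(ℝ, Model m) p).symm y) v (coordFrame p y w)
  have h1 : frame p y (frameLin F p y v) = F.lin ((extChartAt 𝓘(ℝ, Model m) p).symm y) v :=
    DFunLike.congr_fun (frame_mul_coframe hy) _
  rw [coordMetric_apply, h1]
  exact h

/-- The matrix of an endomorphism, given in the chart at `p`, with respect to a frame. -/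
def frameMat (F : OrthoFrame g) (p : N) (y : Model m) (B : Model m →L[ℝ] Model m) :
    Std m →L[ℝ] Std m :=
  (frameCoord F p y).comp (B.comp (frameLin F p y))

/-- The endomorphism, in the chart at `p`, with a given matrix with respect to a frame. -/
def frameEnd (F : OrthoFrame g) (p : N) (y : Model m) (T : Std m →L[ℝ] Std m) :
    Model m →L[ℝ] Model m :=
  (frameLin F p y).comp (T.comp (frameCoord F p y))

theorem frameLin_frameCoord (hy : y ∈ (extChartAt 𝓘(ℝ, Model m) p).target)
    (hF : (extChartAt 𝓘(ℝ, Model m) p).symm y ∈ F.dom)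
    (v : Model m) : frameLin F p y (frameCoord F p y v) = v :=
  DFunLike.congr_fun (frameLin_comp_frameCoord hy hF) v

theorem frameCoord_frameLin (hy : y ∈ (extChartAt 𝓘(ℝ, Model m) p).target)
    (hF : (extChartAt 𝓘(ℝ, Model m) p).symm y ∈ F.dom)
    (v : Std m) : frameCoord F p y (frameLin F p y v) = v :=
  DFunLike.congr_fun (frameCoord_comp_frameLin hy hF) v

theorem frameEnd_frameMat (hy : y ∈ (extChartAt 𝓘(ℝ, Model m) p).target)
    (hF : (extChartAt 𝓘(ℝ, Model m) p).symm y ∈ F.dom)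
    (B : Model m →L[ℝ] Model m) :
    frameEnd F p y (frameMat F p y B) = B := by
  ext1 v
  simp only [frameEnd, frameMat, ContinuousLinearMap.comp_apply, frameLin_frameCoord hy hF]

theorem frameMat_frameEnd (hy : y ∈ (extChartAt 𝓘(ℝ, Model m) p).target)
    (hF : (extChartAt 𝓘(ℝ, Model m) p).symm y ∈ F.dom)
    (T : Std m →L[ℝ] Std m) : frameMat F p y (frameEnd F p y T) = T := by
  ext1 v
  simp only [frameEnd, frameMat, ContinuousLinearMap.comp_apply, frameCoord_frameLin hy hF]

theorem frameMat_mul (hy : y ∈ (extChartAt 𝓘(ℝ, Model m) p).target)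
    (hF : (extChartAt 𝓘(ℝ, Model m) p).symm y ∈ F.dom)
    (B C : Model m →L[ℝ] Model m) :
    frameMat F p y (B * C) = frameMat F p y B * frameMat F p y C := by
  ext1 v
  simp only [frameMat, mul_apply_eq_comp, ContinuousLinearMap.comp_apply,
    frameLin_frameCoord hy hF]

theorem trace_frameMat (hy : y ∈ (extChartAt 𝓘(ℝ, Model m) p).target)
    (hF : (extChartAt 𝓘(ℝ, Model m) p).symm y ∈ F.dom)
    (B : Model m →L[ℝ] Model m) :
    LinearMap.trace ℝ (Std m) (frameMat F p y B) = LinearMap.trace ℝ (Model m) B := by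
  have h := LinearMap.trace_comp_comm' (R := ℝ) (frameCoord F p y).toLinearMap
    (B.comp (frameLin F p y)).toLinearMap
  refine h.symm.trans (congrArg _ ?_)
  ext1 v
  exact congrArg B (frameLin_frameCoord hy hF v)

theorem star_frameMat (hy : y ∈ (extChartAt 𝓘(ℝ, Model m) p).target)
    {B : Model m →L[ℝ] Model m}
    (hB : ∀ a b, coordMetric g.inner p y (B a) b = -coordMetric g.inner p y a (B b)) :
    star (frameMat F p y B) = -frameMat F p y B := by
  rw [ContinuousLinearMap.star_eq_adjoint]
  symm
  rw [ContinuousLinearMap.eq_adjoint_iff]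
  intro v w
  change inner ℝ (-frameCoord F p y (B (frameLin F p y v))) w =
    inner ℝ v (frameCoord F p y (B (frameLin F p y w)))
  rw [← coordMetric_frameLin hy, inner_neg_left, real_inner_comm, ← coordMetric_frameLin hy,
    coordMetric_symm g p y (frameLin F p y w), hB, neg_neg]

theorem eq_zero_of_trace_nonneg (hy : y ∈ (extChartAt 𝓘(ℝ, Model m) p).target)
    (hF : (extChartAt 𝓘(ℝ, Model m) p).symm y ∈ F.dom)
    {B : Model m →L[ℝ] Model m}
    (hB : ∀ a b, coordMetric g.inner p y (B a) b = -coordMetric g.inner p y a (B b))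
    (h : 0 ≤ LinearMap.trace ℝ (Model m) (B * B : Model m →L[ℝ] Model m)) : B = 0 := by
  rw [← trace_frameMat hy hF, frameMat_mul hy hF] at h
  rw [← frameEnd_frameMat hy hF B, eq_zero_of_trace_skew (star_frameMat hy hB) h]
  ext1 v
  simp [frameEnd]

theorem trace_nonpos (hy : y ∈ (extChartAt 𝓘(ℝ, Model m) p).target)
    (hF : (extChartAt 𝓘(ℝ, Model m) p).symm y ∈ F.dom)
    {B : Model m →L[ℝ] Model m}
    (hB : ∀ a b, coordMetric g.inner p y (B a) b = -coordMetric g.inner p y a (B b)) :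
    LinearMap.trace ℝ (Model m) (B * B : Model m →L[ℝ] Model m) ≤ 0 := by
  rw [← trace_frameMat hy hF, frameMat_mul hy hF, trace_skew_mul_self (star_frameMat hy hB)]
  exact neg_nonpos.2 (Finset.sum_nonneg fun i _ ↦ by positivity)

/-- Differentiating c(A)(1 + A) = (1 + A) J₀ at 0, where c(0) = J₀, gives dc(A) + J₀ A = A J₀, with
no need for the derivative of the inverse. -/
theorem hasFDerivAt_cayleyInv (A : StdTangent m) :
    fderiv ℝ (fun A : StdTangent m ↦ cayleyInv (A : Std m →L[ℝ] Std m)) 0 A =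
      (A : Std m →L[ℝ] Std m) * stdJ m - stdJ m * A := by
  have hc : DifferentiableAt ℝ (fun A : StdTangent m ↦ cayleyInv (A : Std m →L[ℝ] Std m)) 0 :=
    contDiff_cayleyInv.contDiffAt.differentiableAt (by simp)
  have h1 : HasFDerivAt (fun A : StdTangent m ↦ 1 + (A : Std m →L[ℝ] Std m))
      (StdTangent m).subtypeL 0 := (StdTangent m).subtypeL.hasFDerivAt.const_add 1
  have h0 : (fun A : StdTangent m ↦ cayleyInv (A : Std m →L[ℝ] Std m) *
      (1 + (A : Std m →L[ℝ] Std m))) = fun A : StdTangent m ↦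
      (1 + (A : Std m →L[ℝ] Std m)) * stdJ m := by
    funext A
    rw [cayleyInv, mul_assoc, Ring.inverse_mul_cancel _ (isUnit_one_add A.2.1), mul_one]
  have h2 := h1.fun_mul' (hasFDerivAt_const (stdJ m) (0 : StdTangent m))
  rw [← h0] at h2
  have h3 := DFunLike.congr_fun ((hc.hasFDerivAt.fun_mul' h1).unique h2) A
  have h4 : cayleyInv (0 : Std m →L[ℝ] Std m) = stdJ m := by simp [cayleyInv]
  simp only [add_apply, smul_apply, smul_eq_mul, MulOpposite.smul_eq_mul_unop,
    MulOpposite.unop_op, ZeroMemClass.coe_zero, h4, add_zero, mul_one, zero_apply, mul_zero,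
    zero_add, Submodule.subtypeL_apply] at h3
  rw [eq_sub_iff_add_eq', ← h3]

variable {σ : TwistorSpace g} {z : Model m × StdTangent m}

theorem connModel_self (σ : TwistorSpace g) (ξ : Model m × StdTangent m) :
    connModel σ ξ = connForm σ (extChartAt 𝓘(ℝ, Model m × StdTangent m) σ σ) ξ := by
  have h := connModel_frame (mem_extChartAt_target (I := 𝓘(ℝ, Model m × StdTangent m)) σ) ξ
  have h1 : (extChartAt 𝓘(ℝ, Model m × StdTangent m) σ σ).1 =
    extChartAt 𝓘(ℝ, Model m) σ.proj σ.proj := rfl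
  rw [h1, frame_self, frame_self, extChartAt_to_inv, mul_one, one_mul] at h
  exact h

theorem projModel_self (σ : TwistorSpace g) (ξ : Model m × StdTangent m) :
    projModel σ ξ = ξ.1 := by
  have h := projModel_frame (mem_extChartAt_target (I := 𝓘(ℝ, Model m × StdTangent m)) σ) ξ
  have h1 : (extChartAt 𝓘(ℝ, Model m × StdTangent m) σ σ).1 =
    extChartAt 𝓘(ℝ, Model m) σ.proj σ.proj := rfl
  rw [h1, frame_self, frame_self, extChartAt_to_inv] at h
  exact h

theorem connForm_anticomm (hz : z ∈ (extChartAt 𝓘(ℝ, Model m × StdTangent m) σ).target)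
    (ξ : Model m × StdTangent m) :
    connForm σ z ξ * csField σ z = -(csField σ z * connForm σ z ξ) :=
  covDeriv_anticomm ((contDiffAt_csField hz).differentiableAt (by simp))
    ((eventually_twistor_target hz).mono fun z' hz' ↦
      coordCs_mul_self ((mem_twistor_target σ z').1 hz').1 _ (proj_twistor_symm hz')) _ ξ

theorem csField_skew (hz : z ∈ (extChartAt 𝓘(ℝ, Model m × StdTangent m) σ).target)
    (a b : Model m) : coordMetric g.inner σ.proj z.1 (csField σ z a) b =
      -coordMetric g.inner σ.proj z.1 a (csField σ z b) :=
  coordCs_skew ((mem_twistor_target σ z).1 hz).1 _ (proj_twistor_symm hz) a b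

/-- K is the covariant derivative of the field I of skew endomorphisms over the twistor chart, for
the metric and the connection pulled back by π. This and the anti-commutation above say that K takes
vertical values. -/
theorem connForm_skew (hz : z ∈ (extChartAt 𝓘(ℝ, Model m × StdTangent m) σ).target)
    (ξ : Model m × StdTangent m) (a b : Model m) :
    coordMetric g.inner σ.proj z.1 (connForm σ z ξ a) b =
      -coordMetric g.inner σ.proj z.1 a (connForm σ z ξ b) := by
  have hz1 := ((mem_twistor_target σ z).1 hz).1
  have hd : DifferentiableAt ℝ (coordMetric g.inner σ.proj) z.1 :=
    (contDiffAt_coordMetric g hz1).differentiableAt (by simp)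
  have hG : HasFDerivAt (fun z : Model m × StdTangent m ↦ coordMetric g.inner σ.proj z.1)
      ((fderiv ℝ (coordMetric g.inner σ.proj) z.1).comp
        (ContinuousLinearMap.fst ℝ (Model m) (StdTangent m))) z :=
    hd.hasFDerivAt.comp z hasFDerivAt_fst
  refine covDeriv_skew (G := fun z : Model m × StdTangent m ↦ coordMetric g.inner σ.proj z.1)
    (Γ := fun z : Model m × StdTangent m ↦ (christoffel g.inner σ.proj z.1).comp
      (ContinuousLinearMap.fst ℝ (Model m) (StdTangent m))) hG.differentiableAt ?_
    ((contDiffAt_csField hz).differentiableAt (by simp))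
    ((eventually_twistor_target hz).mono fun z' hz' ↦ csField_skew hz') ξ a b
  intro u v w
  rw [hG.fderiv]
  exact fderiv_metric g hz1 u.1 v w

/-- On a vertical vector the Christoffel term vanishes and the orthonormal frame stays fixed, so
only the Cayley factor is differentiated. -/
theorem connForm_vertical (A : StdTangent m) :
    connForm σ (extChartAt 𝓘(ℝ, Model m × StdTangent m) σ σ) (0, A) =
      frameEnd (adaptedFrame σ) σ.proj (extChartAt 𝓘(ℝ, Model m) σ.proj σ.proj)
        ((A : Std m →L[ℝ] Std m) * stdJ m - stdJ m * A) := by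
  have hz := mem_extChartAt_target (I := 𝓘(ℝ, Model m × StdTangent m)) σ
  have hd : DifferentiableAt ℝ (csField σ) (extChartAt 𝓘(ℝ, Model m × StdTangent m) σ σ) :=
    (contDiffAt_csField hz).differentiableAt (by simp)
  rw [connForm_apply]
  simp only [map_zero, add_zero]
  rw [extChartAt_twistor_self] at hd hz ⊢
  have h1 : (fun A : StdTangent m ↦
      csField σ (extChartAt 𝓘(ℝ, Model m) σ.proj σ.proj, A)) = fun A : StdTangent m ↦
      frameEnd (adaptedFrame σ) σ.proj (extChartAt 𝓘(ℝ, Model m) σ.proj σ.proj)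
        (cayleyInv (A : Std m →L[ℝ] Std m)) := by
    funext A
    exact csField_eq ((mem_twistor_target σ _).2 ((mem_twistor_target σ _).1 hz))
  have h3 : HasFDerivAt (fun A : StdTangent m ↦
      (extChartAt 𝓘(ℝ, Model m) σ.proj σ.proj, A)) (ContinuousLinearMap.inr ℝ (Model m)
        (StdTangent m)) 0 := hasFDerivAt_prodMk_right _ _
  have hc : DifferentiableAt ℝ (fun A : StdTangent m ↦ cayleyInv (A : Std m →L[ℝ] Std m)) 0 :=
    contDiff_cayleyInv.contDiffAt.differentiableAt (by simp)
  have h4 : HasFDerivAt (fun A : StdTangent m ↦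
      frameEnd (adaptedFrame σ) σ.proj (extChartAt 𝓘(ℝ, Model m) σ.proj σ.proj)
        (cayleyInv (A : Std m →L[ℝ] Std m))) _ 0 :=
    (hasFDerivAt_const (frameLin (adaptedFrame σ) σ.proj
      (extChartAt 𝓘(ℝ, Model m) σ.proj σ.proj)) (0 : StdTangent m)).clm_comp
      (hc.hasFDerivAt.clm_comp (hasFDerivAt_const (frameCoord (adaptedFrame σ) σ.proj
      (extChartAt 𝓘(ℝ, Model m) σ.proj σ.proj)) (0 : StdTangent m)))
  rw [← h1] at h4
  have h5 := HasFDerivAt.comp (0 : StdTangent m) hd.hasFDerivAt h3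
  have h6 := DFunLike.congr_fun (h5.unique h4) A
  rw [← hasFDerivAt_cayleyInv]
  refine Eq.trans h6 ?_
  ext1 v
  simp [frameEnd]

end Splitting

/-! ### Horizontal and vertical vectors; nondegeneracy of h_t -/

section Splitting

variable {m : ℕ} {N : Type*} [TopologicalSpace N] [ChartedSpace (Model m) N]
  [IsManifold 𝓘(ℝ, Model m) ∞ N] {g : Metric m N} {σ : TwistorSpace g}

theorem csField_self (σ : TwistorSpace g) :
    csField σ (extChartAt 𝓘(ℝ, Model m × StdTangent m) σ σ) = modelEnd σ.cs :=
  csFieldAt_self (extChartAt_to_inv σ)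

theorem frameMat_csField (σ : TwistorSpace g) :
    frameMat (adaptedFrame σ) σ.proj (extChartAt 𝓘(ℝ, Model m) σ.proj σ.proj)
      (modelEnd σ.cs) = stdJ m := by
  have hz := mem_extChartAt_target (I := 𝓘(ℝ, Model m × StdTangent m)) σ
  have h1 := csField_eq hz
  obtain ⟨hy, hF⟩ := (mem_twistor_target σ _).1 hz
  rw [csField_self, extChartAt_twistor_self] at h1
  have h2 : cayleyInv (0 : Std m →L[ℝ] Std m) = stdJ m := by simp [cayleyInv]
  have h3 := frameMat_frameEnd hy hF (stdJ m)
  rw [← h2] at h3 ⊢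
  exact (congrArg _ h1).trans h3

/-- Skew-symmetric endomorphisms anti-commuting with the complex structure are the values of the
connection map on vertical vectors. -/
theorem exists_connForm_vertical {B : Model m →L[ℝ] Model m}
    (hB : ∀ a b, coordMetric g.inner σ.proj (extChartAt 𝓘(ℝ, Model m) σ.proj σ.proj) (B a) b =
      -coordMetric g.inner σ.proj (extChartAt 𝓘(ℝ, Model m) σ.proj σ.proj) a (B b))
    (hJ : B * modelEnd σ.cs = -(modelEnd σ.cs * B)) :
    ∃ A : StdTangent m,
      connForm σ (extChartAt 𝓘(ℝ, Model m × StdTangent m) σ σ) (0, A) = B := by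
  have hz := mem_extChartAt_target (I := 𝓘(ℝ, Model m × StdTangent m)) σ
  obtain ⟨hy, hF⟩ := (mem_twistor_target σ _).1 hz
  set T := frameMat (adaptedFrame σ) σ.proj (extChartAt 𝓘(ℝ, Model m) σ.proj σ.proj) B with hT
  have hTs : star T = -T := star_frameMat hy hB
  have hTJ : T * stdJ m = -(stdJ m * T) := by
    rw [← frameMat_csField σ]
    have h1 := frameMat_mul hy hF B (modelEnd σ.cs)
    have h2 := frameMat_mul hy hF (modelEnd σ.cs) B
    refine h1.symm.trans ?_
    rw [hJ]
    refine Eq.trans ?_ (congrArg Neg.neg h2)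
    ext1 v
    simp [frameMat]
  have hJJ : stdJ m * stdJ m = -1 := stdJ_mul_self
  -- For A anti-commuting with J₀ one has A J₀ - J₀ A = 2 A J₀. Setting this equal to T and using
  -- J₀² = -1 gives A = -½ T J₀.
  have hA : (-(1 / 2 : ℝ)) • (T * stdJ m) ∈ StdTangent m := by
    refine Submodule.smul_mem _ _ ⟨?_, ?_⟩
    · rw [star_mul, star_stdJ, hTs, neg_mul_neg, hTJ, neg_neg]
    · rw [mul_assoc, hJJ, ← mul_assoc, ← neg_mul, ← hTJ, mul_assoc, hJJ]
  refine ⟨⟨_, hA⟩, ?_⟩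
  rw [connForm_vertical]
  have h1 : (-(1 / 2 : ℝ)) • (T * stdJ m) * stdJ m - stdJ m * ((-(1 / 2 : ℝ)) • (T * stdJ m)) =
      T := by
    rw [smul_mul_assoc, mul_smul_comm, mul_assoc, hJJ, ← mul_assoc, ← neg_eq_iff_eq_neg.2 hTJ,
      neg_mul, mul_assoc, hJJ]
    simp only [mul_neg, mul_one, neg_neg]
    module
  rw [h1]
  exact frameEnd_frameMat hy hF B

/-- The value of K at (X, 0) is itself skew and anti-commutes with I, so a vertical vector can
correct it to any prescribed B. -/
theorem exists_connForm {B : Model m →L[ℝ] Model m}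
    (hB : ∀ a b, coordMetric g.inner σ.proj (extChartAt 𝓘(ℝ, Model m) σ.proj σ.proj) (B a) b =
      -coordMetric g.inner σ.proj (extChartAt 𝓘(ℝ, Model m) σ.proj σ.proj) a (B b))
    (hJ : B * modelEnd σ.cs = -(modelEnd σ.cs * B)) (X : Model m) :
    ∃ ξ : Model m × StdTangent m, ξ.1 = X ∧
      connForm σ (extChartAt 𝓘(ℝ, Model m × StdTangent m) σ σ) ξ = B := by
  have hz := mem_extChartAt_target (I := 𝓘(ℝ, Model m × StdTangent m)) σ
  have h1 := connForm_skew hz (X, 0)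
  have h2 := connForm_anticomm hz (X, 0)
  rw [csField_self] at h2
  obtain ⟨A, hA⟩ := exists_connForm_vertical (σ := σ)
    (B := B - connForm σ (extChartAt 𝓘(ℝ, Model m × StdTangent m) σ σ) (X, 0))
    (by
      intro a b
      have h3 := h1 a b
      have h4 := hB a b
      simp only [sub_apply, map_sub]
      rw [h4]
      change _ - coordMetric g.inner σ.proj (extChartAt 𝓘(ℝ, Model m) σ.proj σ.proj) _ _ =
        -(_ - coordMetric g.inner σ.proj (extChartAt 𝓘(ℝ, Model m) σ.proj σ.proj) _ _)
      change coordMetric g.inner σ.proj (extChartAt 𝓘(ℝ, Model m) σ.proj σ.proj) _ _ =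
        -coordMetric g.inner σ.proj (extChartAt 𝓘(ℝ, Model m) σ.proj σ.proj) _ _ at h3
      rw [h3]
      ring)
    (by rw [sub_mul, hJ, h2, mul_sub]; abel)
  refine ⟨(X, A), rfl, ?_⟩
  have h3 : ((X, A) : Model m × StdTangent m) = (X, 0) + (0, A) := by simp
  rw [h3, map_add, hA]
  abel

/-- On vertical vectors K is A ↦ 2 A J₀ in the frame, and J₀ is invertible. -/
theorem connForm_injective {ξ : Model m × StdTangent m} (h1 : ξ.1 = 0)
    (h2 : connForm σ (extChartAt 𝓘(ℝ, Model m × StdTangent m) σ σ) ξ = 0) : ξ = 0 := by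
  obtain ⟨X, A⟩ := ξ
  change X = 0 at h1
  subst h1
  have hz := mem_extChartAt_target (I := 𝓘(ℝ, Model m × StdTangent m)) σ
  obtain ⟨hy, hF⟩ := (mem_twistor_target σ _).1 hz
  rw [connForm_vertical] at h2
  have h3 := frameMat_frameEnd hy hF ((A : Std m →L[ℝ] Std m) * stdJ m - stdJ m * A)
  have h4 : frameMat (adaptedFrame σ) σ.proj
      (extChartAt 𝓘(ℝ, Model m × StdTangent m) σ σ).1 0 = 0 := by
    ext1 v
    simp [frameMat]
  have h5 : (A : Std m →L[ℝ] Std m) * stdJ m - stdJ m * A = 0 :=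
    h3.symm.trans ((congrArg _ h2).trans h4)
  have hJJ : stdJ m * stdJ m = -1 := stdJ_mul_self
  have h6 : (2 : ℝ) • (A : Std m →L[ℝ] Std m) = 0 := by
    have h7 : ((A : Std m →L[ℝ] Std m) * stdJ m - stdJ m * A) * stdJ m =
        -((2 : ℝ) • (A : Std m →L[ℝ] Std m)) := by
      rw [sub_mul, mul_assoc, hJJ, mul_assoc, A.2.2, mul_neg (stdJ m), ← mul_assoc, hJJ]
      simp only [mul_neg, mul_one, neg_mul, one_mul, neg_neg]
      module
    rw [h5, zero_mul] at h7
    exact neg_eq_zero.1 h7.symm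
  have h8 : (A : Std m →L[ℝ] Std m) = 0 := (smul_eq_zero.1 h6).resolve_left two_ne_zero
  exact Prod.ext rfl (Subtype.ext h8)

/-- `horizontalLift` and `verticalVector` are values of `Function.invFun`, arbitrary outside the
range of the splitting. This existence is what lets them be computed. -/
theorem exists_splitting {B : Model m →L[ℝ] Model m}
    (hB : ∀ a b, coordMetric g.inner σ.proj (extChartAt 𝓘(ℝ, Model m) σ.proj σ.proj) (B a) b =
      -coordMetric g.inner σ.proj (extChartAt 𝓘(ℝ, Model m) σ.proj σ.proj) a (B b))
    (hJ : B * modelEnd σ.cs = -(modelEnd σ.cs * B)) (X : Model m) :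
    ∃ ξ, σ.splitting ξ = (X, B) := by
  obtain ⟨ξ, h1, h2⟩ := exists_connForm (σ := σ) hB hJ X
  refine ⟨ξ, ?_⟩
  rw [← h1, ← h2, ← projModel_self σ, ← connModel_self σ]
  rfl

theorem splitting_model {ξ : TangentSpace 𝓘(ℝ, Model m × StdTangent m) σ} {X : Model m}
    {B : Model m →L[ℝ] Model m} (h : σ.splitting ξ = (X, B)) :
    (modelVec ξ).1 = X ∧
      connForm σ (extChartAt 𝓘(ℝ, Model m × StdTangent m) σ σ) (modelVec ξ) = B := by
  rw [← projModel_self σ, ← connModel_self σ]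
  exact ⟨congrArg Prod.fst h, congrArg Prod.snd h⟩

theorem horizontalLift_model (σ : TwistorSpace g) (X : TangentSpace 𝓘(ℝ, Model m) σ.proj) :
    (modelVec (σ.horizontalLift X)).1 = modelVec X ∧
      connForm σ (extChartAt 𝓘(ℝ, Model m × StdTangent m) σ σ)
        (modelVec (σ.horizontalLift X)) = 0 :=
  splitting_model (Function.invFun_eq (exists_splitting (B := 0) (by simp) (by simp) X))

theorem verticalVector_model {B : Model m →L[ℝ] Model m}
    (hB : ∀ a b, coordMetric g.inner σ.proj (extChartAt 𝓘(ℝ, Model m) σ.proj σ.proj) (B a) b =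
      -coordMetric g.inner σ.proj (extChartAt 𝓘(ℝ, Model m) σ.proj σ.proj) a (B b))
    (hJ : B * modelEnd σ.cs = -(modelEnd σ.cs * B)) :
    (modelVec (σ.verticalVector B)).1 = 0 ∧
      connForm σ (extChartAt 𝓘(ℝ, Model m × StdTangent m) σ σ)
        (modelVec (σ.verticalVector B)) = B :=
  splitting_model (Function.invFun_eq (exists_splitting hB hJ 0))

/-- Testing ξ against itself gives a sum of two nonnegative terms, so π_* ξ = 0 and Tr(K ξ K ξ) = 0,
whence K ξ = 0. For m = 0 the coefficient 1/(2m) would be 0, so the second conclusion needs m ≠ 0.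
-/
theorem coordMetric_twistor_separating (hm : m ≠ 0) {t : ℝ} (ht : 0 < t)
    {ξ : Model m × StdTangent m}
    (h : ∀ η, coordMetric (twistorMetric g t) σ
      (extChartAt 𝓘(ℝ, Model m × StdTangent m) σ σ) ξ η = 0) : ξ = 0 := by
  have hz := mem_extChartAt_target (I := 𝓘(ℝ, Model m × StdTangent m)) σ
  obtain ⟨hy, hF⟩ := (mem_twistor_target σ _).1 hz
  have h1 := h ξ
  rw [coordMetric_twistorMetric t hz] at h1
  have h2 := trace_nonpos hy hF (connForm_skew hz ξ)
  have h3 : 0 < t * (1 / (2 * m : ℝ)) := by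
    have : (0 : ℝ) < m := by exact_mod_cast Nat.pos_of_ne_zero hm
    positivity
  have h4 : ξ.1 = 0 := by
    by_contra h0
    have := coordMetric_pos g hy h0
    nlinarith
  have h5 : connForm σ (extChartAt 𝓘(ℝ, Model m × StdTangent m) σ σ) ξ = 0 := by
    refine eq_zero_of_trace_nonneg hy hF (connForm_skew hz ξ) ?_
    rw [h4, map_zero, zero_add] at h1
    nlinarith
  exact connForm_injective h4 h5

end Splitting

/-! ### Symmetries of the curvature and its value on the two-vector of an endomorphism -/

section Curvature

variable {m : ℕ} {N : Type*} [TopologicalSpace N] [ChartedSpace (Model m) N]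
  [IsManifold 𝓘(ℝ, Model m) ∞ N]

theorem coordCurvature_apply {E : Type*} [NormedAddCommGroup E] [NormedSpace ℝ E]
    {M : Type*} [TopologicalSpace M] [ChartedSpace E M] (h : BilinField E M) (p : M)
    (y u v : E) : coordCurvature h p y ![u, v] =
      fderiv ℝ (christoffel h p) y v u - fderiv ℝ (christoffel h p) y u v +
        commutator (christoffel h p y u) (christoffel h p y v) := rfl

variable (g : Metric m N) {p : N} {y : Model m}

theorem coordCurvature_skew (hy : y ∈ (extChartAt 𝓘(ℝ, Model m) p).target)
    (u v a b : Model m) :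
    coordMetric g.inner p y (coordCurvature g.inner p y ![u, v] a) b =
      -coordMetric g.inner p y a (coordCurvature g.inner p y ![u, v] b) := by
  rw [coordCurvature_apply]
  refine curvature_skew ((contDiffAt_coordMetric g hy).of_le (by norm_cast))
    ((contDiffAt_christoffel g hy).differentiableAt (by simp)) ?_ u v a b
  filter_upwards [(isOpen_extChartAt_target (I := 𝓘(ℝ, Model m)) p).mem_nhds hy] with z hz
  exact fderiv_metric g hz

theorem coordCurvature_pair_symm (hy : y ∈ (extChartAt 𝓘(ℝ, Model m) p).target)
    (a b c d : Model m) :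
    coordMetric g.inner p y (coordCurvature g.inner p y ![a, b] c) d =
      coordMetric g.inner p y (coordCurvature g.inner p y ![c, d] a) b := by
  refine pair_symmetry (R := fun a b c d ↦
    coordMetric g.inner p y (coordCurvature g.inner p y ![a, b] c) d) ?_ ?_ ?_ a b c d
  · intro a b c d
    simp only [coordCurvature_apply, commutator_apply, add_apply, sub_apply, map_add, map_sub]
    ring
  · intro a b c d
    rw [coordCurvature_skew g hy, coordMetric_symm]
  · intro a b c d
    have h := curvature_bianchi ((contDiffAt_christoffel g hy).differentiableAt (by simp))
      (by
        filter_upwards [(isOpen_extChartAt_target (I := 𝓘(ℝ, Model m)) p).mem_nhds hy] with z hz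
        exact metric_christoffel_symm g hz) a b c
    rw [← add_apply, ← map_add, ← add_apply, ← map_add, coordCurvature_apply,
      coordCurvature_apply, coordCurvature_apply, h, map_zero, zero_apply]

/-- A basis of the tangent space at `p`, on the model space. -/
def basisVec (p : N) (i : Fin (Module.finrank ℝ (TangentSpace 𝓘(ℝ, Model m) p))) : Model m :=
  modelVec (Module.finBasis ℝ (TangentSpace 𝓘(ℝ, Model m) p) i)

/-- The dual basis with respect to the metric, on the model space. -/
def dualVec (p : N) (i : Fin (Module.finrank ℝ (TangentSpace 𝓘(ℝ, Model m) p))) : Model m :=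
  modelVec ((bilinForm g p).dualBasis (bilinForm_nondegenerate g p)
    (Module.finBasis ℝ (TangentSpace 𝓘(ℝ, Model m) p)) i)

/-- The trace is taken in the dual basis, with respect to which coordinates are pairings with the
original basis. The formula then matches the definition of `hat`. -/
theorem trace_eq_sum_dualVec (p : N) (T : Model m →L[ℝ] Model m) :
    LinearMap.trace ℝ (Model m) T =
      ∑ i, modelBilin g.inner p (T (dualVec g p i)) (basisVec p i) := by
  classical
  let T' : TangentSpace 𝓘(ℝ, Model m) p →L[ℝ] TangentSpace 𝓘(ℝ, Model m) p := T
  have h := LinearMap.trace_eq_matrix_trace ℝ ((bilinForm g p).dualBasis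
    (bilinForm_nondegenerate g p) (Module.finBasis ℝ (TangentSpace 𝓘(ℝ, Model m) p)))
    T'.toLinearMap
  refine Eq.trans h (Finset.sum_congr rfl fun i _ ↦ ?_)
  rw [Matrix.diag_apply, LinearMap.toMatrix_apply, LinearMap.BilinForm.dualBasis_repr_apply]
  rfl

theorem curvature_ιMulti (p : N) (u v : TangentSpace 𝓘(ℝ, Model m) p) :
    modelEnd (curvature g.inner p (exteriorPower.ιMulti ℝ 2 ![u, v])) =
      coordCurvature g.inner p (extChartAt 𝓘(ℝ, Model m) p p) ![modelVec u, modelVec v] := by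
  let R : TangentSpace 𝓘(ℝ, Model m) p [⋀^Fin 2]→ₗ[ℝ]
    (TangentSpace 𝓘(ℝ, Model m) p →L[ℝ] TangentSpace 𝓘(ℝ, Model m) p) :=
    coordCurvature g.inner p (extChartAt 𝓘(ℝ, Model m) p p)
  exact exteriorPower.alternatingMapLinearEquiv_apply_ιMulti R ![u, v]

theorem curvature_hat (p : N)
    (a : TangentSpace 𝓘(ℝ, Model m) p →L[ℝ] TangentSpace 𝓘(ℝ, Model m) p) :
    modelEnd (curvature g.inner p (hat g p a)) = (1 / 2 : ℝ) • ∑ i,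
      coordCurvature g.inner p (extChartAt 𝓘(ℝ, Model m) p p)
        ![dualVec g p i, modelEnd a (basisVec p i)] := by
  rw [hat, map_smul, map_sum]
  exact congrArg (fun T : Model m →L[ℝ] Model m ↦ (1 / 2 : ℝ) • T) (Finset.sum_congr rfl fun i _ ↦
    curvature_ιMulti g p ((bilinForm g p).dualBasis (bilinForm_nondegenerate g p)
      (Module.finBasis ℝ (TangentSpace 𝓘(ℝ, Model m) p)) i)
      (a (Module.finBasis ℝ (TangentSpace 𝓘(ℝ, Model m) p) i)))

/-- Pair symmetry changes g(R(b'_i, a b_i) v, w) into g(R(v, w) b'_i, a b_i), and skewness of a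
moves it to the left with a sign, leaving the trace of a R(v, w). The 2 removes the ½ in a^∧. -/
theorem two_mul_inner_curvature_hat (p : N)
    (a : TangentSpace 𝓘(ℝ, Model m) p →L[ℝ] TangentSpace 𝓘(ℝ, Model m) p)
    (ha : ∀ v w, coordMetric g.inner p (extChartAt 𝓘(ℝ, Model m) p p) (modelEnd a v) w =
      -coordMetric g.inner p (extChartAt 𝓘(ℝ, Model m) p p) v (modelEnd a w)) (v w : Model m) :
    2 * coordMetric g.inner p (extChartAt 𝓘(ℝ, Model m) p p)
      (modelEnd (curvature g.inner p (hat g p a)) v) w =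
      -LinearMap.trace ℝ (Model m) (modelEnd a * coordCurvature g.inner p
        (extChartAt 𝓘(ℝ, Model m) p p) ![v, w] : Model m →L[ℝ] Model m) := by
  have hy := mem_extChartAt_target (I := 𝓘(ℝ, Model m)) p
  rw [trace_eq_sum_dualVec g p, curvature_hat, smul_apply, sum_apply, map_smul, map_sum,
    smul_apply, sum_apply, smul_eq_mul, ← mul_assoc, mul_one_div_cancel two_ne_zero, one_mul,
    ← Finset.sum_neg_distrib]
  refine Finset.sum_congr rfl fun i _ ↦ ?_
  rw [coordCurvature_pair_symm g hy, ← coordMetric_self, mul_apply_eq_comp, ha, neg_neg]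

end Curvature

/-! ### The section defined by J in the charts at p and at J(p) -/

section AlmostHermitianSection

variable {m : ℕ} {N : Type*} [TopologicalSpace N] [ChartedSpace (Model m) N]
  [IsManifold 𝓘(ℝ, Model m) ∞ N] {g : Metric m N}

namespace AlmostHermitian

variable (J : AlmostHermitian g) (p : N)

/-- Smoothness of J is given in the bundle of endomorphisms. Its trivialization at p conjugates by
the coordinate frame, which yields the matrix of J in the chart. -/
theorem contDiffAt_coordEnd :
    ContDiffAt ℝ ∞ (coordEnd J.J p) (extChartAt 𝓘(ℝ, Model m) p p) := by
  have : IsManifold 𝓘(ℝ, Model m) 1 N := isManifold_one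
  have h1 := ((contMDiffAt_hom_bundle _).1 (J.smooth p)).2
  have h2 : ContMDiffAt 𝓘(ℝ, Model m) 𝓘(ℝ, Model m) ∞ (extChartAt 𝓘(ℝ, Model m) p).symm
      (extChartAt 𝓘(ℝ, Model m) p p) :=
    (contMDiffOn_extChartAt_symm p).contMDiffAt
      ((isOpen_extChartAt_target p).mem_nhds (mem_extChartAt_target p))
  have h3 := ContMDiffAt.comp_of_eq h1 h2 (extChartAt_to_inv p)
  refine h3.contDiffAt.congr_of_eventuallyEq ?_
  filter_upwards [(isOpen_extChartAt_target (I := 𝓘(ℝ, Model m)) p).mem_nhds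
    (mem_extChartAt_target p)] with y hy
  have hq := extChartAt_symm_mem_chart_source hy
  have e1 := TangentBundle.continuousLinearMapAt_trivializationAt (I := 𝓘(ℝ, Model m)) hq
  have e2 := TangentBundle.symmL_trivializationAt (I := 𝓘(ℝ, Model m)) hq
  rw [modelWithCornersSelf_coe, Set.range_id, mfderivWithin_univ,
    (extChartAt 𝓘(ℝ, Model m) p).right_inv hy] at e2
  simp only [Function.comp_apply, ContinuousLinearMap.inCoordinates]
  rw [e1, e2]
  rfl

theorem mat_section {F : OrthoFrame g} {y : Model m}
    (hy : y ∈ (extChartAt 𝓘(ℝ, Model m) p).target) :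
    F.mat (J.section ((extChartAt 𝓘(ℝ, Model m) p).symm y)) =
      frameMat F p y (coordEnd J.J p y) := by
  ext1 v
  have h1 : ∀ w, frame p y (coframe p y w) = w := fun w ↦
    DFunLike.congr_fun (frame_mul_coframe hy) w
  have h2 : frame p y (coordEnd J.J p y (frameLin F p y v)) =
      modelEnd (J.J ((extChartAt 𝓘(ℝ, Model m) p).symm y))
        (modelVec (F.lin ((extChartAt 𝓘(ℝ, Model m) p).symm y) v)) := by
    rw [coordEnd_eq, mul_apply_eq_comp, mul_apply_eq_comp, h1]
    exact congrArg _ (h1 _)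
  exact (congrArg (fun w : Model m ↦ F.coord ((extChartAt 𝓘(ℝ, Model m) p).symm y) w) h2).symm

/-- The section defined by `J`, in the charts at `p` and at `J p`. -/
def localSection (y : Model m) : Model m × StdTangent m :=
  extChartAt 𝓘(ℝ, Model m × StdTangent m) (J.section p)
    (J.section ((extChartAt 𝓘(ℝ, Model m) p).symm y))

theorem localSection_self : J.localSection p (extChartAt 𝓘(ℝ, Model m) p p) =
    extChartAt 𝓘(ℝ, Model m × StdTangent m) (J.section p) (J.section p) := by
  rw [localSection, extChartAt_to_inv]

theorem eventually_mem_dom :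
    ∀ᶠ y in 𝓝 (extChartAt 𝓘(ℝ, Model m) p p), y ∈ (extChartAt 𝓘(ℝ, Model m) p).target ∩
      (extChartAt 𝓘(ℝ, Model m) p).symm ⁻¹' (adaptedFrame (J.section p)).dom := by
  refine (isOpen_frame_dom _ p).mem_nhds ⟨mem_extChartAt_target p, ?_⟩
  rw [Set.mem_preimage, extChartAt_to_inv]
  exact proj_mem_adaptedFrame (J.section p)

theorem contDiffAt_frameMat :
    ContDiffAt ℝ ∞ (fun y ↦ frameMat (adaptedFrame (J.section p)) p y (coordEnd J.J p y))
      (extChartAt 𝓘(ℝ, Model m) p p) := by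
  have h := J.eventually_mem_dom p
  exact ((contDiffOn_frameCoord _ p).contDiffAt h).clm_comp
    ((J.contDiffAt_coordEnd p).clm_comp ((contDiffOn_frameLin _ p).contDiffAt h))

theorem isUnit_one_sub_frameMat : IsUnit (1 - stdJ m * frameMat (adaptedFrame (J.section p)) p
    (extChartAt 𝓘(ℝ, Model m) p p) (coordEnd J.J p (extChartAt 𝓘(ℝ, Model m) p p))) := by
  have h := ((mem_twistor_source (J.section p) (J.section p)).1 (mem_extChartAt_source _)).2.2
  rwa [← J.mat_section p (mem_extChartAt_target p), extChartAt_to_inv]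

/-- Continuity of the section into the twistor space is not presupposed. Membership in the chart
domain amounts to being over the domains of the base chart and of the frame, and to a unit condition
on the matrix of J; each is open near p. -/
theorem eventually_section_mem_source :
    ∀ᶠ y in 𝓝 (extChartAt 𝓘(ℝ, Model m) p p),
      J.section ((extChartAt 𝓘(ℝ, Model m) p).symm y) ∈
        (extChartAt 𝓘(ℝ, Model m × StdTangent m) (J.section p)).source := by
  have h1 : ContinuousAt (fun y ↦ 1 - stdJ m *
      frameMat (adaptedFrame (J.section p)) p y (coordEnd J.J p y))
      (extChartAt 𝓘(ℝ, Model m) p p) :=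
    continuousAt_const.sub (continuousAt_const.mul (J.contDiffAt_frameMat p).continuousAt)
  have h2 := h1.eventually (Units.isOpen.mem_nhds (J.isUnit_one_sub_frameMat p))
  filter_upwards [h2, J.eventually_mem_dom p] with y hy hy'
  rw [mem_twistor_source]
  refine ⟨(extChartAt 𝓘(ℝ, Model m) p).map_target hy'.1, hy'.2, ?_⟩
  rw [J.mat_section p hy'.1]
  exact hy

theorem eventually_csField_localSection :
    ∀ᶠ y in 𝓝 (extChartAt 𝓘(ℝ, Model m) p p),
      J.localSection p y ∈
        (extChartAt 𝓘(ℝ, Model m × StdTangent m) (J.section p)).target ∧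
      csField (J.section p) (J.localSection p y) = coordEnd J.J p y ∧
      (J.localSection p y).1 = y := by
  filter_upwards [J.eventually_section_mem_source p, J.eventually_mem_dom p] with y hy hy'
  refine ⟨(extChartAt _ _).map_source hy, ?_, (extChartAt 𝓘(ℝ, Model m) p).right_inv hy'.1⟩
  rw [csField, localSection, (extChartAt _ _).left_inv hy]
  exact coordCs_eq hy'.1 (J.section ((extChartAt 𝓘(ℝ, Model m) p).symm y)) rfl

theorem contDiffAt_localSection :
    ContDiffAt ℝ ∞ (J.localSection p) (extChartAt 𝓘(ℝ, Model m) p p) := by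
  have h1 := ContDiffAt.comp (f := fun y ↦ frameMat (adaptedFrame (J.section p)) p y
    (coordEnd J.J p y)) (extChartAt 𝓘(ℝ, Model m) p p)
    (contDiffAt_cayley (J.isUnit_one_sub_frameMat p)) (J.contDiffAt_frameMat p)
  have h2 := (stdProj m).contDiff.contDiffAt.comp _ h1
  refine (contDiffAt_id.prodMk h2).congr_of_eventuallyEq ?_
  filter_upwards [J.eventually_mem_dom p] with y hy
  rw [localSection, extChartAt_twistor, J.mat_section p hy.1]
  refine Prod.ext ?_ rfl
  exact (extChartAt 𝓘(ℝ, Model m) p).right_inv hy.1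

theorem fderiv_localSection_fst (u : Model m) :
    (fderiv ℝ (J.localSection p) (extChartAt 𝓘(ℝ, Model m) p p) u).1 = u := by
  have h0 : (fun y ↦ (J.localSection p y).1) =ᶠ[𝓝 (extChartAt 𝓘(ℝ, Model m) p p)] id :=
    (J.eventually_csField_localSection p).mono fun y hy ↦ hy.2.2
  have h1 := ((J.contDiffAt_localSection p).differentiableAt (by simp)).hasFDerivAt.fst
  have h2 := DFunLike.congr_fun (h1.unique
    ((hasFDerivAt_id _).congr_of_eventuallyEq h0)) u
  exact h2

/-- The covariant derivative of `J` is the connection map applied to the differential of the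
section. -/
theorem eventually_coordNabla :
    ∀ᶠ y in 𝓝 (extChartAt 𝓘(ℝ, Model m) p p), coordNabla g.inner J.J p y =
      (connForm (J.section p) (J.localSection p y)).comp (fderiv ℝ (J.localSection p) y) := by
  -- At each nearby y the identities are needed on a neighbourhood of y, because they are
  -- differentiated there.
  have h0 := (J.eventually_csField_localSection p).eventually_nhds
  have h1 : ∀ᶠ y in 𝓝 (extChartAt 𝓘(ℝ, Model m) p p), ContDiffAt ℝ 1 (J.localSection p) y :=
    ((J.contDiffAt_localSection p).of_le (m := 1) (by norm_cast)).eventually (by simp)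
  filter_upwards [h0, h1] with y hy hy1
  have hf := hy1.differentiableAt (by simp)
  obtain ⟨hz, hcs, hfst⟩ := hy.self_of_nhds
  have hI := (contDiffAt_csField hz).differentiableAt (by simp)
  have h2 : coordEnd J.J p =ᶠ[𝓝 y] csField (J.section p) ∘ J.localSection p :=
    hy.mono fun y' hy' ↦ hy'.2.1.symm
  have h3 := h2.fderiv_eq (𝕜 := ℝ)
  rw [fderiv_comp y hI hf] at h3
  have h4 : (fun y ↦ (J.localSection p y).1) =ᶠ[𝓝 y] id := hy.mono fun y' hy' ↦ hy'.2.2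
  ext1 u
  have h5 : (fderiv ℝ (J.localSection p) y u).1 = u :=
    DFunLike.congr_fun (hf.hasFDerivAt.fst.unique
      ((hasFDerivAt_id _).congr_of_eventuallyEq h4)) u
  -- By the chain rule the derivative of J is that of I along the section. The section lies over the
  -- identity, so the Christoffel terms agree too.
  rw [ContinuousLinearMap.comp_apply, connForm_apply, h5, hcs, hfst, coordNabla, h3]
  rfl

end AlmostHermitian

end AlmostHermitianSection

/-! ### Differentiation rules and the Koszul formula for a trace metric -/

section ConnectionCalculus

variable {E F A : Type*} [NormedAddCommGroup E] [NormedSpace ℝ E]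
  [NormedAddCommGroup F] [NormedSpace ℝ F] [NormedRing A] [NormedAlgebra ℝ A]

theorem fderiv_clm_apply_const {K : F → E →L[ℝ] A} {z : F} (hK : DifferentiableAt ℝ K z) (η : E) :
    HasFDerivAt (fun z ↦ K z η) ((fderiv ℝ K z).flip η) z := by
  have h := hK.hasFDerivAt.clm_apply (hasFDerivAt_const η z)
  rwa [ContinuousLinearMap.comp_zero, zero_add] at h

theorem fderiv_bilin_apply {B : F → E →L[ℝ] E →L[ℝ] ℝ} {z : F} (hB : DifferentiableAt ℝ B z)
    (ξ η : E) : HasFDerivAt (fun z ↦ B z ξ η) (((fderiv ℝ B z).flip ξ).flip η) z := by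
  have h := (hB.hasFDerivAt.clm_apply (hasFDerivAt_const ξ z)).clm_apply (hasFDerivAt_const η z)
  rwa [ContinuousLinearMap.comp_zero, zero_add, ContinuousLinearMap.comp_zero, zero_add] at h

theorem fderiv_add_commutator {I : F → A} {K K' Γ : F → E →L[ℝ] A} {z : F}
    (hI : DifferentiableAt ℝ I z) (hK : DifferentiableAt ℝ K z) (hK' : DifferentiableAt ℝ K' z)
    (hΓ : DifferentiableAt ℝ Γ z)
    (h : ∀ z η, K z η = K' z η + (Γ z η * I z - I z * Γ z η)) (ξ : F) (η : E) :
    fderiv ℝ K z ξ η = fderiv ℝ K' z ξ η + ((fderiv ℝ Γ z ξ η * I z - I z * fderiv ℝ Γ z ξ η) +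
      (Γ z η * fderiv ℝ I z ξ - fderiv ℝ I z ξ * Γ z η)) := by
  have h2 := fderiv_clm_apply_const hΓ η
  have h4 := (fderiv_clm_apply_const hK' η).add
    ((h2.fun_mul' hI.hasFDerivAt).sub (hI.hasFDerivAt.fun_mul' h2))
  have h5 := fderiv_clm_apply_const hK η
  rw [funext fun z ↦ h z η] at h5
  have h6 := DFunLike.congr_fun (h5.unique h4) ξ
  simp only [add_apply, sub_apply, smul_apply, smul_eq_mul, MulOpposite.smul_eq_mul_unop,
    MulOpposite.unop_op, ContinuousLinearMap.flip_apply] at h6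
  rw [h6]
  abel

theorem fderiv_trace_mul {K : F → E →L[ℝ] A} {z : F} (hK : DifferentiableAt ℝ K z)
    (T : A →L[ℝ] ℝ) (ξ η : E) :
    DifferentiableAt ℝ (fun z ↦ T (K z ξ * K z η)) z ∧
    ∀ ζ, fderiv ℝ (fun z ↦ T (K z ξ * K z η)) z ζ =
      T (fderiv ℝ K z ζ ξ * K z η) + T (K z ξ * fderiv ℝ K z ζ η) := by
  have h := T.hasFDerivAt.comp z
    ((fderiv_clm_apply_const hK ξ).fun_mul' (fderiv_clm_apply_const hK η))
  refine ⟨h.differentiableAt, fun ζ ↦ ?_⟩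
  have h' := DFunLike.congr_fun h.fderiv ζ
  refine h'.trans ?_
  simp only [ContinuousLinearMap.comp_apply, add_apply, smul_apply, smul_eq_mul,
    MulOpposite.smul_eq_mul_unop, MulOpposite.unop_op, ContinuousLinearMap.flip_apply, map_add]
  rw [add_comm]

theorem fderiv_comp_fst {S V : Type*} [NormedAddCommGroup S] [NormedSpace ℝ S]
    [NormedAddCommGroup V] [NormedSpace ℝ V] {f : E → V} {z : E × S}
    (hf : DifferentiableAt ℝ f z.1) :
    DifferentiableAt ℝ (fun z : E × S ↦ f z.1) z ∧
      ∀ ζ, fderiv ℝ (fun z : E × S ↦ f z.1) z ζ = fderiv ℝ f z.1 ζ.1 := by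
  have h := hf.hasFDerivAt.comp z hasFDerivAt_fst
  exact ⟨h.differentiableAt, fun ζ ↦ DFunLike.congr_fun h.fderiv ζ⟩

theorem fderiv_comp_fst_comp {S V : Type*} [NormedAddCommGroup S] [NormedSpace ℝ S]
    [NormedAddCommGroup V] [NormedSpace ℝ V] {f : E → E →L[ℝ] V} {z : E × S}
    (hf : DifferentiableAt ℝ f z.1) :
    DifferentiableAt ℝ (fun z : E × S ↦ (f z.1).comp (ContinuousLinearMap.fst ℝ E S)) z ∧
      ∀ ζ η, fderiv ℝ (fun z : E × S ↦ (f z.1).comp (ContinuousLinearMap.fst ℝ E S)) z ζ η =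
        fderiv ℝ f z.1 ζ.1 η.1 := by
  have h := (hf.hasFDerivAt.comp z hasFDerivAt_fst).clm_comp
    (hasFDerivAt_const (ContinuousLinearMap.fst ℝ E S) z)
  refine ⟨h.differentiableAt, fun ζ η ↦ ?_⟩
  refine (DFunLike.congr_fun (DFunLike.congr_fun h.fderiv ζ) η).trans ?_
  simp

theorem fderiv_bundle_metric {S : Type*} [NormedAddCommGroup S] [NormedSpace ℝ S]
    {B : E × S → E × S →L[ℝ] E × S →L[ℝ] ℝ} {G : E → E →L[ℝ] E →L[ℝ] ℝ}
    {K : E × S → E × S →L[ℝ] A} {z : E × S} {T : A →L[ℝ] ℝ} {c d : ℝ}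
    (hB : DifferentiableAt ℝ B z) (hG : DifferentiableAt ℝ G z.1) (hK : DifferentiableAt ℝ K z)
    (h : ∀ ξ η, ∀ᶠ z in 𝓝 z, B z ξ η = G z.1 ξ.1 η.1 + c * (d * T (K z ξ * K z η)))
    (ζ ξ η : E × S) :
    fderiv ℝ B z ζ ξ η = fderiv ℝ G z.1 ζ.1 ξ.1 η.1 +
      c * (d * (T (fderiv ℝ K z ζ ξ * K z η) + T (K z ξ * fderiv ℝ K z ζ η))) := by
  obtain ⟨h1, h1'⟩ := fderiv_comp_fst (S := S) (z := z) (f := fun y ↦ G y ξ.1 η.1)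
    (fderiv_bilin_apply hG ξ.1 η.1).differentiableAt
  obtain ⟨h2, h2'⟩ := fderiv_trace_mul hK T ξ η
  have h4 := (fderiv_bilin_apply hB ξ η).unique ((h1.hasFDerivAt.add
    ((h2.hasFDerivAt.const_mul d).const_mul c)).congr_of_eventuallyEq (h ξ η))
  have h5 := DFunLike.congr_fun h4 ζ
  have h6 := DFunLike.congr_fun (fderiv_bilin_apply hG ξ.1 η.1).fderiv ζ.1
  refine h5.trans ?_
  rw [add_apply, h1' ζ, h6, smul_apply, smul_apply, h2' ζ]
  rfl

/-- Here k_i stands for K(ξ_i), g_i for Γ(ξ_i), d_ij for the derivative of K(ξ_j) along ξ_i, and r_i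
for [R(ξ_i, ξ_3), I]. The structure equations h₁ and h₂ trade d₁₃ and d₂₃ for d₃₁ and d₃₂, which
cancel against the subtracted terms. By cyclicity of the trace the g₃ terms cancel as well, and the
g₁ and g₂ terms complete d₁₂ + d₂₁ to a covariant derivative. -/
theorem trace_koszul {A : Type*} [Ring A] (T : A →+ ℝ) (hT : ∀ a b, T (a * b) = T (b * a))
    {d₁₂ d₂₁ d₁₃ d₃₁ d₂₃ d₃₂ k₁ k₂ k₃ g₁ g₂ g₃ r₁ r₂ : A}
    (h₁ : d₁₃ - d₃₁ = (g₃ * k₁ - k₁ * g₃) - (g₁ * k₃ - k₃ * g₁) - r₁)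
    (h₂ : d₂₃ - d₃₂ = (g₃ * k₂ - k₂ * g₃) - (g₂ * k₃ - k₃ * g₂) - r₂) :
    (T (d₁₂ * k₃) + T (k₂ * d₁₃)) + (T (d₂₁ * k₃) + T (k₁ * d₂₃)) - (T (d₃₁ * k₂) + T (k₁ * d₃₂)) =
      T ((d₁₂ + d₂₁ + (g₁ * k₂ - k₂ * g₁) + (g₂ * k₁ - k₁ * g₂)) * k₃) - T (k₂ * r₁) -
        T (k₁ * r₂) := by
  obtain rfl : d₁₃ = d₃₁ + ((g₃ * k₁ - k₁ * g₃) - (g₁ * k₃ - k₃ * g₁) - r₁) := by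
    rw [← h₁]; abel
  obtain rfl : d₂₃ = d₃₂ + ((g₃ * k₂ - k₂ * g₃) - (g₂ * k₃ - k₃ * g₂) - r₂) := by
    rw [← h₂]; abel
  simp only [mul_add, mul_sub, add_mul, sub_mul, map_add, map_sub]
  have e₁ := hT d₃₁ k₂
  have e₂ : T (k₂ * (g₃ * k₁)) = T (k₁ * (k₂ * g₃)) := by rw [← mul_assoc, hT]
  have e₃ : T (k₂ * (k₁ * g₃)) = T (k₁ * (g₃ * k₂)) := by rw [hT, mul_assoc]
  have e₄ : T (k₂ * (g₁ * k₃)) = T (k₂ * g₁ * k₃) := by rw [mul_assoc]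
  have e₅ : T (k₂ * (k₃ * g₁)) = T (g₁ * k₂ * k₃) := by rw [← mul_assoc, hT, mul_assoc]
  have e₆ : T (k₁ * (g₂ * k₃)) = T (k₁ * g₂ * k₃) := by rw [mul_assoc]
  have e₇ : T (k₁ * (k₃ * g₂)) = T (g₂ * k₁ * k₃) := by rw [← mul_assoc, hT, mul_assoc]
  linarith

theorem koszul_of_sum {C C' a b c a' b' c' x₁ y₁ x₂ y₂ x₃ y₃ t k S : ℝ}
    (h₁ : a = a' + t * (k * (x₁ + y₁))) (h₂ : b = b' + t * (k * (x₂ + y₂)))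
    (h₃ : c = c' + t * (k * (x₃ + y₃))) (h₄ : C' = (1 / 2 : ℝ) * (a' + b' - c'))
    (h₅ : C = (1 / 2 : ℝ) * (a + b - c)) (h : x₁ + y₁ + (x₂ + y₂) - (x₃ + y₃) = S) :
    C = C' + t * k / 2 * S := by
  rw [h₅, h₁, h₂, h₃, h₄, ← h]
  ring

end ConnectionCalculus

/-! ### The structure equation and the Christoffel symbols of h_t -/

section LeviCivita

variable {m : ℕ} {N : Type*} [TopologicalSpace N] [ChartedSpace (Model m) N]
  [IsManifold 𝓘(ℝ, Model m) ∞ N] {g : Metric m N}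

/-- The trace as a continuous linear map. -/
def traceL (m : ℕ) : (Model m →L[ℝ] Model m) →L[ℝ] ℝ :=
  LinearMap.toContinuousLinearMap
    ((LinearMap.trace ℝ (Model m)).comp (ContinuousLinearMap.coeLM ℝ))

theorem traceL_apply (A : Model m →L[ℝ] Model m) :
    traceL m A = LinearMap.trace ℝ (Model m) A := rfl

theorem traceL_mul_comm (A B : Model m →L[ℝ] Model m) : traceL m (A * B) = traceL m (B * A) :=
  LinearMap.trace_mul_comm ℝ A.toLinearMap B.toLinearMap

variable {σ : TwistorSpace g} {z : Model m × StdTangent m}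

theorem contDiffAt_connForm (hz : z ∈ (extChartAt 𝓘(ℝ, Model m × StdTangent m) σ).target) :
    ContDiffAt ℝ ∞ (connForm σ) z := by
  have ho : IsOpen (extChartAt 𝓘(ℝ, Model m × StdTangent m) σ).target :=
    isOpen_extChartAt_target σ
  have hI := contDiffOn_csField σ
  have hI' : ContDiffOn ℝ ∞ (fderiv ℝ (csField σ))
      (extChartAt 𝓘(ℝ, Model m × StdTangent m) σ).target := hI.fderiv_of_isOpen ho (by simp)
  have hΓ : ContDiffOn ℝ ∞ (fun z : Model m × StdTangent m ↦ christoffel g.inner σ.proj z.1)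
      (extChartAt 𝓘(ℝ, Model m × StdTangent m) σ).target :=
    (contDiffOn_christoffel g σ.proj).comp contDiff_fst.contDiffOn
      fun z hz ↦ ((mem_twistor_target σ z).1 hz).1
  refine ContDiffOn.contDiffAt ?_ (ho.mem_nhds hz)
  rw [contDiffOn_clm_apply]
  intro η
  have hη : ContDiffOn ℝ ∞
      (fun z : Model m × StdTangent m ↦ christoffel g.inner σ.proj z.1 η.1)
      (extChartAt 𝓘(ℝ, Model m × StdTangent m) σ).target := hΓ.clm_apply contDiffOn_const
  simp only [connForm_apply, commutator_apply]
  exact (hI'.clm_apply contDiffOn_const).add ((hη.mul hI).sub (hI.mul hη))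

theorem fderiv_connForm (hz : z ∈ (extChartAt 𝓘(ℝ, Model m × StdTangent m) σ).target)
    (ξ η : Model m × StdTangent m) :
    fderiv ℝ (connForm σ) z ξ η = fderiv ℝ (fderiv ℝ (csField σ)) z ξ η +
      (commutator (csField σ z) (fderiv ℝ (christoffel g.inner σ.proj) z.1 ξ.1 η.1) +
        commutator (fderiv ℝ (csField σ) z ξ) (christoffel g.inner σ.proj z.1 η.1)) := by
  have hz1 := ((mem_twistor_target σ z).1 hz).1
  have hK : DifferentiableAt ℝ (connForm σ) z := (contDiffAt_connForm hz).differentiableAt (by simp)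
  have hI : DifferentiableAt ℝ (csField σ) z := (contDiffAt_csField hz).differentiableAt (by simp)
  have hI' : DifferentiableAt ℝ (fderiv ℝ (csField σ)) z :=
    ((contDiffAt_csField hz).fderiv_right (m := ∞) (by simp)).differentiableAt (by simp)
  obtain ⟨hΓ, hΓ'⟩ := fderiv_comp_fst_comp (S := StdTangent m) (z := z)
    ((contDiffAt_christoffel g hz1).differentiableAt (by simp))
  have h := fderiv_add_commutator hI hK hI' hΓ (fun z η ↦ connForm_apply σ z η) ξ η
  rw [hΓ'] at h
  exact h

/-- The exterior covariant derivative of the connection map is the curvature. -/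
theorem fderiv_connForm_sub (hz : z ∈ (extChartAt 𝓘(ℝ, Model m × StdTangent m) σ).target)
    (ξ ζ : Model m × StdTangent m) :
    fderiv ℝ (connForm σ) z ξ ζ - fderiv ℝ (connForm σ) z ζ ξ =
      commutator (connForm σ z ξ) (christoffel g.inner σ.proj z.1 ζ.1) -
      commutator (connForm σ z ζ) (christoffel g.inner σ.proj z.1 ξ.1) -
      commutator (csField σ z) (coordCurvature g.inner σ.proj z.1 ![ξ.1, ζ.1]) := by
  -- The second derivative of I drops out of the antisymmetrisation, and the derivatives of Γ
  -- combine to the curvature.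
  have hsym := (((contDiffAt_csField hz).of_le (m := 2) (by norm_cast)).isSymmSndFDerivAt
    (by simp)).eq ξ ζ
  rw [fderiv_connForm hz, fderiv_connForm hz, hsym, connForm_apply, connForm_apply,
    coordCurvature_apply]
  simp only [commutator_apply]
  noncomm_ring

theorem coordMetric_twistorMetric' (t : ℝ)
    (hz : z ∈ (extChartAt 𝓘(ℝ, Model m × StdTangent m) σ).target)
    (ξ η : Model m × StdTangent m) :
    coordMetric (twistorMetric g t) σ z ξ η = coordMetric g.inner σ.proj z.1 ξ.1 η.1 +
      t * (-(1 / (2 * m : ℝ)) * traceL m (connForm σ z ξ * connForm σ z η)) :=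
  coordMetric_twistorMetric t hz ξ η

theorem differentiableAt_coordMetric_twistor (t : ℝ)
    (hz : z ∈ (extChartAt 𝓘(ℝ, Model m × StdTangent m) σ).target) :
    DifferentiableAt ℝ (coordMetric (twistorMetric g t) σ) z := by
  have ho : IsOpen (extChartAt 𝓘(ℝ, Model m × StdTangent m) σ).target :=
    isOpen_extChartAt_target σ
  have h : ContDiffOn ℝ 1 (coordMetric (twistorMetric g t) σ)
      (extChartAt 𝓘(ℝ, Model m × StdTangent m) σ).target := by
    rw [contDiffOn_clm_apply]
    intro ξ
    rw [contDiffOn_clm_apply]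
    intro η
    have hG : ContDiffOn ℝ 1 (fun z : Model m × StdTangent m ↦ coordMetric g.inner σ.proj z.1)
        (extChartAt 𝓘(ℝ, Model m × StdTangent m) σ).target :=
      ((contDiffOn_coordMetric g σ.proj).of_le (by norm_cast)).comp contDiff_fst.contDiffOn
        fun z hz ↦ ((mem_twistor_target σ z).1 hz).1
    have hK : ContDiffOn ℝ 1 (connForm σ)
        (extChartAt 𝓘(ℝ, Model m × StdTangent m) σ).target := fun z hz ↦
      ((contDiffAt_connForm hz).of_le (by norm_cast)).contDiffWithinAt
    have hKK := (traceL m).contDiff.comp_contDiffOn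
      ((hK.clm_apply (contDiffOn_const (c := ξ))).mul (hK.clm_apply (contDiffOn_const (c := η))))
    exact (((hG.clm_apply contDiffOn_const).clm_apply contDiffOn_const).add
      (contDiffOn_const.mul (contDiffOn_const.mul hKK))).congr
        fun z hz ↦ coordMetric_twistorMetric' t hz ξ η
  exact (h.contDiffAt (ho.mem_nhds hz)).differentiableAt (by simp)

theorem fderiv_coordMetric_twistor (t : ℝ)
    (hz : z ∈ (extChartAt 𝓘(ℝ, Model m × StdTangent m) σ).target)
    (ζ ξ η : Model m × StdTangent m) :
    fderiv ℝ (coordMetric (twistorMetric g t) σ) z ζ ξ η =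
      fderiv ℝ (coordMetric g.inner σ.proj) z.1 ζ.1 ξ.1 η.1 + t * (-(1 / (2 * m : ℝ)) *
        (traceL m (fderiv ℝ (connForm σ) z ζ ξ * connForm σ z η) +
          traceL m (connForm σ z ξ * fderiv ℝ (connForm σ) z ζ η))) := by
  have hz1 := ((mem_twistor_target σ z).1 hz).1
  have hG : DifferentiableAt ℝ (coordMetric g.inner σ.proj) z.1 :=
    (contDiffAt_coordMetric g hz1).differentiableAt (by simp)
  have hK : DifferentiableAt ℝ (connForm σ) z := (contDiffAt_connForm hz).differentiableAt (by simp)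
  exact fderiv_bundle_metric (differentiableAt_coordMetric_twistor t hz) hG hK
    (fun ξ η ↦ (eventually_twistor_target hz).mono fun z' hz' ↦
      coordMetric_twistorMetric' t hz' ξ η) ζ ξ η

/-- The Christoffel symbols of the first kind of the metric `h_t`. -/
theorem christoffelFirst_twistor (t : ℝ)
    (hz : z ∈ (extChartAt 𝓘(ℝ, Model m × StdTangent m) σ).target)
    (ξ η ζ : Model m × StdTangent m) :
    christoffelFirst (twistorMetric g t) σ z ξ η ζ =
      christoffelFirst g.inner σ.proj z.1 ξ.1 η.1 ζ.1 + t * (-(1 / (2 * m : ℝ))) / 2 *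
      (traceL m ((fderiv ℝ (connForm σ) z ξ η + fderiv ℝ (connForm σ) z η ξ +
          commutator (connForm σ z η) (christoffel g.inner σ.proj z.1 ξ.1) +
          commutator (connForm σ z ξ) (christoffel g.inner σ.proj z.1 η.1)) * connForm σ z ζ) -
        traceL m (connForm σ z η * commutator (csField σ z)
          (coordCurvature g.inner σ.proj z.1 ![ξ.1, ζ.1])) -
        traceL m (connForm σ z ξ * commutator (csField σ z)
          (coordCurvature g.inner σ.proj z.1 ![η.1, ζ.1]))) := by
  have h := trace_koszul (traceL m : (Model m →L[ℝ] Model m) →+ ℝ) traceL_mul_comm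
    (d₁₂ := fderiv ℝ (connForm σ) z ξ η) (d₂₁ := fderiv ℝ (connForm σ) z η ξ)
    (fderiv_connForm_sub hz ξ ζ) (fderiv_connForm_sub hz η ζ)
  simp only [AddMonoidHom.coe_coe] at h
  have h1 := fderiv_coordMetric_twistor t hz ξ η ζ
  have h2 := fderiv_coordMetric_twistor t hz η ξ ζ
  have h3 := fderiv_coordMetric_twistor t hz ζ ξ η
  have h4 := christoffelFirst_apply g.inner σ.proj z.1 ξ.1 η.1 ζ.1
  have h5 := christoffelFirst_apply (twistorMetric g t) σ z ξ η ζ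
  exact koszul_of_sum h1 h2 h3 h4 h5 h

end LeviCivita

/-! ### Algebraic comparison of the two sides against a test vector -/

section SplitForms

variable {E S A : Type*} [NormedAddCommGroup E] [NormedSpace ℝ E]
  [NormedAddCommGroup S] [NormedSpace ℝ S] [NormedRing A] [NormedAlgebra ℝ A]

theorem fderiv_comp_fderiv {F : Type*} [NormedAddCommGroup F] [NormedSpace ℝ F]
    {K : F → F →L[ℝ] A} {f : E → F} {y : E} (hK : DifferentiableAt ℝ K (f y))
    (hf : DifferentiableAt ℝ f y) (hf' : DifferentiableAt ℝ (fderiv ℝ f) y) :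
    DifferentiableAt ℝ (fun y ↦ (K (f y)).comp (fderiv ℝ f y)) y ∧
    ∀ u v, fderiv ℝ (fun y ↦ (K (f y)).comp (fderiv ℝ f y)) y u v =
      fderiv ℝ K (f y) (fderiv ℝ f y u) (fderiv ℝ f y v) +
        K (f y) (fderiv ℝ (fderiv ℝ f) y u v) := by
  have h := (hK.hasFDerivAt.comp y hf.hasFDerivAt).clm_comp hf'.hasFDerivAt
  refine ⟨h.differentiableAt, fun u v ↦ ?_⟩
  refine (DFunLike.congr_fun (DFunLike.congr_fun h.fderiv u) v).trans ?_
  simp [add_comm]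

/-- T(I Q I k) = T(Q I k I) = T(Q k), because k anti-commutes with I and I² = -1: the projection is
self-adjoint for the trace form and fixes k. -/
theorem trace_vertical (T : A →L[ℝ] ℝ) (hT : ∀ a b, T (a * b) = T (b * a)) {I k : A}
    (hI : I * I = -1) (hk : k * I = -(I * k)) (Q : A) :
    T ((1 / 2 : ℝ) • (Q + I * (Q * I)) * k) = T (Q * k) := by
  have h : T (I * (Q * I) * k) = T (Q * k) := by
    rw [mul_assoc, hT, mul_assoc, mul_assoc, hk, mul_neg, ← mul_assoc I, hI, neg_mul,
      neg_neg, one_mul]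
  rw [smul_mul_assoc, add_mul, map_smul, map_add, h, smul_eq_mul]
  ring

theorem trace_mul_commutator (T : A →L[ℝ] ℝ) (hT : ∀ a b, T (a * b) = T (b * a)) {I k : A}
    (hk : k * I = -(I * k)) (R : A) : T (k * (R * I - I * R)) = 2 * T (I * k * R) := by
  have h : T (k * (R * I)) = T (I * k * R) := by rw [← mul_assoc, hT, mul_assoc]
  rw [mul_sub, map_sub, h, ← mul_assoc, hk, neg_mul, map_neg]
  ring

/-- Here a is the second derivative of the section, b its differential at Γ(u, v), c the Christoffel
vector of h_t, V the vertical part and H₁, H₂ the lifts; q₁ and q₂ are the two second covariant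
derivatives. Against ζ, the base part of b cancels the g-symbols in c, and the remaining K terms of
a - b + c sum to (tk/2) T((q₁ + q₂) K ζ), which is the pairing with V. With k = -1/n, the value s =
-2tk is the factor 2t/n of the lifts. -/
theorem secondFundamentalForm_test {h : E × S →L[ℝ] E × S →L[ℝ] ℝ} {G : E →L[ℝ] E →L[ℝ] ℝ}
    {K : E × S →L[ℝ] A} (T : A →L[ℝ] ℝ) (hT : ∀ a b, T (a * b) = T (b * a)) {t k s : ℝ}
    (hs : s = -2 * (t * k))
    (hh : ∀ ξ η, h ξ η = G ξ.1 η.1 + t * (k * T (K ξ * K η)))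
    {I : A} (hI : I * I = -1) (hK : ∀ ξ, K ξ * I = -(I * K ξ)) {R : E → E → A}
    {a b c ξ η V H₁ H₂ : E × S} {γ : E} {u v : E} {C : E → ℝ} {d₁₂ d₂₁ g₁ g₂ q₁ q₂ : A}
    (ha : a.1 = 0) (hb : b.1 = γ) (hC : ∀ w, G γ w = C w)
    (hc : ∀ ζ, h c ζ = C ζ.1 + t * k / 2 *
      (T ((d₁₂ + d₂₁ + (g₁ * K η - K η * g₁) + (g₂ * K ξ - K ξ * g₂)) * K ζ) -
        T (K η * (R u ζ.1 * I - I * R u ζ.1)) - T (K ξ * (R v ζ.1 * I - I * R v ζ.1))))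
    (hq₁ : q₁ = d₁₂ + K a + (g₁ * K η - K η * g₁) - K b)
    (hq₂ : q₂ = d₂₁ + K a + (g₂ * K ξ - K ξ * g₂) - K b)
    (hV : V.1 = 0)
    (hV' : K V = (1 / 2 : ℝ) • ((1 / 2 : ℝ) • ((q₁ + q₂) + I * ((q₁ + q₂) * I))))
    (hH₁ : K H₁ = 0) (hH₁' : ∀ w, 2 * G H₁.1 w = -T (I * K ξ * R v w))
    (hH₂ : K H₂ = 0) (hH₂' : ∀ w, 2 * G H₂.1 w = -T (I * K η * R u w)) (ζ : E × S) :
    h (a - b + c - (V - s • (H₁ + H₂))) ζ = 0 := by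
  have e₁ := hH₁' ζ.1
  have e₂ := hH₂' ζ.1
  have e₃ := trace_mul_commutator T hT (hK η) (R u ζ.1)
  have e₄ := trace_mul_commutator T hT (hK ξ) (R v ζ.1)
  have e₅ := trace_vertical T hT hI (hK ζ) (q₁ + q₂)
  have hVζ : h V ζ = t * (k * ((1 / 2) * T ((q₁ + q₂) * K ζ))) := by
    rw [hh, hV, hV', smul_mul_assoc, map_smul, e₅, map_zero, zero_apply, zero_add, smul_eq_mul]
  have hHζ₁ : h H₁ ζ = G H₁.1 ζ.1 := by rw [hh, hH₁, zero_mul, map_zero]; ring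
  have hHζ₂ : h H₂ ζ = G H₂.1 ζ.1 := by rw [hh, hH₂, zero_mul, map_zero]; ring
  have haζ : h a ζ = t * (k * T (K a * K ζ)) := by rw [hh, ha, map_zero, zero_apply, zero_add]
  have hbζ : h b ζ = C ζ.1 + t * (k * T (K b * K ζ)) := by rw [hh, hb, hC]
  rw [map_sub, map_add, map_sub, map_sub, map_smul, map_add]
  simp only [sub_apply, add_apply, smul_apply, smul_eq_mul]
  rw [hVζ, hHζ₁, hHζ₂, haζ, hbζ, hc, e₃, e₄, hq₁, hq₂, hs]
  simp only [add_mul, sub_mul, map_add, map_sub]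
  -- Only curvature is left: each commutator trace is twice T(I K R), that is -4 times the pairing
  -- with a lift, and its coefficient is -tk/2.
  linear_combination (-(t * k)) * (e₁ + e₂)

end SplitForms

/-! ### Second covariant derivative and second fundamental form of the section -/

namespace AlmostHermitian

variable {m : ℕ} {N : Type*} [TopologicalSpace N] [ChartedSpace (Model m) N]
  [IsManifold 𝓘(ℝ, Model m) ∞ N] {g : Metric m N} (J : AlmostHermitian g) (p : N)

theorem localSection_mem_target : J.localSection p (extChartAt 𝓘(ℝ, Model m) p p) ∈
    (extChartAt 𝓘(ℝ, Model m × StdTangent m) (J.section p)).target :=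
  (J.eventually_csField_localSection p).self_of_nhds.1

theorem differentiableAt_fderiv_localSection :
    DifferentiableAt ℝ (fderiv ℝ (J.localSection p)) (extChartAt 𝓘(ℝ, Model m) p p) :=
  ((J.contDiffAt_localSection p).fderiv_right (m := ∞) (by simp)).differentiableAt (by simp)

/-- ∇J is the pull-back of K by the section on a neighbourhood of p, so the product rule applies. It
brings in the second derivative of the section, which is the leading term of the second fundamental
form. -/
theorem fderiv_coordNabla :
    DifferentiableAt ℝ (coordNabla g.inner J.J p) (extChartAt 𝓘(ℝ, Model m) p p) ∧ ∀ u v,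
    fderiv ℝ (coordNabla g.inner J.J p) (extChartAt 𝓘(ℝ, Model m) p p) u v =
      fderiv ℝ (connForm (J.section p)) (J.localSection p (extChartAt 𝓘(ℝ, Model m) p p))
        (fderiv ℝ (J.localSection p) (extChartAt 𝓘(ℝ, Model m) p p) u)
        (fderiv ℝ (J.localSection p) (extChartAt 𝓘(ℝ, Model m) p p) v) +
      connForm (J.section p) (J.localSection p (extChartAt 𝓘(ℝ, Model m) p p))
        (fderiv ℝ (fderiv ℝ (J.localSection p)) (extChartAt 𝓘(ℝ, Model m) p p) u v) := by
  have h := J.eventually_coordNabla p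
  have hK : DifferentiableAt ℝ (connForm (J.section p))
      (J.localSection p (extChartAt 𝓘(ℝ, Model m) p p)) :=
    (contDiffAt_connForm (J.localSection_mem_target p)).differentiableAt (by simp)
  obtain ⟨h1, h2⟩ := fderiv_comp_fderiv hK
    ((J.contDiffAt_localSection p).differentiableAt (by simp))
    (J.differentiableAt_fderiv_localSection p)
  refine ⟨h1.congr_of_eventuallyEq h, fun u v ↦ ?_⟩
  rw [Filter.EventuallyEq.fderiv_eq (𝕜 := ℝ) h]
  exact h2 u v

/-- The section lies over the identity, so its differential has constant base component. -/
theorem fderiv_fderiv_localSection_fst (u v : Model m) :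
    (fderiv ℝ (fderiv ℝ (J.localSection p)) (extChartAt 𝓘(ℝ, Model m) p p) u v).1 = 0 := by
  have h0 : (fun y ↦ (ContinuousLinearMap.fst ℝ (Model m) (StdTangent m)).comp
      (fderiv ℝ (J.localSection p) y)) =ᶠ[𝓝 (extChartAt 𝓘(ℝ, Model m) p p)]
      fun _ ↦ ContinuousLinearMap.id ℝ (Model m) := by
    have h1 : ∀ᶠ y in 𝓝 (extChartAt 𝓘(ℝ, Model m) p p), ContDiffAt ℝ 1 (J.localSection p) y :=
      ((J.contDiffAt_localSection p).of_le (m := 1) (by norm_cast)).eventually (by simp)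
    filter_upwards [(J.eventually_csField_localSection p).eventually_nhds, h1] with y hy hy1
    have h4 : (fun y ↦ (J.localSection p y).1) =ᶠ[𝓝 y] id := hy.mono fun y' hy' ↦ hy'.2.2
    exact (hy1.differentiableAt (by simp)).hasFDerivAt.fst.unique
      ((hasFDerivAt_id _).congr_of_eventuallyEq h4)
  have h1 := (hasFDerivAt_const (ContinuousLinearMap.fst ℝ (Model m) (StdTangent m))
    (extChartAt 𝓘(ℝ, Model m) p p)).clm_comp
    (J.differentiableAt_fderiv_localSection p).hasFDerivAt
  have h2 := h1.unique ((hasFDerivAt_const (ContinuousLinearMap.id ℝ (Model m)) _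
    ).congr_of_eventuallyEq h0)
  have h3 := DFunLike.congr_fun (DFunLike.congr_fun h2 u) v
  simpa using h3

/-- The second covariant derivative of `J` on the model space. -/
def modelNablaSq (u v : Model m) : Model m →L[ℝ] Model m :=
  fderiv ℝ (coordNabla g.inner J.J p) (extChartAt 𝓘(ℝ, Model m) p p) u v +
    commutator (coordNabla g.inner J.J p (extChartAt 𝓘(ℝ, Model m) p p) v)
      (christoffel g.inner p (extChartAt 𝓘(ℝ, Model m) p p) u) -
    coordNabla g.inner J.J p (extChartAt 𝓘(ℝ, Model m) p p)
      (christoffel g.inner p (extChartAt 𝓘(ℝ, Model m) p p) u v)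

theorem coordNabla_skew :
    ∀ᶠ y in 𝓝 (extChartAt 𝓘(ℝ, Model m) p p), ∀ u a b : Model m,
      coordMetric g.inner p y (coordNabla g.inner J.J p y u a) b =
        -coordMetric g.inner p y a (coordNabla g.inner J.J p y u b) := by
  filter_upwards [J.eventually_coordNabla p, J.eventually_csField_localSection p] with y hy hy'
  intro u a b
  have h := connForm_skew hy'.1 (fderiv ℝ (J.localSection p) y u) a b
  rw [hy'.2.2] at h
  rw [hy]
  exact h

/-- ∇_v J is a skew field, and covariant differentiation preserves skewness. Anti-commutation with J
is not preserved in this way, whence the projection in the vertical part. -/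
theorem modelNablaSq_skew (u v a b : Model m) :
    coordMetric g.inner p (extChartAt 𝓘(ℝ, Model m) p p) (J.modelNablaSq p u v a) b =
      -coordMetric g.inner p (extChartAt 𝓘(ℝ, Model m) p p) a (J.modelNablaSq p u v b) := by
  have hy := mem_extChartAt_target (I := 𝓘(ℝ, Model m)) p
  have hd := (J.fderiv_coordNabla p).1
  have h0 := fderiv_clm_apply_const hd v
  have h1 := covDeriv_skew (Γ := christoffel g.inner p)
    ((contDiffAt_coordMetric g hy).differentiableAt (by simp))
    (fderiv_metric g hy) h0.differentiableAt
    ((J.coordNabla_skew p).mono fun y hy ↦ hy v) u a b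
  have h2 := (J.coordNabla_skew p).self_of_nhds
    (christoffel g.inner p (extChartAt 𝓘(ℝ, Model m) p p) u v) a b
  rw [h0.fderiv] at h1
  rw [modelNablaSq, sub_apply, sub_apply, map_sub, map_sub, sub_apply, h2]
  refine (congrArg (· - _) h1).trans ?_
  rw [ContinuousLinearMap.flip_apply]
  ring

theorem coordNabla_self (u : Model m) :
    coordNabla g.inner J.J p (extChartAt 𝓘(ℝ, Model m) p p) u =
      connForm (J.section p) (J.localSection p (extChartAt 𝓘(ℝ, Model m) p p))
        (fderiv ℝ (J.localSection p) (extChartAt 𝓘(ℝ, Model m) p p) u) :=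
  DFunLike.congr_fun (J.eventually_coordNabla p).self_of_nhds u

end AlmostHermitian

namespace AlmostHermitian

variable {m : ℕ} {N : Type*} [TopologicalSpace N] [ChartedSpace (Model m) N]
  [IsManifold 𝓘(ℝ, Model m) ∞ N] {g : Metric m N} (J : AlmostHermitian g) (p : N)

theorem coordEnd_mul_self : modelEnd (J.J p) * modelEnd (J.J p) = -1 := by
  ext1 v
  exact J.J_J p v

theorem modelEnd_skew (a b : Model m) :
    coordMetric g.inner p (extChartAt 𝓘(ℝ, Model m) p p) (modelEnd (J.J p) a) b =
      -coordMetric g.inner p (extChartAt 𝓘(ℝ, Model m) p p) a (modelEnd (J.J p) b) := by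
  have h2 : modelEnd (J.J p) (modelEnd (J.J p) b) = -b := J.J_J p b
  have h1 : modelBilin g.inner p (modelEnd (J.J p) a) (modelEnd (J.J p) (modelEnd (J.J p) b)) =
      modelBilin g.inner p a (modelEnd (J.J p) b) := J.inner_J p a (modelEnd (J.J p) b)
  rw [h2, map_neg] at h1
  rw [coordMetric_self, coordMetric_self, ← h1, neg_neg]

theorem csField_section : csField (J.section p)
    (extChartAt 𝓘(ℝ, Model m × StdTangent m) (J.section p) (J.section p)) = modelEnd (J.J p) :=
  csField_self (J.section p)

theorem extChartAt_section_fst :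
    (extChartAt 𝓘(ℝ, Model m × StdTangent m) (J.section p) (J.section p)).1 =
      extChartAt 𝓘(ℝ, Model m) p p := by
  rw [← J.localSection_self]
  exact (J.eventually_csField_localSection p).self_of_nhds.2.2

/-- The vertical projection on the model space. -/
def modelVert (Q : Model m →L[ℝ] Model m) : Model m →L[ℝ] Model m :=
  (1 / 2 : ℝ) • ((1 / 2 : ℝ) • (Q + modelEnd (J.J p) * (Q * modelEnd (J.J p))))

/-- Of the two factors ½ in `modelVert`, one belongs to the projection and the other to the
symmetrised second derivative; neither affects the sign rule J(Q + JQJ) = -(Q + JQJ)J. -/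
theorem modelVert_anticomm (Q : Model m →L[ℝ] Model m) :
    J.modelVert p Q * modelEnd (J.J p) = -(modelEnd (J.J p) * J.modelVert p Q) := by
  have h := J.coordEnd_mul_self p
  have h1 : modelEnd (J.J p) * (Q * modelEnd (J.J p)) * modelEnd (J.J p) =
      -(modelEnd (J.J p) * Q) := by
    rw [mul_assoc, mul_assoc, h, mul_neg, mul_one, mul_neg]
  have h2 : modelEnd (J.J p) * (modelEnd (J.J p) * (Q * modelEnd (J.J p))) =
      -(Q * modelEnd (J.J p)) := by
    rw [← mul_assoc, h, neg_mul, one_mul]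
  rw [modelVert, smul_mul_assoc, smul_mul_assoc, mul_smul_comm, mul_smul_comm, add_mul, mul_add,
    h1, h2, ← smul_neg, ← smul_neg, neg_add, neg_neg, add_comm]

theorem modelVert_skew {Q : Model m →L[ℝ] Model m}
    (hQ : ∀ a b, coordMetric g.inner p (extChartAt 𝓘(ℝ, Model m) p p) (Q a) b =
      -coordMetric g.inner p (extChartAt 𝓘(ℝ, Model m) p p) a (Q b)) (a b : Model m) :
    coordMetric g.inner p (extChartAt 𝓘(ℝ, Model m) p p) (J.modelVert p Q a) b =
      -coordMetric g.inner p (extChartAt 𝓘(ℝ, Model m) p p) a (J.modelVert p Q b) := by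
  simp only [modelVert, smul_apply, add_apply, mul_apply_eq_comp, map_smul, map_add, smul_eq_mul]
  rw [J.modelEnd_skew, hQ, hQ, J.modelEnd_skew]
  ring

/-- The differential of the section, on the model space. -/
def sectionDeriv (u : Model m) : Model m × StdTangent m :=
  fderiv ℝ (J.localSection p) (extChartAt 𝓘(ℝ, Model m) p p) u

theorem modelEnd_nabla (u : Model m) :
    modelEnd ((J.J p).comp (nabla g.inner J.J p u)) = modelEnd (J.J p) *
      connForm (J.section p)
        (extChartAt 𝓘(ℝ, Model m × StdTangent m) (J.section p) (J.section p))
        (J.sectionDeriv p u) := by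
  rw [sectionDeriv, ← J.localSection_self, ← J.coordNabla_self]
  rfl

/-- The product of two anti-commuting skew endomorphisms is skew. This is the hypothesis under which
the two-vector of J ∘ ∇_u J has its trace interpretation. -/
theorem modelEnd_nabla_skew (u a b : Model m) :
    coordMetric g.inner p (extChartAt 𝓘(ℝ, Model m) p p)
        (modelEnd ((J.J p).comp (nabla g.inner J.J p u)) a) b =
      -coordMetric g.inner p (extChartAt 𝓘(ℝ, Model m) p p) a
        (modelEnd ((J.J p).comp (nabla g.inner J.J p u)) b) := by
  have hz := mem_extChartAt_target (I := 𝓘(ℝ, Model m × StdTangent m)) (J.section p)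
  have h1 := connForm_anticomm hz (J.sectionDeriv p u)
  have h2 := connForm_skew hz (J.sectionDeriv p u)
  rw [J.csField_section] at h1
  rw [J.extChartAt_section_fst] at h2
  have h3 := DFunLike.congr_fun h1 b
  rw [J.modelEnd_nabla, mul_apply_eq_comp, mul_apply_eq_comp, J.modelEnd_skew]
  refine (congrArg Neg.neg (h2 a (modelEnd (J.J p) b))).trans ?_
  have h4 := congrArg (coordMetric g.inner p (extChartAt 𝓘(ℝ, Model m) p p) a) h3
  rw [neg_apply, map_neg, mul_apply_eq_comp, mul_apply_eq_comp] at h4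
  rw [neg_neg]
  exact h4

/-- The horizontal lift of `R((J ∘ ∇_u J)^∧) v`, on the model space. -/
def curvatureLift (u v : Model m) : Model m × StdTangent m :=
  modelVec ((J.section p).horizontalLift (curvature g.inner p
    (hat g p ((J.J p).comp (nabla g.inner J.J p u))) v))

theorem connForm_curvatureLift (u v : Model m) :
    connForm (J.section p)
      (extChartAt 𝓘(ℝ, Model m × StdTangent m) (J.section p) (J.section p))
      (J.curvatureLift p u v) = 0 :=
  (horizontalLift_model (J.section p) _).2

theorem two_mul_coordMetric_curvatureLift (u v w : Model m) :
    2 * coordMetric g.inner p (extChartAt 𝓘(ℝ, Model m) p p) (J.curvatureLift p u v).1 w =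
      -traceL m (modelEnd (J.J p) * connForm (J.section p)
        (extChartAt 𝓘(ℝ, Model m × StdTangent m) (J.section p) (J.section p))
        (J.sectionDeriv p u) *
        coordCurvature g.inner p (extChartAt 𝓘(ℝ, Model m) p p) ![v, w]) := by
  have h := two_mul_inner_curvature_hat g p ((J.J p).comp (nabla g.inner J.J p u))
    (J.modelEnd_nabla_skew p u) v w
  have h1 : (J.curvatureLift p u v).1 = modelEnd (curvature g.inner p
      (hat g p ((J.J p).comp (nabla g.inner J.J p u)))) v :=
    (horizontalLift_model (J.section p) _).1
  rw [h1, h, J.modelEnd_nabla, traceL_apply]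

/-- The vertical part of the second fundamental form, on the model space. -/
def verticalPart (u v : Model m) : Model m × StdTangent m :=
  modelVec ((J.section p).verticalVector
    (J.modelVert p (J.modelNablaSq p u v + J.modelNablaSq p v u)))

theorem verticalPart_spec (u v : Model m) : (J.verticalPart p u v).1 = 0 ∧
    connForm (J.section p)
      (extChartAt 𝓘(ℝ, Model m × StdTangent m) (J.section p) (J.section p))
      (J.verticalPart p u v) = J.modelVert p (J.modelNablaSq p u v + J.modelNablaSq p v u) := by
  refine verticalVector_model (J.modelVert_skew p fun a b ↦ ?_) (J.modelVert_anticomm p _)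
  rw [add_apply, add_apply, map_add, map_add, add_apply, J.modelNablaSq_skew,
    J.modelNablaSq_skew, neg_add]

/-- The second covariant derivative in exactly the terms that occur in the second fundamental form:
the derivative of K, the second derivative of the section, and two Christoffel corrections. -/
theorem modelNablaSq_eq (u v : Model m) : J.modelNablaSq p u v =
    fderiv ℝ (connForm (J.section p))
        (extChartAt 𝓘(ℝ, Model m × StdTangent m) (J.section p) (J.section p))
        (J.sectionDeriv p u) (J.sectionDeriv p v) +
      connForm (J.section p)
        (extChartAt 𝓘(ℝ, Model m × StdTangent m) (J.section p) (J.section p))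
        (fderiv ℝ (fderiv ℝ (J.localSection p)) (extChartAt 𝓘(ℝ, Model m) p p) u v) +
      commutator (connForm (J.section p)
        (extChartAt 𝓘(ℝ, Model m × StdTangent m) (J.section p) (J.section p))
        (J.sectionDeriv p v)) (christoffel g.inner p (extChartAt 𝓘(ℝ, Model m) p p) u) -
      connForm (J.section p)
        (extChartAt 𝓘(ℝ, Model m × StdTangent m) (J.section p) (J.section p))
        (J.sectionDeriv p (christoffel g.inner p (extChartAt 𝓘(ℝ, Model m) p p) u v)) := by
  have h1 := (J.fderiv_coordNabla p).2 u v
  have h2 := J.coordNabla_self p v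
  have h3 := J.coordNabla_self p
    (christoffel g.inner p (extChartAt 𝓘(ℝ, Model m) p p) u v)
  rw [J.localSection_self] at h1 h2 h3
  exact congrArg₂ (· - ·) (congrArg₂ (· + ·) h1 (congrArg (fun A ↦ commutator A
    (christoffel g.inner p (extChartAt 𝓘(ℝ, Model m) p p) u)) h2)) h3

theorem sectionDeriv_fst (u : Model m) : (J.sectionDeriv p u).1 = u :=
  J.fderiv_localSection_fst p u

set_option maxHeartbeats 2000000 in
/-- The second fundamental form of the section, on the model space. -/
theorem secondFundamentalForm_model (hm : m ≠ 0) {t : ℝ} (ht : 0 < t) (u v : Model m) :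
    fderiv ℝ (fderiv ℝ (J.localSection p)) (extChartAt 𝓘(ℝ, Model m) p p) u v -
        J.sectionDeriv p (christoffel g.inner p (extChartAt 𝓘(ℝ, Model m) p p) u v) +
        christoffel (twistorMetric g t) (J.section p)
          (extChartAt 𝓘(ℝ, Model m × StdTangent m) (J.section p) (J.section p))
          (J.sectionDeriv p u) (J.sectionDeriv p v) =
      J.verticalPart p u v -
        (2 * t / (2 * m : ℝ)) • (J.curvatureLift p u v + J.curvatureLift p v u) := by
  have hz := mem_extChartAt_target (I := 𝓘(ℝ, Model m × StdTangent m)) (J.section p)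
  have hy := mem_extChartAt_target (I := 𝓘(ℝ, Model m)) p
  have hB : (coordMetric (twistorMetric g t) (J.section p)
      (extChartAt 𝓘(ℝ, Model m × StdTangent m) (J.section p) (J.section p))).IsInvertible :=
    isInvertible_of_separating fun ξ h ↦ coordMetric_twistor_separating hm ht h
  have hc := coordMetric_christoffel hB (J.sectionDeriv p u) (J.sectionDeriv p v)
  have hc' := christoffelFirst_twistor t hz (J.sectionDeriv p u) (J.sectionDeriv p v)
  have hh := coordMetric_twistorMetric' t hz
  have hK := connForm_anticomm hz
  have hy1 := J.extChartAt_section_fst p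
  rw [hy1, J.csField_section, J.sectionDeriv_fst, J.sectionDeriv_fst] at hc'
  rw [hy1] at hh
  rw [J.csField_section] at hK
  -- Symmetry of the second derivative and of Γ gives both orders of the second covariant derivative
  -- the same K(d²s) and the same K(ds Γ).
  have hs : fderiv ℝ (fderiv ℝ (J.localSection p)) (extChartAt 𝓘(ℝ, Model m) p p) v u =
      fderiv ℝ (fderiv ℝ (J.localSection p)) (extChartAt 𝓘(ℝ, Model m) p p) u v :=
    (((J.contDiffAt_localSection p).of_le (m := 2) (by norm_cast)).isSymmSndFDerivAt
      (by simp)).eq v u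
  have hq₂ := J.modelNablaSq_eq p v u
  rw [hs, metric_christoffel_symm g hy v u] at hq₂
  have hΓ := coordMetric_christoffel (isInvertible_coordMetric g hy) u v
  obtain ⟨hV, hV'⟩ := J.verticalPart_spec p u v
  -- The difference of the two sides is h_t-orthogonal to every ζ.
  refine sub_eq_zero.1 (coordMetric_twistor_separating (σ := J.section p) hm ht fun ζ ↦ ?_)
  exact secondFundamentalForm_test (traceL m) traceL_mul_comm (by ring) hh
    (J.coordEnd_mul_self p) hK
    (R := fun u v ↦ coordCurvature g.inner p (extChartAt 𝓘(ℝ, Model m) p p) ![u, v])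
    (J.fderiv_fderiv_localSection_fst p u v) (J.sectionDeriv_fst p _) hΓ
    (fun ζ ↦ (hc ζ).trans (hc' ζ)) (J.modelNablaSq_eq p u v) hq₂ hV hV'
    (J.connForm_curvatureLift p u v) (J.two_mul_coordMetric_curvatureLift p u v)
    (J.connForm_curvatureLift p v u) (J.two_mul_coordMetric_curvatureLift p v u) ζ

end AlmostHermitian

/-- In dimension zero the twistor charts take values in a point, so all tangent vectors there
coincide. -/
instance subsingleton_twistorModel : Subsingleton (Model 0 × StdTangent 0) :=
  haveI : Subsingleton (Model 0) := inferInstanceAs (Subsingleton (EuclideanSpace ℝ (Fin 0)))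
  haveI : Subsingleton (StdTangent 0) :=
    ⟨fun _ _ ↦ Subtype.ext (ContinuousLinearMap.ext fun _ ↦ Subsingleton.elim _ _)⟩
  inferInstance

end Twistor

end

theorem proposition1 {m : ℕ} {N : Type*} [TopologicalSpace N] [ChartedSpace (Twistor.Model m) N]
    [IsManifold 𝓘(ℝ, Twistor.Model m) ∞ N] (g : Twistor.Metric m N) (J : Twistor.AlmostHermitian g)
    (t : ℝ) (ht : 0 < t) (p : N) (X Y : TangentSpace 𝓘(ℝ, Twistor.Model m) p) :
    Twistor.secondFundamentalForm g.inner (Twistor.twistorMetric g t) J.section p X Y =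
      (J.section p).verticalVector ((1 / 2 : ℝ) • (J.section p).verticalProj
        (Twistor.nablaSq g.inner J.J p X Y + Twistor.nablaSq g.inner J.J p Y X)) -
      (2 * t / (2 * m : ℝ)) •
        ((J.section p).horizontalLift (Twistor.curvature g.inner p
            (Twistor.hat g p ((J.J p).comp (Twistor.nabla g.inner J.J p X))) Y) +
          (J.section p).horizontalLift (Twistor.curvature g.inner p
            (Twistor.hat g p ((J.J p).comp (Twistor.nabla g.inner J.J p Y))) X)) := by
  obtain rfl | hm := eq_or_ne m 0
  -- The division by 2m has its default value here, but both sides lie in a zero space.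
  · exact Twistor.subsingleton_twistorModel.elim _ _
  -- All the tensors in the statement are defined in the charts at p and J(p), so it unfolds to the
  -- identity on the model space.
  · exact J.secondFundamentalForm_model p hm ht X Y
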